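/- Let $\mathcal K$ be a separable complex Hilbert space and let $(V_t)_{t\ge 0}$ be a $C_0$-semigroup (strongly continuous one-parameter semigroup) of isometries in $\mathcal K$. Its deficiency index is $\dim(\operatorname{Ran}(d+I))^\perp\in\{0,1,2,\dots,\infty\}$, where $d$ is the generator of $(V_t)$. An isometry is called completely nonunitary if no nonzero closed subspace reduces it to a unitary operator. Let $\mathcal K=\mathcal K_0\oplus\mathcal K_1$ be the Wold decomposition: $\mathcal K_0$ reduces $(V_t)$ to a semigroup of unitaries, and $\mathcal K_1$ reduces each $V_t$, $t>0$, to a completely nonunitary isometry. Suppose that $(V_t)$ has deficiency index $n>0$ ($n=\infty$ is allowed) and satisfies condition N: the unitary part is uniformly continuous, i.e. $\|V_t|_{\mathcal K_0}-V_s|_{\mathcal K_0}\|\to 0$ as $t\to s$, for all $s\ge 0$ ($t\ge 0$). Then there is a $C_0$-semigroup $(S_t)_{t\ge 0}$ of isometries in $\mathcal K$, with $S_t$ completely nonunitary for all $t>0$, which has deficiency index $n$ and approximates $(V_t)$ in the following sense: there are a Hilbert space $\mathcal K'\supseteq\mathcal K$ and $C_0$-semigroups of unitaries $(S'_t)_{t\ge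 0}$ and $(V'_t)_{t\ge 0}$ in $\mathcal K'$ which are minimal unitary dilations of $(S_t)$ and $(V_t)$ respectively, such that for all $t\ge 0$ the operator $S'_t-V'_t$ is Hilbert–Schmidt and $S'_tV_t'^{*}|_{\mathcal K'\ominus\mathcal K}=I$. -/

import Mathlib

open scoped NNReal Topology InnerProductSpace

noncomputable section

namespace IsometricSemigroup

universe u

variable {K : Type u} [NormedAddCommGroup K] [InnerProductSpace ℂ K]

/-- `T` is a `C₀`-semigroup: a strongly continuous one-parameter semigroup of bounded operators. -/
structure IsC0Semigroup (T : ℝ≥0 → K →L[ℂ] K) : Prop where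
  map_zero : T 0 = ContinuousLinearMap.id ℂ K
  map_add : ∀ s t, T (s + t) = T s ∘L T t
  continuous : ∀ x, Continuous fun t => T t x

/-- `T` is a `C₀`-semigroup of isometries. -/
structure IsC0Isometric (T : ℝ≥0 → K →L[ℂ] K) : Prop extends IsC0Semigroup T where
  norm_map : ∀ t x, ‖T t x‖ = ‖x‖

/-- `T` is a `C₀`-semigroup of unitaries. -/
structure IsC0Unitary [CompleteSpace K] (T : ℝ≥0 → K →L[ℂ] K) : Prop
    extends IsC0Semigroup T where
  unitary : ∀ t, T t ∈ unitary (K →L[ℂ] K)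

/-! ### Generator and deficiency index -/

/-- `y` is the right derivative at `0` of the orbit `t ↦ T t x`. -/
def HasGeneratorAt (T : ℝ≥0 → K →L[ℂ] K) (x y : K) : Prop :=
  Filter.Tendsto (fun t : ℝ≥0 => (((t : ℝ) : ℂ))⁻¹ • (T t x - x)) (𝓝[>] 0) (𝓝 y)

theorem HasGeneratorAt.add {T : ℝ≥0 → K →L[ℂ] K} {x y x' y' : K}
    (h : HasGeneratorAt T x y) (h' : HasGeneratorAt T x' y') :
    HasGeneratorAt T (x + x') (y + y') := by
  refine (Filter.Tendsto.add h h').congr fun t => ?_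
  rw [← smul_add, map_add]
  congr 1
  abel

theorem HasGeneratorAt.smul {T : ℝ≥0 → K →L[ℂ] K} {x y : K} (c : ℂ)
    (h : HasGeneratorAt T x y) : HasGeneratorAt T (c • x) (c • y) := by
  refine (Filter.Tendsto.const_smul h c).congr fun t => ?_
  rw [smul_comm, map_smul, smul_sub]

theorem HasGeneratorAt.unique {T : ℝ≥0 → K →L[ℂ] K} {x y y' : K}
    (h : HasGeneratorAt T x y) (h' : HasGeneratorAt T x y') : y = y' :=
  tendsto_nhds_unique h h'

/-- The (in general unbounded) generator `d x = lim_{t → 0+} (T t x - x) / t`, on the domain of all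
`x` for which the limit exists. -/
def generator (T : ℝ≥0 → K →L[ℂ] K) : K →ₗ.[ℂ] K where
  domain :=
    { carrier := {x | ∃ y, HasGeneratorAt T x y}
      zero_mem' := ⟨0, by simp [HasGeneratorAt]⟩
      add_mem' := fun ⟨_, h⟩ ⟨_, h'⟩ => ⟨_, h.add h'⟩
      smul_mem' := fun c _ ⟨_, h⟩ => ⟨_, h.smul c⟩ }
  toFun :=
    { toFun := fun x => x.2.choose
      map_add' := fun x x' =>
        (x + x').2.choose_spec.unique (x.2.choose_spec.add x'.2.choose_spec)
      map_smul' := fun c x => (c • x).2.choose_spec.unique (x.2.choose_spec.smul c) }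

/-- The deficiency subspace `(Ran (d + 1))ᗮ = Ker (d* + 1)` of the generator `d` of `T`. If `T`
consists of isometries, then `d` is skew-symmetric and `Ran (d - 1)` is the whole space, so that
this is the only deficiency subspace which can be nonzero. -/
def deficiencySubspace (T : ℝ≥0 → K →L[ℂ] K) : Submodule ℂ K :=
  (LinearMap.range ((generator T).toFun + (generator T).domain.subtype))ᗮ

/-- The deficiency index of a `C₀`-semigroup of isometries on a separable space: the dimension of
the deficiency subspace of the generator, `⊤` standing for the countably infinite (Hilbert)
dimension. -/
def deficiencyIndex (T : ℝ≥0 → K →L[ℂ] K) : ℕ∞ :=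
  Cardinal.toENat (Module.rank ℂ (deficiencySubspace T))

/-! ### Completely nonunitary isometries, Wold decomposition -/

section Wold

variable [CompleteSpace K]

/-- The closed subspace `L` reduces the operator `W` to a unitary operator on `L`. -/
structure ReducesToUnitary (W : K →L[ℂ] K) (L : Submodule ℂ K) : Prop where
  isClosed : IsClosed (L : Set K)
  map_mem : ∀ x ∈ L, W x ∈ L
  adjoint_mem : ∀ x ∈ L, ContinuousLinearMap.adjoint W x ∈ L
  norm_map : ∀ x ∈ L, ‖W x‖ = ‖x‖
  surj : ∀ y ∈ L, ∃ x ∈ L, W x = y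

/-- `W` is a completely nonunitary isometry. -/
structure IsCompletelyNonunitary (W : K →L[ℂ] K) : Prop where
  norm_map : ∀ x, ‖W x‖ = ‖x‖
  eq_bot : ∀ L : Submodule ℂ K, ReducesToUnitary W L → L = ⊥

/-- `S` is a `C₀`-semigroup of completely nonunitary isometries (`S 0 = 1` being excepted). -/
structure IsC0CompletelyNonunitary (S : ℝ≥0 → K →L[ℂ] K) : Prop extends IsC0Isometric S where
  completelyNonunitary : ∀ t, 0 < t → IsCompletelyNonunitary (S t)

/-- `K = K₀ ⊕ K₀ᗮ` is the Wold decomposition of the semigroup of isometries `V`: the subspace `K₀`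
reduces `V` to unitaries, and `K₀ᗮ` (which then reduces `V` as well) reduces it to completely
nonunitary isometries. -/
structure IsWoldDecomposition (V : ℝ≥0 → K →L[ℂ] K) (K₀ : Submodule ℂ K) : Prop where
  unitary : ∀ t, ReducesToUnitary (V t) K₀
  completelyNonunitary : ∀ t, 0 < t → ∀ L : Submodule ℂ K, L ≤ K₀ᗮ →
    ReducesToUnitary (V t) L → L = ⊥

theorem adjoint_apply_of_isometric {W : K →L[ℂ] K} (hW : ∀ x, ‖W x‖ = ‖x‖) (x : K) :
    ContinuousLinearMap.adjoint W (W x) = x := by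
  have h := (ContinuousLinearMap.norm_map_iff_adjoint_comp_self W).1 hW
  exact congrArg (fun A : K →L[ℂ] K => A x) h

/-- Every `C₀`-semigroup of isometries has a Wold decomposition, so that condition `N` below does
not presuppose anything. -/
theorem exists_isWoldDecomposition {V : ℝ≥0 → K →L[ℂ] K} (hV : IsC0Isometric V) :
    ∃ K₀ : Submodule ℂ K, IsWoldDecomposition V K₀ := by
  have hle : ∀ {s t : ℝ≥0} {x : K}, s ≤ t → (∃ y, V t y = x) → ∃ y, V s y = x := by
    rintro s t x hst ⟨y, rfl⟩
    obtain ⟨r, rfl⟩ := exists_add_of_le hst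
    exact ⟨V r y, by rw [hV.map_add]; rfl⟩
  have hmem : ∀ x, x ∈ (⨅ t, (V t).range : Submodule ℂ K) ↔ ∀ t, ∃ y, V t y = x := by
    intro x
    simp [Submodule.mem_iInf]
  have hadj : ∀ s, ∀ x ∈ (⨅ t, (V t).range : Submodule ℂ K),
      ContinuousLinearMap.adjoint (V s) x ∈ (⨅ t, (V t).range : Submodule ℂ K) := by
    intro s x hx
    rw [hmem] at hx ⊢
    intro t
    obtain ⟨y, rfl⟩ := hx (s + t)
    refine ⟨y, ?_⟩
    rw [hV.map_add, ContinuousLinearMap.comp_apply, adjoint_apply_of_isometric (hV.norm_map s)]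
  refine ⟨⨅ t, (V t).range, fun s => ⟨?_, ?_, hadj s, fun x _ => hV.norm_map s x, ?_⟩, ?_⟩
  · rw [Submodule.coe_iInf]
    refine isClosed_iInter fun t => ?_
    have hi : Isometry (V t) := AddMonoidHomClass.isometry_of_norm _ (hV.norm_map t)
    exact hi.isClosedEmbedding.isClosed_range
  · intro x hx
    rw [hmem] at hx ⊢
    intro t
    obtain ⟨y, rfl⟩ := hx t
    refine hle (le_add_self : t ≤ s + t) ⟨y, ?_⟩
    rw [hV.map_add]; rfl
  · intro y hy
    refine ⟨_, hadj s y hy, ?_⟩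
    obtain ⟨z, rfl⟩ := (hmem y).1 hy s
    rw [adjoint_apply_of_isometric (hV.norm_map s)]
  · intro t ht L hL hLt
    rw [eq_bot_iff]
    intro x hx
    have hn : ∀ n : ℕ, ∀ y ∈ L, ∃ z ∈ L, V (n * t) z = y := by
      intro n
      induction n with
      | zero => intro y hy; exact ⟨y, hy, by simp [hV.map_zero]⟩
      | succ n ih =>
        intro y hy
        obtain ⟨z, hz, rfl⟩ := ih y hy
        obtain ⟨w, hw, rfl⟩ := hLt.surj z hz
        exact ⟨w, hw, by push_cast; rw [add_mul, one_mul, hV.map_add]; rfl⟩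
    have hx0 : x ∈ (⨅ t, (V t).range : Submodule ℂ K) := by
      rw [hmem]
      intro s
      obtain ⟨n, hns⟩ := exists_nat_ge (s / t)
      obtain ⟨z, _, hz⟩ := hn n x hx
      exact hle ((div_le_iff₀ ht).1 hns) ⟨z, hz⟩
    have h0 : ⟪x, x⟫_ℂ = 0 := Submodule.inner_right_of_mem_orthogonal hx0 (hL hx)
    simpa using h0

/-- Condition `N`: the unitary part `(V t|K₀)` of `V` is uniformly continuous, that is continuous
in `t` for the operator norm. -/
def ConditionN (V : ℝ≥0 → K →L[ℂ] K) : Prop :=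
  ∃ K₀ : Submodule ℂ K, IsWoldDecomposition V K₀ ∧
    Continuous fun t => V t ∘L K₀.subtypeL

end Wold

/-! ### Approximation in the Hilbert–Schmidt sense -/

/-- `A` is a Hilbert–Schmidt operator: `∑ ‖A e‖² < ∞` along an orthonormal basis. -/
def IsHilbertSchmidt (A : K →L[ℂ] K) : Prop :=
  ∃ (w : Set K) (b : HilbertBasis w ℂ K), Summable fun i => ‖A (b i)‖ ^ 2

/-- `V'` is a minimal unitary dilation of `V`, the space `K` of `V` being embedded in the space `K'`
of `V'` by the linear isometry `ι`. -/
structure IsMinimalUnitaryDilation {K' : Type u} [NormedAddCommGroup K'] [InnerProductSpace ℂ K']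
    [CompleteSpace K'] (ι : K →ₗᵢ[ℂ] K') (V : ℝ≥0 → K →L[ℂ] K) (V' : ℝ≥0 → K' →L[ℂ] K') :
    Prop where
  isC0Unitary : IsC0Unitary V'
  dilation : ∀ t x y, ⟪ι x, V' t (ι y)⟫_ℂ = ⟪x, V t y⟫_ℂ
  minimal : (Submodule.span ℂ
    {z | ∃ t x, z = V' t (ι x) ∨ z = ContinuousLinearMap.adjoint (V' t) (ι x)}).topologicalClosure
      = ⊤

/-- The `C₀`-semigroups of isometries `U` and `V` in `K` approximate each other: they have minimal
unitary dilations `U'`, `V'` in a common Hilbert space `K' ⊇ K` such that `U' t - V' t` is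
Hilbert–Schmidt and `U' t (V' t)*` is the identity on `K' ⊖ K`, for all `t ≥ 0`. -/
def Approximates (U V : ℝ≥0 → K →L[ℂ] K) : Prop :=
  ∃ (K' : Type u) (_ : NormedAddCommGroup K') (_ : InnerProductSpace ℂ K') (_ : CompleteSpace K')
    (ι : K →ₗᵢ[ℂ] K') (U' V' : ℝ≥0 → K' →L[ℂ] K'),
    IsMinimalUnitaryDilation ι U U' ∧ IsMinimalUnitaryDilation ι V V' ∧
    ∀ t, IsHilbertSchmidt (U' t - V' t) ∧
      ∀ z ∈ (LinearMap.range ι.toLinearMap)ᗮ, U' t (ContinuousLinearMap.adjoint (V' t) z) = z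

end IsometricSemigroup

end

/-! The unitary part of `V` is to be absorbed into a shift at the cost of Hilbert–Schmidt operators
only. Positive deficiency supplies the shift: a unit vector `h` with `(V t)* h = e^{-t} h` yields a
cocycle `b` with orthogonal increments (`exists_isOrthogonalCocycle`), whose closed span `Z ⊆ K₀ᗮ`
reduces `V` to the shift on `L²(0, ∞)`, with `b t` in the role of the indicator of `(0, t]`.

By condition N the unitary part is `exp (t B)` with `B` bounded and skew-adjoint. The theorem of
Weyl and von Neumann makes `B` diagonal up to a Hilbert–Schmidt operator, and a further triangular
Hilbert–Schmidt correction turns it into `G` with `G + G* = -|g⟩⟨g|` and `exp (t G)* → 0` strongly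
(`exists_stable_perturbation`). The energy that `E t = exp (t G)` loses through `g` is emitted into
the shift: setting `T t x = E t x + ∫ ⟪g, E (t - r) x⟫ db r` over `(0, t]` for `x` in `K₀`, and `T =
V` on `K₀ᗮ`, gives a semigroup of isometries (`exists_coupling`). `T t - V t` is Hilbert–Schmidt, by
Duhamel's formula for `E` and because the integral term is a Carleman operator.

The outgoing cocycle `β t = b t - ∫ T r g dr` is orthogonal for `T` and has the Gram matrix of `b`.
Stability, norm continuity and complete nonunitarity on `K₀ᗮ` together show that `β` and `K₀ᗮ ∩ Zᗮ`
span `K` (`eq_zero_of_orthogonal`). Hence sending `b` to `β`, fixing `K₀ᗮ ∩ Zᗮ` and killing `K₀`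
defines a coisometry `Ω` with kernel `K₀` and `Ω V = T Ω`. The required semigroup is `S = Ω V Ω*`,
which is `T` again; through `Ω*` it is unitarily equivalent to `V` on `K₀ᗮ`, so it is completely
nonunitary and has the deficiency index of `V`.

In the space `K'` of the dilation `V'`, let `X` be `Ω` on `K` and the identity on `K' ⊖ K`. The
kernel `K₀` of `X` reduces `V'` to unitaries, so `S' = X V' X*` is unitary and is a minimal dilation
of `S`. Since `(V' t)*` preserves `K' ⊖ K`, where `X` is the identity, `S' t (V' t)*` is the
identity there. Finally `X V' - V' X` equals `Ω V - V Ω = (T - V) Ω` on `K` and factors through `(Ω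
- 1)(1 - V V*)` on `K' ⊖ K`; both operators are Hilbert–Schmidt. -/

namespace IsometricSemigroup

/-! ### Hilbert–Schmidt operators -/

section HilbertSchmidt

variable {E F F' : Type*} [NormedAddCommGroup E] [InnerProductSpace ℂ E]
  [NormedAddCommGroup F] [InnerProductSpace ℂ F] [NormedAddCommGroup F'] [InnerProductSpace ℂ F']

/-- The sums `∑ ‖A e‖²` over finite orthonormal sets are bounded. -/
def HasFiniteHSNorm (A : E →L[ℂ] F) : Prop :=
  ∃ C : ℝ, ∀ s : Finset E, Orthonormal ℂ (fun e : s => (e : E)) → ∑ e ∈ s, ‖A e‖ ^ 2 ≤ C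

theorem sum_norm_inner_sq_le {s : Finset E} (hs : Orthonormal ℂ (fun e : s => (e : E))) (x : E) :
    ∑ e ∈ s, ‖⟪e, x⟫_ℂ‖ ^ 2 ≤ ‖x‖ ^ 2 := by
  rw [← Finset.sum_coe_sort]
  exact hs.sum_inner_products_le x (s := Finset.univ)

theorem hasSum_norm_inner_sq {ι : Type*} (b : HilbertBasis ι ℂ E) (x : E) :
    HasSum (fun i => ‖⟪b i, x⟫_ℂ‖ ^ 2) (‖x‖ ^ 2) := by
  have h2 := Complex.hasSum_re (b.hasSum_inner_mul_inner x x)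
  rw [inner_self_eq_norm_sq_to_K] at h2
  have e1 : (((‖x‖ : ℝ) : ℂ) ^ 2).re = ‖x‖ ^ 2 := by norm_cast
  simp only [Complex.coe_algebraMap] at h2
  rw [e1] at h2
  refine h2.congr_fun fun i => ?_
  rw [← inner_conj_symm x (b i), mul_comm, RCLike.mul_conj]
  norm_cast

theorem orthonormal_image {ι : Type*} [DecidableEq E] {v : ι → E} (hv : Orthonormal ℂ v)
    (u : Finset ι) : Orthonormal ℂ (fun e : u.image v => (e : E)) := by
  have h := hv.toSubtypeRange
  exact h.comp (fun e : u.image v => (⟨e, by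
    obtain ⟨i, -, hi⟩ := Finset.mem_image.1 e.2
    exact ⟨i, hi⟩⟩ : Set.range v)) (fun a b hab => by
      exact Subtype.ext (congrArg (fun z : Set.range v => (z : E)) hab))

theorem HasFiniteHSNorm.exists_bound {A : E →L[ℂ] F} (hA : HasFiniteHSNorm A) :
    ∃ C : ℝ, ∀ (ι : Type _) (v : ι → E), Orthonormal ℂ v →
      ∀ u : Finset ι, ∑ i ∈ u, ‖A (v i)‖ ^ 2 ≤ C := by
  classical
  obtain ⟨C, hC⟩ := hA
  refine ⟨C, fun ι v hv u => ?_⟩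
  rw [← Finset.sum_image (f := fun e => ‖A e‖ ^ 2) (g := v)
    (hv.linearIndependent.injective.injOn)]
  exact hC _ (orthonormal_image hv u)

/-- Parseval in the basis and Bessel in the finite set, applied to the double sum of `|⟪b i, A* f⟫|²
= |⟪f, A (b i)⟫|²`. Used twice, it shows that the choice of the basis is immaterial. -/
theorem hasFiniteHSNorm_adjoint_of_basis [CompleteSpace E] [CompleteSpace F] {ι : Type*}
    (b : HilbertBasis ι ℂ E) (A : E →L[ℂ] F) {C : ℝ}
    (h : ∀ u : Finset ι, ∑ i ∈ u, ‖A (b i)‖ ^ 2 ≤ C) :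
    HasFiniteHSNorm (ContinuousLinearMap.adjoint A) := by
  refine ⟨C, fun s hs => ?_⟩
  refine hasSum_le_of_sum_le (hasSum_sum fun f _ => hasSum_norm_inner_sq b _) fun u => ?_
  refine le_trans (Finset.sum_le_sum fun i _ => ?_) (h u)
  refine le_trans (Finset.sum_le_sum fun f _ => ?_) (sum_norm_inner_sq_le hs (A (b i)))
  rw [ContinuousLinearMap.adjoint_inner_right, ← inner_conj_symm, RCLike.norm_conj]

theorem HasFiniteHSNorm.adjoint [CompleteSpace E] [CompleteSpace F] {A : E →L[ℂ] F}
    (hA : HasFiniteHSNorm A) : HasFiniteHSNorm (ContinuousLinearMap.adjoint A) := by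
  obtain ⟨w, b, -⟩ := exists_hilbertBasis ℂ E
  obtain ⟨C, hC⟩ := hA.exists_bound
  exact hasFiniteHSNorm_adjoint_of_basis b A (hC _ b b.orthonormal)

theorem hasFiniteHSNorm_of_basis [CompleteSpace E] [CompleteSpace F] {ι : Type*}
    (b : HilbertBasis ι ℂ E) (A : E →L[ℂ] F) (h : Summable fun i => ‖A (b i)‖ ^ 2) :
    HasFiniteHSNorm A := by
  have := (hasFiniteHSNorm_adjoint_of_basis b A
    (fun u => h.sum_le_tsum u fun _ _ => by positivity)).adjoint
  rwa [ContinuousLinearMap.adjoint_adjoint] at this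

theorem HasFiniteHSNorm.add {A B : E →L[ℂ] F} (hA : HasFiniteHSNorm A)
    (hB : HasFiniteHSNorm B) : HasFiniteHSNorm (A + B) := by
  obtain ⟨C, hC⟩ := hA
  obtain ⟨D, hD⟩ := hB
  refine ⟨2 * (C + D), fun s hs => ?_⟩
  refine le_trans (Finset.sum_le_sum (g := fun e => 2 * (‖A e‖ ^ 2 + ‖B e‖ ^ 2)) fun e _ => ?_) ?_
  · have h1 := norm_add_le (A e) (B e)
    have h2 : ‖(A + B) e‖ ^ 2 ≤ (‖A e‖ + ‖B e‖) ^ 2 := by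
      gcongr
      exact h1
    nlinarith [sq_nonneg (‖A e‖ - ‖B e‖)]
  · rw [← Finset.mul_sum, Finset.sum_add_distrib]
    linarith [hC s hs, hD s hs]

theorem HasFiniteHSNorm.comp_left {A : E →L[ℂ] F} (hA : HasFiniteHSNorm A) (B : F →L[ℂ] F') :
    HasFiniteHSNorm (B ∘L A) := by
  obtain ⟨C, hC⟩ := hA
  refine ⟨‖B‖ ^ 2 * C, fun s hs => ?_⟩
  refine le_trans (Finset.sum_le_sum (g := fun e => ‖B‖ ^ 2 * ‖A e‖ ^ 2) fun e _ => ?_) ?_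
  · rw [← mul_pow]
    gcongr
    exact B.le_opNorm _
  · rw [← Finset.mul_sum]
    exact mul_le_mul_of_nonneg_left (hC s hs) (by positivity)

theorem HasFiniteHSNorm.comp_right [CompleteSpace E] [CompleteSpace F] [CompleteSpace F']
    {A : E →L[ℂ] F} (hA : HasFiniteHSNorm A) (B : F' →L[ℂ] E) :
    HasFiniteHSNorm (A ∘L B) := by
  have := (hA.adjoint.comp_left (ContinuousLinearMap.adjoint B)).adjoint
  rwa [← ContinuousLinearMap.adjoint_comp, ContinuousLinearMap.adjoint_adjoint] at this

theorem HasFiniteHSNorm.isHilbertSchmidt [CompleteSpace E] {A : E →L[ℂ] E}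
    (hA : HasFiniteHSNorm A) : IsHilbertSchmidt A := by
  obtain ⟨w, b, -⟩ := exists_hilbertBasis ℂ E
  obtain ⟨C, hC⟩ := hA.exists_bound
  exact ⟨w, b, summable_of_sum_le (fun _ => by positivity) (hC _ b b.orthonormal)⟩

/-- Operators dominated by a Carleman kernel are Hilbert–Schmidt. -/
theorem hasFiniteHSNorm_of_le_integral {A : E →L[ℂ] F} {t : ℝ} (ht : 0 ≤ t) {u : ℝ → E}
    (hu : Continuous u) (h : ∀ x, ‖A x‖ ^ 2 ≤ ∫ s in (0 : ℝ)..t, ‖⟪x, u s⟫_ℂ‖ ^ 2) :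
    HasFiniteHSNorm A := by
  refine ⟨∫ s in (0 : ℝ)..t, ‖u s‖ ^ 2, fun s hs => ?_⟩
  refine le_trans (Finset.sum_le_sum fun e _ => h e) ?_
  rw [← intervalIntegral.integral_finsetSum fun e _ =>
    Continuous.intervalIntegrable (by fun_prop) _ _]
  exact intervalIntegral.integral_mono_on ht
    (Continuous.intervalIntegrable (by fun_prop) _ _)
    (Continuous.intervalIntegrable (by fun_prop) _ _) fun r _ => sum_norm_inner_sq_le hs (u r)

/-- Operators dominated by an average of unitary transforms of a Hilbert–Schmidt operator. -/
theorem hasFiniteHSNorm_of_le_integral_comp {A : E →L[ℂ] F} {N : E →L[ℂ] F'}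
    (hN : HasFiniteHSNorm N) {t c : ℝ} (ht : 0 ≤ t) (hc : 0 ≤ c) {U : ℝ → E →ₗᵢ[ℂ] E}
    (hU : ∀ x, Continuous fun s => U s x)
    (h : ∀ x, ‖A x‖ ^ 2 ≤ c * ∫ s in (0 : ℝ)..t, ‖N (U s x)‖ ^ 2) :
    HasFiniteHSNorm A := by
  obtain ⟨C, hC⟩ := hN.exists_bound
  refine ⟨c * (t * C), fun s hs => ?_⟩
  refine le_trans (Finset.sum_le_sum fun e _ => h e) ?_
  have hi : ∀ e, Continuous fun s => ‖N (U s e)‖ ^ 2 := fun e =>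
    (N.continuous.comp (hU e)).norm.pow 2
  rw [← Finset.mul_sum, ← intervalIntegral.integral_finsetSum fun e _ =>
    (hi e).intervalIntegrable _ _]
  refine mul_le_mul_of_nonneg_left ?_ hc
  have : t * C = ∫ _ in (0 : ℝ)..t, C := by simp
  rw [this]
  refine intervalIntegral.integral_mono_on ht
    ((continuous_finsetSum _ fun e _ => hi e).intervalIntegrable _ _)
    (by simp) fun r _ => ?_
  -- For fixed `r`, `U r` carries the orthonormal set to an orthonormal family, so the bound for `N`
  -- applies uniformly in `r`.
  rw [← Finset.sum_coe_sort]
  exact hC s (fun e => U r e) (hs.comp_linearIsometry (U r)) Finset.univ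

end HilbertSchmidt

/-! ### Isometries from Gram matrices, semigroups from right continuity -/

/-- Equal Gram matrices give equal norms of linear combinations, so `v i ↦ w i` is well defined and
isometric on a dense subspace. This produces both the stochastic integral and the intertwiner. -/
theorem exists_linearIsometry_of_gram {ι E F : Type*} [NormedAddCommGroup E]
    [InnerProductSpace ℂ E] [NormedAddCommGroup F] [InnerProductSpace ℂ F] [CompleteSpace F]
    {v : ι → E} {w : ι → F} (hv : (Submodule.span ℂ (Set.range v)).topologicalClosure = ⊤)
    (h : ∀ i j, ⟪v i, v j⟫_ℂ = ⟪w i, w j⟫_ℂ) :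
    ∃ I : E →ₗᵢ[ℂ] F, ∀ i, I (v i) = w i := by
  set e := Finsupp.linearCombination ℂ v
  set f := Finsupp.linearCombination ℂ w
  have hin : ∀ c : ι →₀ ℂ, ⟪e c, e c⟫_ℂ = ⟪f c, f c⟫_ℂ := by
    intro c
    simp only [e, f, Finsupp.linearCombination_apply, Finsupp.sum, sum_inner, inner_sum,
      inner_smul_left, inner_smul_right, h]
  have hn : ∀ c, ‖f c‖ = ‖e c‖ := by
    intro c
    rw [@norm_eq_sqrt_re_inner ℂ, @norm_eq_sqrt_re_inner ℂ, hin c]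
  have hd : DenseRange e := by
    rw [DenseRange, ← LinearMap.coe_range, Finsupp.range_linearCombination]
    exact Submodule.dense_iff_topologicalClosure_eq_top.2 hv
  have hb : ∃ C, ∀ c, ‖f c‖ ≤ C * ‖e c‖ := ⟨1, fun c => by rw [one_mul, hn]⟩
  have hI : ∀ c, f.extendOfNorm e (e c) = f c := LinearMap.extendOfNorm_eq hd hb
  refine ⟨⟨(f.extendOfNorm e).toLinearMap, ?_⟩, fun i => ?_⟩
  · intro x
    refine hd.induction_on (p := fun x => ‖(f.extendOfNorm e).toLinearMap x‖ = ‖x‖) x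
      (isClosed_eq (f.extendOfNorm e).continuous.norm continuous_norm) fun c => ?_
    exact (congrArg norm (hI c)).trans (hn c)
  · have := hI (Finsupp.single i 1)
    simpa [e, f] using this

/-- For isometries `‖T s x - T t x‖` depends on `|s - t|` only. -/
theorem continuous_of_tendsto_zero {E : Type*} [NormedAddCommGroup E] [InnerProductSpace ℂ E]
    {T : ℝ≥0 → E →L[ℂ] E} (hadd : ∀ s t, T (s + t) = T s ∘L T t)
    (hn : ∀ t x, ‖T t x‖ = ‖x‖) {x : E} (h : Filter.Tendsto (fun t => T t x) (𝓝 0) (𝓝 x)) :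
    Continuous fun t => T t x := by
  have key : ∀ s t, ‖T s x - T t x‖ = ‖T (nndist s t) x - x‖ := by
    have aux : ∀ s r, ‖T (s + r) x - T s x‖ = ‖T r x - x‖ := by
      intro s r
      rw [hadd, ContinuousLinearMap.comp_apply, ← map_sub, hn]
    intro s t
    rcases le_total s t with hst | hst
    · obtain ⟨r, rfl⟩ := exists_add_of_le hst
      rw [norm_sub_rev, aux]
      rw [show nndist s (s + r) = r by apply NNReal.eq; simp [NNReal.dist_eq]]
    · obtain ⟨r, rfl⟩ := exists_add_of_le hst
      rw [aux]
      rw [show nndist (t + r) t = r by apply NNReal.eq; simp [NNReal.dist_eq]]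
  rw [continuous_iff_continuousAt]
  intro t
  rw [ContinuousAt, tendsto_iff_norm_sub_tendsto_zero]
  simp_rw [key]
  have h1 : Filter.Tendsto (fun s : ℝ≥0 => nndist s t) (𝓝 t) (𝓝 0) := by
    have : Continuous fun s : ℝ≥0 => nndist s t := by fun_prop
    simpa using this.tendsto t
  exact tendsto_iff_norm_sub_tendsto_zero.1 (h.comp h1)

theorem mem_unitary_of_inverse {E : Type*} [NormedAddCommGroup E] [InnerProductSpace ℂ E]
    [CompleteSpace E] {U W : E →L[ℂ] E} (hU : ∀ x, ‖U x‖ = ‖x‖) (h : ∀ x, U (W x) = x) :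
    U ∈ unitary (E →L[ℂ] E) ∧ ContinuousLinearMap.adjoint U = W := by
  have h1 := (ContinuousLinearMap.norm_map_iff_adjoint_comp_self U).1 hU
  have h2 : ContinuousLinearMap.adjoint U = W := by
    ext x
    have := congrArg (fun A : E →L[ℂ] E => A (W x)) h1
    simpa [h] using this
  refine ⟨⟨h1, ?_⟩, h2⟩
  rw [ContinuousLinearMap.star_eq_adjoint, h2]
  ext x
  exact h x

/-! ### The minimal unitary dilation -/

section Dilation

variable {K : Type*} [NormedAddCommGroup K] [InnerProductSpace ℂ K] [CompleteSpace K]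

/-- Bounded families `φ` with `(V s)* (φ (t + s)) = φ t`: the images `P (V' t z)` under the
projection onto `K` of the orbits of the unitary dilation. -/
def trajectories (V : ℝ≥0 → K →L[ℂ] K) : Submodule ℂ (ℝ≥0 → K) where
  carrier := {φ | (∀ s t, ContinuousLinearMap.adjoint (V s) (φ (t + s)) = φ t) ∧
    ∃ C : ℝ, ∀ t, ‖φ t‖ ≤ C}
  zero_mem' := ⟨by simp, 0, by simp⟩
  add_mem' := by
    rintro φ ψ ⟨h1, C, hC⟩ ⟨h2, D, hD⟩
    exact ⟨fun s t => by simp [h1, h2], C + D, fun t => norm_add_le_of_le (hC t) (hD t)⟩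
  smul_mem' := by
    rintro c φ ⟨h1, C, hC⟩
    refine ⟨fun s t => by simp [h1], ‖c‖ * C, fun t => ?_⟩
    rw [Pi.smul_apply, norm_smul]
    exact mul_le_mul_of_nonneg_left (hC t) (norm_nonneg c)

variable {V : ℝ≥0 → K →L[ℂ] K}

theorem norm_adjoint_le_of_isometric {W : K →L[ℂ] K} (hW : ∀ x, ‖W x‖ = ‖x‖) (x : K) :
    ‖ContinuousLinearMap.adjoint W x‖ ≤ ‖x‖ := by
  refine (ContinuousLinearMap.le_opNorm _ _).trans ?_
  rw [LinearIsometryEquiv.norm_map]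
  have : ‖W‖ ≤ 1 := W.opNorm_le_bound zero_le_one fun x => by rw [hW, one_mul]
  exact mul_le_of_le_one_left (norm_nonneg x) this

/-- An earlier value of a trajectory is the image of a later one under the contraction `(V s)*`. -/
theorem monotone_norm_trajectory (hV : IsC0Isometric V) (φ : trajectories V) :
    Monotone fun t => ‖(φ : ℝ≥0 → K) t‖ := by
  intro t r htr
  obtain ⟨s, rfl⟩ := exists_add_of_le htr
  dsimp only
  rw [← φ.2.1 s t]
  exact norm_adjoint_le_of_isometric (hV.norm_map s) _

/-- Polarization reduces this to norms, which are monotone and bounded. -/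
theorem exists_tendsto_inner_trajectory (hV : IsC0Isometric V) (φ ψ : trajectories V) :
    ∃ c : ℂ, Filter.Tendsto (fun t => ⟪(φ : ℝ≥0 → K) t, (ψ : ℝ≥0 → K) t⟫_ℂ) Filter.atTop (𝓝 c) := by
  have hn : ∀ χ : trajectories V, ∃ c : ℂ,
      Filter.Tendsto (fun t => ((‖(χ : ℝ≥0 → K) t‖ : ℂ)) ^ 2) Filter.atTop (𝓝 c) := by
    intro χ
    obtain ⟨C, hC⟩ := χ.2.2
    have h := tendsto_atTop_ciSup (monotone_norm_trajectory hV χ) ⟨C, by rintro _ ⟨t, rfl⟩; exact hC t⟩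
    exact ⟨_, ((Complex.continuous_ofReal.tendsto _).comp h).pow 2⟩
  simp_rw [inner_eq_sum_norm_sq_div_four]
  obtain ⟨c1, h1⟩ := hn (φ + ψ)
  obtain ⟨c2, h2⟩ := hn (φ - ψ)
  obtain ⟨c3, h3⟩ := hn (φ - Complex.I • ψ)
  obtain ⟨c4, h4⟩ := hn (φ + Complex.I • ψ)
  exact ⟨_, ((h1.sub h2).add ((h3.sub h4).mul_const _)).div_const _⟩

/-- The space of trajectories of a semigroup of isometries, as a Hilbert space. -/
def TrajectorySpace {V : ℝ≥0 → K →L[ℂ] K} (_ : IsC0Isometric V) : Type _ := trajectories V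

namespace TrajectorySpace

variable (hV : IsC0Isometric V)

instance : AddCommGroup (TrajectorySpace hV) := inferInstanceAs (AddCommGroup (trajectories V))

instance : Module ℂ (TrajectorySpace hV) := inferInstanceAs (Module ℂ (trajectories V))

variable {hV}

instance : CoeFun (TrajectorySpace hV) fun _ => ℝ≥0 → K := ⟨fun φ => φ.1⟩

theorem ext {φ ψ : TrajectorySpace hV} (h : ∀ t, φ t = ψ t) : φ = ψ := Subtype.ext (funext h)

theorem sub_apply (φ ψ : TrajectorySpace hV) (t : ℝ≥0) : (φ - ψ) t = φ t - ψ t := rfl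

theorem zero_apply (t : ℝ≥0) : (0 : TrajectorySpace hV) t = 0 := rfl

theorem adjoint_apply_add (φ : TrajectorySpace hV) (s t : ℝ≥0) :
    ContinuousLinearMap.adjoint (V s) (φ (t + s)) = φ t := φ.2.1 s t

variable (hV)

/-- The inner product `⟪φ, ψ⟫ = lim ⟪φ t, ψ t⟫` of trajectories. -/
@[reducible]
noncomputable def core : InnerProductSpace.Core ℂ (TrajectorySpace hV) where
  inner φ ψ := (exists_tendsto_inner_trajectory hV φ ψ).choose
  conj_inner_symm φ ψ := by
    have h1 := (exists_tendsto_inner_trajectory hV φ ψ).choose_spec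
    have h2 := (exists_tendsto_inner_trajectory hV ψ φ).choose_spec
    refine tendsto_nhds_unique ((Complex.continuous_conj.tendsto _).comp h2) (h1.congr fun t => ?_)
    exact (inner_conj_symm _ _).symm
  re_inner_nonneg φ := by
    have h1 := (exists_tendsto_inner_trajectory hV φ φ).choose_spec
    exact ge_of_tendsto' ((Complex.continuous_re.tendsto _).comp h1)
      fun t => inner_self_nonneg (𝕜 := ℂ)
  add_left φ ψ χ := by
    have h1 := (exists_tendsto_inner_trajectory hV φ χ).choose_spec
    have h2 := (exists_tendsto_inner_trajectory hV ψ χ).choose_spec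
    have h3 := (exists_tendsto_inner_trajectory hV (φ + ψ) χ).choose_spec
    exact tendsto_nhds_unique h3 ((h1.add h2).congr fun t => (inner_add_left _ _ _).symm)
  smul_left φ ψ c := by
    have h1 := (exists_tendsto_inner_trajectory hV φ ψ).choose_spec
    have h3 := (exists_tendsto_inner_trajectory hV (c • φ) ψ).choose_spec
    exact tendsto_nhds_unique h3 ((h1.const_mul _).congr fun t => (inner_smul_left _ _ _).symm)
  definite φ h0 := by
    have h1 := (exists_tendsto_inner_trajectory hV φ φ).choose_spec
    rw [show (exists_tendsto_inner_trajectory hV φ φ).choose = 0 from h0] at h1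
    have h2 : Filter.Tendsto (fun t => ‖φ t‖ ^ 2) Filter.atTop (𝓝 0) := by
      have := h1.norm
      simpa [inner_self_eq_norm_sq_to_K] using this
    refine ext fun t => ?_
    -- The norms increase to the limit `0`, so all of them vanish.
    have h3 : ‖φ t‖ ^ 2 ≤ 0 := by
      refine ge_of_tendsto h2 ?_
      filter_upwards [Filter.eventually_ge_atTop t] with r hr
      have := monotone_norm_trajectory hV φ hr
      dsimp only at this
      gcongr
    rw [zero_apply]
    simpa using le_antisymm h3 (by positivity)

noncomputable instance : NormedAddCommGroup (TrajectorySpace hV) :=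
  (core hV).toNormedAddCommGroup

noncomputable instance : InnerProductSpace ℂ (TrajectorySpace hV) :=
  InnerProductSpace.ofCore (core hV).toCore

variable {hV}

theorem tendsto_inner (φ ψ : TrajectorySpace hV) :
    Filter.Tendsto (fun t => ⟪φ t, ψ t⟫_ℂ) Filter.atTop (𝓝 ⟪φ, ψ⟫_ℂ) :=
  (exists_tendsto_inner_trajectory hV φ ψ).choose_spec

theorem tendsto_norm (φ : TrajectorySpace hV) :
    Filter.Tendsto (fun t => ‖φ t‖) Filter.atTop (𝓝 ‖φ‖) := by
  have h := (Complex.continuous_re.tendsto _).comp (tendsto_inner φ φ)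
  have h2 := (Real.continuous_sqrt.tendsto _).comp h
  rw [@norm_eq_sqrt_re_inner ℂ]
  refine h2.congr fun t => ?_
  rw [@norm_eq_sqrt_re_inner ℂ]
  rfl

theorem norm_apply_le (φ : TrajectorySpace hV) (t : ℝ≥0) : ‖φ t‖ ≤ ‖φ‖ :=
  (monotone_norm_trajectory hV φ).ge_of_tendsto (tendsto_norm φ) t

theorem norm_le {φ : TrajectorySpace hV} {C : ℝ} (hC : ∀ t, ‖φ t‖ ≤ C) : ‖φ‖ ≤ C :=
  le_of_tendsto' (tendsto_norm φ) hC

/-- The norm is the supremum of the pointwise norms, so the usual argument for bounded functions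
applies. -/
instance : CompleteSpace (TrajectorySpace hV) := by
  refine Metric.complete_of_cauchySeq_tendsto fun u hu => ?_
  have hpt : ∀ t, ∃ x, Filter.Tendsto (fun n => u n t) Filter.atTop (𝓝 x) := by
    intro t
    refine cauchySeq_tendsto_of_complete (Metric.cauchySeq_iff.2 ?_)
    intro ε hε
    obtain ⟨N, hN⟩ := Metric.cauchySeq_iff.1 hu ε hε
    refine ⟨N, fun m hm n hn => lt_of_le_of_lt ?_ (hN m hm n hn)⟩
    rw [dist_eq_norm, dist_eq_norm, ← sub_apply]
    exact norm_apply_le (u m - u n) t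
  choose φ hφ using hpt
  obtain ⟨C, hC⟩ := hu.norm_bddAbove
  have hφmem : φ ∈ trajectories V := by
    refine ⟨fun s t => ?_, C, fun t => ?_⟩
    · refine tendsto_nhds_unique
        (((ContinuousLinearMap.adjoint (V s)).continuous.tendsto _).comp (hφ (t + s)))
        ((hφ t).congr fun n => ?_)
      exact ((u n).adjoint_apply_add s t).symm
    · exact le_of_tendsto' (hφ t).norm fun n => (norm_apply_le (u n) t).trans (hC ⟨n, rfl⟩)
  obtain ⟨Φ, hΦ⟩ : ∃ Φ : TrajectorySpace hV, ∀ t, Φ t = φ t :=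
    ⟨(⟨φ, hφmem⟩ : trajectories V), fun _ => rfl⟩
  refine ⟨Φ, Metric.tendsto_atTop.2 ?_⟩
  intro ε hε
  obtain ⟨N, hN⟩ := Metric.cauchySeq_iff.1 hu (ε / 2) (half_pos hε)
  refine ⟨N, fun n hn => lt_of_le_of_lt ?_ (half_lt_self hε)⟩
  rw [dist_eq_norm]
  refine norm_le fun t => ?_
  rw [sub_apply, hΦ]
  refine le_of_tendsto (((tendsto_const_nhds (x := u n t)).sub (hφ t)).norm) ?_
  filter_upwards [Filter.eventually_ge_atTop N] with m hm
  rw [← sub_apply]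
  refine (norm_apply_le (u n - u m) t).trans ?_
  rw [← dist_eq_norm]
  exact (hN n hn m hm).le

variable (hV)

/-- The embedding `x ↦ (t ↦ V t x)`. -/
noncomputable def embed : K →ₗᵢ[ℂ] TrajectorySpace hV where
  toFun x := (⟨fun t => V t x, fun s t => by
      dsimp only
      rw [add_comm, hV.map_add]; exact adjoint_apply_of_isometric (hV.norm_map s) _,
    ‖x‖, fun t => (hV.norm_map t x).le⟩ : trajectories V)
  map_add' x y := ext fun t => map_add (V t) x y
  map_smul' c x := ext fun t => map_smul (V t) c x
  norm_map' x := by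
    refine tendsto_nhds_unique (tendsto_norm _) ?_
    exact (tendsto_const_nhds (x := ‖x‖)).congr fun t => (hV.norm_map t x).symm

theorem tendsto_add_const_atTop (s : ℝ≥0) :
    Filter.Tendsto (fun t : ℝ≥0 => t + s) Filter.atTop Filter.atTop :=
  Filter.tendsto_atTop_mono (fun _ => le_self_add) Filter.tendsto_id

/-- The forward shift of trajectories. -/
noncomputable def shift (s : ℝ≥0) : TrajectorySpace hV →ₗᵢ[ℂ] TrajectorySpace hV where
  toFun φ := (⟨fun t => φ (t + s), fun r t => by
      dsimp only
      rw [add_right_comm]; exact φ.2.1 r (t + s),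
    φ.2.2.choose, fun t => φ.2.2.choose_spec _⟩ : trajectories V)
  map_add' _ _ := rfl
  map_smul' _ _ := rfl
  norm_map' φ := tendsto_nhds_unique (tendsto_norm _)
    ((tendsto_norm φ).comp (tendsto_add_const_atTop s))

/-- The backward shift of trajectories. -/
noncomputable def backShift (s : ℝ≥0) : TrajectorySpace hV →L[ℂ] TrajectorySpace hV :=
  LinearMap.mkContinuous
    { toFun := fun φ => (⟨fun t => ContinuousLinearMap.adjoint (V s) (φ t),
        fun r t => by
          dsimp only
          rw [← ContinuousLinearMap.comp_apply, ← ContinuousLinearMap.adjoint_comp, ← hV.map_add,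
            add_comm, hV.map_add, ContinuousLinearMap.adjoint_comp,
            ContinuousLinearMap.comp_apply, φ.adjoint_apply_add r t],
        φ.2.2.choose, fun t => (norm_adjoint_le_of_isometric (hV.norm_map s) _).trans
          (φ.2.2.choose_spec _)⟩ : trajectories V)
      map_add' := fun φ ψ => ext fun t => map_add _ (φ t) (ψ t)
      map_smul' := fun c φ => ext fun t => map_smul _ c (φ t) } 1 fun φ => by
    rw [one_mul]
    exact norm_le fun t =>
      (norm_adjoint_le_of_isometric (hV.norm_map s) _).trans (norm_apply_le φ t)

/-- The unitary dilation of `V`. -/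
noncomputable def dilation (s : ℝ≥0) : TrajectorySpace hV →L[ℂ] TrajectorySpace hV :=
  (shift hV s).toContinuousLinearMap

theorem dilation_mem_unitary (s : ℝ≥0) :
    dilation hV s ∈ unitary (TrajectorySpace hV →L[ℂ] TrajectorySpace hV) ∧
      ContinuousLinearMap.adjoint (dilation hV s) = backShift hV s :=
  mem_unitary_of_inverse (fun φ => (shift hV s).norm_map φ) fun φ =>
    ext fun t => φ.adjoint_apply_add s t

theorem norm_dilation (s : ℝ≥0) (φ : TrajectorySpace hV) : ‖dilation hV s φ‖ = ‖φ‖ :=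
  (shift hV s).norm_map φ

theorem dilation_embed (t : ℝ≥0) (x : K) : dilation hV t (embed hV x) = embed hV (V t x) := by
  refine ext fun r => ?_
  change V (r + t) x = V r (V t x)
  rw [hV.map_add]; rfl

theorem dilation_add (s t : ℝ≥0) : dilation hV (s + t) = dilation hV s ∘L dilation hV t := by
  refine ContinuousLinearMap.ext fun φ => ext fun r => ?_
  change φ (r + (s + t)) = φ (r + s + t)
  rw [add_assoc]

/-- `⟪V t x, φ t⟫` does not depend on `t`. Thus evaluation at `0` is the adjoint of the embedding.
-/
theorem inner_embed (x : K) (φ : TrajectorySpace hV) : ⟪embed hV x, φ⟫_ℂ = ⟪x, φ 0⟫_ℂ := by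
  refine tendsto_nhds_unique (tendsto_inner _ _) ?_
  refine (tendsto_const_nhds (x := ⟪x, φ 0⟫_ℂ)).congr fun t => ?_
  have h := φ.adjoint_apply_add t 0
  rw [zero_add] at h
  rw [← h, ContinuousLinearMap.adjoint_inner_right]
  rfl

theorem span_dilation_embed : (Submodule.span ℂ {z | ∃ t x, z = dilation hV t (embed hV x) ∨
    z = ContinuousLinearMap.adjoint (dilation hV t) (embed hV x)}).topologicalClosure = ⊤ := by
  rw [Submodule.topologicalClosure_eq_top_iff, eq_bot_iff]
  intro φ hφ
  rw [Submodule.mem_orthogonal] at hφ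
  refine ext fun t => ?_
  -- This test vector pairs with `φ` to `‖φ t‖²`.
  have h := hφ (ContinuousLinearMap.adjoint (dilation hV t) (embed hV (φ t)))
    (Submodule.subset_span ⟨t, _, Or.inr rfl⟩)
  rw [ContinuousLinearMap.adjoint_inner_left, inner_embed] at h
  change ⟪φ t, φ (0 + t)⟫_ℂ = 0 at h
  rw [zero_add] at h
  rw [zero_apply]
  simpa using h

/-- On the embedded copy of `K` this is the continuity of `V`. The backward shifts commute with the
dilation and carry it to a dense subspace, and isometry does the rest. -/
theorem tendsto_dilation_zero (φ : TrajectorySpace hV) :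
    Filter.Tendsto (fun t => dilation hV t φ) (𝓝 0) (𝓝 φ) := by
  have hι : ∀ x, Filter.Tendsto (fun t => dilation hV t (embed hV x)) (𝓝 0) (𝓝 (embed hV x)) := by
    intro x
    simp_rw [dilation_embed]
    have := (hV.continuous x).tendsto 0
    rw [hV.map_zero] at this
    exact ((embed hV).continuous.tendsto _).comp this
  have hsub : ∀ φ ∈ Submodule.span ℂ {z | ∃ t x, z = dilation hV t (embed hV x) ∨
      z = ContinuousLinearMap.adjoint (dilation hV t) (embed hV x)},
      Filter.Tendsto (fun t => dilation hV t φ) (𝓝 0) (𝓝 φ) := by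
    intro φ hφ
    induction hφ using Submodule.span_induction with
    | mem z hz =>
      obtain ⟨r, x, rfl | rfl⟩ := hz
      · rw [dilation_embed]
        exact hι _
      · rw [(dilation_mem_unitary hV r).2]
        exact (((backShift hV r).continuous.tendsto _).comp (hι x)).congr fun t => ext fun s => rfl
    | zero => simp
    | add x y _ _ hx hy => simpa using hx.add hy
    | smul c x _ hx => simpa using hx.const_smul c
  rw [Metric.tendsto_nhds]
  intro ε hε
  have hφ : φ ∈ (Submodule.span ℂ {z | ∃ t x, z = dilation hV t (embed hV x) ∨
      z = ContinuousLinearMap.adjoint (dilation hV t) (embed hV x)}).topologicalClosure := by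
    rw [span_dilation_embed]; trivial
  obtain ⟨ψ, hψ, hd⟩ := Metric.mem_closure_iff.1 hφ (ε / 3) (by positivity)
  filter_upwards [Metric.tendsto_nhds.1 (hsub ψ hψ) (ε / 3) (by positivity)] with t ht
  have h1 : dist (dilation hV t φ) (dilation hV t ψ) = dist φ ψ := by
    rw [dist_eq_norm, ← map_sub, norm_dilation, dist_eq_norm]
  calc dist (dilation hV t φ) φ
      ≤ dist (dilation hV t φ) (dilation hV t ψ) + dist (dilation hV t ψ) ψ + dist ψ φ :=
        dist_triangle4 _ _ _ _
    _ < ε := by rw [h1, dist_comm ψ φ]; linarith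

end TrajectorySpace

open TrajectorySpace in
/-- Every `C₀`-semigroup of isometries has a minimal unitary dilation, and the dilation extends
the semigroup. -/
theorem isMinimalUnitaryDilation_dilation (hV : IsC0Isometric V) :
    IsMinimalUnitaryDilation (embed hV) V (dilation hV) where
  isC0Unitary :=
    { map_zero := ContinuousLinearMap.ext fun φ => ext fun t => congrArg φ (add_zero t)
      map_add := dilation_add hV
      continuous := fun φ => continuous_of_tendsto_zero (dilation_add hV) (norm_dilation hV)
        (tendsto_dilation_zero hV φ)
      unitary := fun t => (dilation_mem_unitary hV t).1 }
  dilation t x y := by rw [dilation_embed, (embed hV).inner_map_map]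
  minimal := span_dilation_embed hV

end Dilation

/-! ### Orbit integrals and the deficiency subspace -/

theorem IsC0Semigroup.continuous_toNNReal {K : Type*} [NormedAddCommGroup K] [InnerProductSpace ℂ K]
    {T : ℝ≥0 → K →L[ℂ] K} (hT : IsC0Semigroup T) (x : K) :
    Continuous fun s : ℝ => T s.toNNReal x :=
  (hT.continuous x).comp continuous_real_toNNReal

section Deficiency

variable {K : Type*} [NormedAddCommGroup K] [InnerProductSpace ℂ K] [CompleteSpace K]

theorem inner_intervalIntegral_right {f : ℝ → K} (hf : Continuous f) (x : K) (a b : ℝ) :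
    ⟪x, ∫ s in a..b, f s⟫_ℂ = ∫ s in a..b, ⟪x, f s⟫_ℂ :=
  ((innerSL ℂ x).intervalIntegral_comp_comm (hf.intervalIntegrable a b)).symm

theorem inner_intervalIntegral_left {f : ℝ → K} (hf : Continuous f) (x : K) (a b : ℝ) :
    ⟪∫ s in a..b, f s, x⟫_ℂ = ∫ s in a..b, ⟪f s, x⟫_ℂ := by
  rw [← inner_conj_symm, inner_intervalIntegral_right hf]
  simp_rw [← inner_conj_symm (f _) x]
  exact (Complex.conjCLE.toContinuousLinearMap.intervalIntegral_comp_comm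
    (Continuous.intervalIntegrable (by fun_prop) a b)).symm

theorem map_intervalIntegral {F : Type*} [NormedAddCommGroup F] [InnerProductSpace ℂ F]
    [CompleteSpace F] {f : ℝ → K} (hf : Continuous f) (T : K →L[ℂ] F) (a b : ℝ) :
    T (∫ s in a..b, f s) = ∫ s in a..b, T (f s) :=
  (T.intervalIntegral_comp_comm (hf.intervalIntegrable a b)).symm

variable {T : ℝ≥0 → K →L[ℂ] K}

theorem IsC0Semigroup.apply_integral (hT : IsC0Semigroup T) (x : K) (s a b : ℝ≥0) (hab : a ≤ b) :
    T s (∫ r in (a : ℝ)..b, T r.toNNReal x) = ∫ r in ((a + s : ℝ≥0) : ℝ)..(b + s : ℝ≥0),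
      T r.toNNReal x := by
  rw [map_intervalIntegral (hT.continuous_toNNReal x)]
  rw [NNReal.coe_add, NNReal.coe_add, ← intervalIntegral.integral_comp_add_right]
  refine intervalIntegral.integral_congr fun r hr => ?_
  rw [Set.uIcc_of_le (by exact_mod_cast hab)] at hr
  have hr0 : 0 ≤ r := a.2.trans hr.1
  rw [Real.toNNReal_add hr0 s.coe_nonneg, add_comm, Real.toNNReal_coe, hT.map_add]
  rfl

theorem IsC0Semigroup.integral_add (hT : IsC0Semigroup T) (x : K) (s t : ℝ≥0) :
    ∫ r in (0 : ℝ)..(s + t : ℝ≥0), T r.toNNReal x =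
      (∫ r in (0 : ℝ)..s, T r.toNNReal x) + T s (∫ r in (0 : ℝ)..t, T r.toNNReal x) := by
  have h := hT.apply_integral x s 0 t zero_le
  rw [NNReal.coe_zero, zero_add] at h
  rw [h, add_comm t s]
  have hi := fun a b => (hT.continuous_toNNReal x).intervalIntegrable (μ := MeasureTheory.volume) a b
  exact (intervalIntegral.integral_add_adjacent_intervals (hi _ _) (hi _ _)).symm

/-- Difference quotients of the orbit integral are differences of averages of the orbit near `a` and
near `0`. This supplies enough elements of the domain to test the deficiency subspace. -/
theorem IsC0Semigroup.hasGeneratorAt_integral (hT : IsC0Semigroup T) (x : K) (a : ℝ≥0) :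
    HasGeneratorAt T (∫ r in (0 : ℝ)..a, T r.toNNReal x) (T a x - x) := by
  have hc := hT.continuous_toNNReal x
  have hd : ∀ c : ℝ≥0, Filter.Tendsto (fun t : ℝ≥0 => (((t : ℝ) : ℂ))⁻¹ •
      ((∫ r in (0 : ℝ)..(c + t : ℝ≥0), T r.toNNReal x) - ∫ r in (0 : ℝ)..c, T r.toNNReal x))
      (𝓝[>] 0) (𝓝 (T c x)) := by
    intro c
    have h1 : HasDerivAt (fun u : ℝ => ∫ r in (0 : ℝ)..u, T r.toNNReal x) (T c x) c := by
      have := intervalIntegral.integral_hasDerivAt_right (hc.intervalIntegrable (0 : ℝ) c)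
        hc.stronglyMeasurable.stronglyMeasurableAtFilter hc.continuousAt
      rwa [Real.toNNReal_coe] at this
    have h2 := h1.tendsto_slope_zero_right
    have h3 : Filter.Tendsto (fun t : ℝ≥0 => (t : ℝ)) (𝓝[>] 0) (𝓝[>] 0) := by
      refine tendsto_nhdsWithin_iff.2 ⟨?_, ?_⟩
      · exact (NNReal.continuous_coe.tendsto 0).mono_left nhdsWithin_le_nhds
      · filter_upwards [self_mem_nhdsWithin] with t ht
        exact_mod_cast ht
    refine (h2.comp h3).congr fun t => ?_
    simp only [Function.comp, NNReal.coe_add]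
    rw [← Complex.ofReal_inv]
    exact RCLike.real_smul_eq_coe_smul (K := ℂ) _ _
  have h0 := hd 0
  simp only [zero_add, NNReal.coe_zero, intervalIntegral.integral_same, sub_zero, hT.map_zero] at h0
  refine ((hd a).sub h0).congr fun t => ?_
  rw [← smul_sub]
  congr 1
  rw [add_comm a t, hT.integral_add x t a]
  abel

theorem eq_exp_mul_of_integral_eq {φ : ℝ → ℂ} (hφ : Continuous φ)
    (h : ∀ a, 0 ≤ a → φ a = φ 0 - ∫ s in (0 : ℝ)..a, φ s) (a : ℝ) (ha : 0 ≤ a) :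
    φ a = Real.exp (-a) * φ 0 := by
  have hd : ∀ s, HasDerivAt (fun s : ℝ => (Real.exp s : ℂ) * (φ 0 - ∫ r in (0 : ℝ)..s, φ r))
      ((Real.exp s : ℂ) * (φ 0 - ∫ r in (0 : ℝ)..s, φ r) + Real.exp s * (0 - φ s)) s := by
    intro s
    refine HasDerivAt.mul (Real.hasDerivAt_exp s).ofReal_comp ?_
    exact (hasDerivAt_const _ _).sub (intervalIntegral.integral_hasDerivAt_right
      (hφ.intervalIntegrable _ _) hφ.stronglyMeasurable.stronglyMeasurableAtFilter hφ.continuousAt)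
  have hc := constant_of_has_deriv_right_zero (a := 0) (b := a)
    (fun s _ => (hd s).continuousAt.continuousWithinAt) (fun s hs => by
      have := (hd s).hasDerivWithinAt (s := Set.Ici s)
      rwa [← h s hs.1, zero_sub, mul_neg, add_neg_cancel] at this) a ⟨ha, le_rfl⟩
  simp only [intervalIntegral.integral_same, Real.exp_zero, sub_zero, ← h a ha] at hc
  rw [Real.exp_neg, Complex.ofReal_inv]
  have : (Real.exp a : ℂ) ≠ 0 := by exact_mod_cast (Real.exp_pos a).ne'
  field_simp
  simpa [mul_comm] using hc

/-- Turns `d* x = -x` into `(T t)* x = e^{-t} x`, which avoids the unbounded generator from here on.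
One direction integrates along orbits, the other differentiates at `0`. -/
theorem mem_deficiencySubspace_iff (hT : IsC0Semigroup T) (x : K) :
    x ∈ deficiencySubspace T ↔ ∀ (t : ℝ≥0) y, ⟪x, T t y⟫_ℂ = Real.exp (-t) * ⟪x, y⟫_ℂ := by
  have hgen : ∀ (y : (generator T).domain), HasGeneratorAt T y ((generator T).toFun y) :=
    fun y => y.2.choose_spec
  rw [deficiencySubspace, Submodule.mem_orthogonal']
  constructor
  · intro h t y
    have hc : Continuous fun s : ℝ => ⟪x, T s.toNNReal y⟫_ℂ :=
      continuous_const.inner (hT.continuous_toNNReal y)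
    have := eq_exp_mul_of_integral_eq hc (fun a ha => ?_) t t.2
    · simpa [hT.map_zero] using this
    · lift a to ℝ≥0 using ha
      have hg := hT.hasGeneratorAt_integral y a
      -- Orthogonality to `(d + 1) ∫ T s y ds = T a y - y + ∫ T s y ds`: the integrated form of `φ'
      -- = -φ`.
      have h1 := h _ ⟨⟨_, _, hg⟩, rfl⟩
      rw [LinearMap.add_apply, (hgen ⟨_, _, hg⟩).unique hg, Submodule.subtype_apply,
        inner_add_right, inner_sub_right, inner_intervalIntegral_right
        (hT.continuous_toNNReal y)] at h1
      simp only [Real.toNNReal_coe, Real.toNNReal_zero, hT.map_zero, ContinuousLinearMap.coe_id',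
        id]
      linear_combination h1
  · rintro h _ ⟨y, rfl⟩
    rw [LinearMap.add_apply, inner_add_right]
    have h1 : Filter.Tendsto (fun t : ℝ≥0 => ⟪x, (((t : ℝ) : ℂ))⁻¹ • (T t (y : K) - y)⟫_ℂ)
        (𝓝[>] 0) (𝓝 ⟪x, (generator T).toFun y⟫_ℂ) := tendsto_const_nhds.inner (hgen y)
    have h2 : Filter.Tendsto (fun t : ℝ≥0 => ⟪x, (((t : ℝ) : ℂ))⁻¹ • (T t (y : K) - y)⟫_ℂ)
        (𝓝[>] 0) (𝓝 (-⟪x, y⟫_ℂ)) := by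
      have hd : HasDerivAt (fun u : ℝ => Real.exp (-u)) (-1) 0 := by
        simpa using (hasDerivAt_neg (0 : ℝ)).exp
      have h3 : Filter.Tendsto (fun t : ℝ≥0 => (t : ℝ)) (𝓝[>] 0) (𝓝[>] 0) := by
        refine tendsto_nhdsWithin_iff.2 ⟨?_, ?_⟩
        · exact (NNReal.continuous_coe.tendsto 0).mono_left nhdsWithin_le_nhds
        · filter_upwards [self_mem_nhdsWithin] with t ht
          exact_mod_cast ht
      have h4 := (Complex.continuous_ofReal.tendsto _).comp (hd.tendsto_slope_zero_right.comp h3)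
      have h5 := h4.mul_const ⟪x, (y : K)⟫_ℂ
      simp only [Complex.ofReal_neg, Complex.ofReal_one, neg_mul, one_mul] at h5
      refine h5.congr fun t => ?_
      rw [inner_smul_right, inner_sub_right, h]
      simp
      ring
    rw [tendsto_nhds_unique h1 h2]
    simp

end Deficiency

/-! ### The additive cocycle of a deficiency vector -/

section Cocycle

variable {K : Type*} [NormedAddCommGroup K] [InnerProductSpace ℂ K] [CompleteSpace K]
  {V : ℝ≥0 → K →L[ℂ] K}

/-- An additive cocycle with orthogonal increments for a semigroup of isometries, that is the
image of `t ↦ 1_(0, t]` under a unitary equivalence of a part of `V` with the unilateral shift. -/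
structure IsOrthogonalCocycle (V : ℝ≥0 → K →L[ℂ] K) (b : ℝ≥0 → K) : Prop where
  map_add : ∀ s t, b (s + t) = b s + V s (b t)
  inner_map : ∀ t y, ⟪b t, V t y⟫_ℂ = 0
  norm_sq : ∀ t, ‖b t‖ ^ 2 = t

theorem integral_exp_neg_sub (t : ℝ) : ∫ s in (0 : ℝ)..t, (Real.exp (-(t - s)) : ℂ) =
    1 - Real.exp (-t) := by
  rw [intervalIntegral.integral_ofReal, intervalIntegral.integral_comp_sub_left
    (fun u => Real.exp (-u)), intervalIntegral.integral_comp_neg (fun u => Real.exp u)]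
  simp

theorem integral_exp_neg (t : ℝ) : ∫ s in (0 : ℝ)..t, (Real.exp (-s) : ℂ) =
    1 - Real.exp (-t) := by
  rw [intervalIntegral.integral_ofReal, intervalIntegral.integral_comp_neg (fun u => Real.exp u)]
  simp

/-- In the model of the shift on `L²(0, ∞)` the vector `h` is `√2 e^{-s}`, and `h - V t h + ∫ V s h
ds` over `(0, t]` is `√2` times the indicator of `(0, t]`. All relations follow from `(V t)* h =
e^{-t} h` alone. -/
theorem exists_isOrthogonalCocycle (hV : IsC0Isometric V) {h : K} (hn : ‖h‖ = 1)
    (hd : ∀ (t : ℝ≥0) y, ⟪h, V t y⟫_ℂ = Real.exp (-t) * ⟪h, y⟫_ℂ) :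
    ∃ b : ℝ≥0 → K, IsOrthogonalCocycle V b := by
  have hinn : ∀ t x y, ⟪V t x, V t y⟫_ℂ = ⟪x, y⟫_ℂ := by
    intro t x y
    rw [← ContinuousLinearMap.adjoint_inner_left, adjoint_apply_of_isometric (hV.norm_map t)]
  have hc := hV.continuous_toNNReal h
  have hhh : ⟪h, h⟫_ℂ = 1 := by rw [inner_self_eq_norm_sq_to_K, hn]; simp
  set u : ℝ≥0 → K := fun t => h - V t h + ∫ s in (0 : ℝ)..t, V s.toNNReal h with hu
  have hsplit : ∀ (t : ℝ≥0) (s : ℝ), s ∈ Set.uIcc (0 : ℝ) t → t = s.toNNReal + (t - s.toNNReal)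
      ∧ ((t - s.toNNReal : ℝ≥0) : ℝ) = t - s := by
    intro t s hs
    rw [Set.uIcc_of_le t.coe_nonneg] at hs
    have h1 : s.toNNReal ≤ t := Real.toNNReal_le_iff_le_coe.2 hs.2
    refine ⟨(add_tsub_cancel_of_le h1).symm, ?_⟩
    rw [NNReal.coe_sub h1, Real.coe_toNNReal _ hs.1]
  have hadd : ∀ s t, u (s + t) = u s + V s (u t) := by
    intro s t
    simp only [hu]
    rw [hV.integral_add, map_add, map_sub, hV.map_add, ContinuousLinearMap.comp_apply]
    abel
  have horth : ∀ t y, ⟪u t, V t y⟫_ℂ = 0 := by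
    intro t y
    simp only [hu]
    rw [inner_add_left, inner_sub_left, hinn, hd, inner_intervalIntegral_left hc]
    have : ∫ s in (0 : ℝ)..t, ⟪V s.toNNReal h, V t y⟫_ℂ =
        ∫ s in (0 : ℝ)..t, (Real.exp (-(t - s)) : ℂ) * ⟪h, y⟫_ℂ := by
      refine intervalIntegral.integral_congr fun s hs => ?_
      obtain ⟨h1, h2⟩ := hsplit t s hs
      conv_lhs => rw [h1]
      rw [hV.map_add, ContinuousLinearMap.comp_apply, hinn, hd, h2]
    rw [this, intervalIntegral.integral_mul_const, integral_exp_neg_sub]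
    ring
  have hhu : ∀ t, ⟪h, u t⟫_ℂ = ((2 * (1 - Real.exp (-t)) : ℝ) : ℂ) := by
    intro t
    simp only [hu]
    rw [inner_add_right, inner_sub_right, hd, inner_intervalIntegral_right hc]
    have : ∫ s in (0 : ℝ)..t, ⟪h, V s.toNNReal h⟫_ℂ = ∫ s in (0 : ℝ)..t, (Real.exp (-s) : ℂ) := by
      refine intervalIntegral.integral_congr fun s hs => ?_
      rw [Set.uIcc_of_le t.coe_nonneg] at hs
      rw [hd, hhh, mul_one, Real.coe_toNNReal _ hs.1]
    rw [this, integral_exp_neg, hhh]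
    push_cast
    ring
  have huh : ∀ t, ⟪u t, h⟫_ℂ = ((2 * (1 - Real.exp (-t)) : ℝ) : ℂ) := by
    intro t
    rw [← inner_conj_symm, hhu, Complex.conj_ofReal]
  have hnorm : ∀ t : ℝ≥0, ⟪u t, u t⟫_ℂ = 2 * (t : ℂ) := by
    intro t
    -- Only the second factor is expanded. Under the integral, `u t = u s + V s (u (t - s))` reduces
    -- each pairing to `⟪u (t - s), h⟫`.
    have e : ⟪u t, u t⟫_ℂ = ⟪u t, h⟫_ℂ - ⟪u t, V t h⟫_ℂ + ∫ s in (0 : ℝ)..t,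
        ⟪u t, V s.toNNReal h⟫_ℂ := by
      rw [← inner_intervalIntegral_right hc, ← inner_sub_right, ← inner_add_right]
    have : ∫ s in (0 : ℝ)..t, ⟪u t, V s.toNNReal h⟫_ℂ =
        ∫ s in (0 : ℝ)..t, (2 - 2 * (Real.exp (-(t - s)) : ℂ)) := by
      refine intervalIntegral.integral_congr fun s hs => ?_
      obtain ⟨h1, h2⟩ := hsplit t s hs
      conv_lhs => rw [h1]
      rw [hadd, inner_add_left, horth, hinn, huh, h2]
      push_cast
      ring
    rw [e, horth, huh, this, intervalIntegral.integral_sub (by simp)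
      (Continuous.intervalIntegrable (by fun_prop) _ _), intervalIntegral.integral_const_mul,
      integral_exp_neg_sub]
    simp
    ring
  refine ⟨fun t => ((√2 : ℝ) : ℂ)⁻¹ • u t, ⟨fun s t => ?_, fun t y => ?_, fun t => ?_⟩⟩
  · rw [hadd, smul_add, map_smul]
  · rw [inner_smul_left, horth, mul_zero]
  · have h2 : ‖u t‖ ^ 2 = 2 * t := by
      have := hnorm t
      rw [inner_self_eq_norm_sq_to_K] at this
      have h3 : ((‖u t‖ ^ 2 : ℝ) : ℂ) = ((2 * t : ℝ) : ℂ) := by push_cast; exact this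
      exact Complex.ofReal_injective h3
    rw [norm_smul, mul_pow, h2, norm_inv, Complex.norm_real, Real.norm_of_nonneg (by positivity),
      inv_pow, Real.sq_sqrt (by norm_num)]
    ring

end Cocycle

/-! ### Square integrable functions on an interval -/

section IntervalL2

open MeasureTheory

/-- The indicator function of `(0, s]` in `L²((0, t])`. -/
noncomputable def indicatorIoc (t : ℝ≥0) (s : Set.Iic t) :
    Lp ℂ 2 (volume.restrict (Set.Ioc 0 (t : ℝ))) :=
  indicatorConstLp 2 (s := Set.Ioc 0 ((s : ℝ≥0) : ℝ)) measurableSet_Ioc (measure_ne_top _ _) 1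

theorem inner_indicatorIoc (t : ℝ≥0) (s : Set.Iic t)
    (f : Lp ℂ 2 (volume.restrict (Set.Ioc 0 (t : ℝ)))) :
    ⟪indicatorIoc t s, f⟫_ℂ = ∫ x in (0 : ℝ)..(s : ℝ≥0), f x := by
  rw [indicatorIoc, L2.inner_indicatorConstLp_one, Measure.restrict_restrict measurableSet_Ioc,
    intervalIntegral.integral_of_le (NNReal.coe_nonneg _), Set.inter_eq_left.2]
  exact Set.Ioc_subset_Ioc_right (by exact_mod_cast s.2)

theorem inner_indicatorIoc_indicatorIoc (t : ℝ≥0) (s r : Set.Iic t) :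
    ⟪indicatorIoc t s, indicatorIoc t r⟫_ℂ = ((min (s : ℝ≥0) r : ℝ≥0) : ℝ) := by
  rw [indicatorIoc, indicatorIoc, L2.inner_indicatorConstLp_one_indicatorConstLp_one,
    Set.Ioc_inter_Ioc, Measure.real, Measure.restrict_apply measurableSet_Ioc,
    Set.inter_eq_left.2]
  · rw [Real.volume_Ioc, max_self, sub_zero, ENNReal.toReal_ofReal (by positivity)]
    push_cast
    rfl
  · refine Set.Ioc_subset_Ioc (by simp) ?_
    exact (min_le_left _ _).trans (by exact_mod_cast s.2)

/-- A function orthogonal to all these indicators has vanishing primitive, hence vanishes almost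
everywhere by Lebesgue differentiation. -/
theorem span_indicatorIoc (t : ℝ≥0) :
    (Submodule.span ℂ (Set.range (indicatorIoc t))).topologicalClosure = ⊤ := by
  rw [Submodule.topologicalClosure_eq_top_iff, eq_bot_iff]
  intro f hf
  rw [Submodule.mem_orthogonal] at hf
  have h0 : ∀ s : Set.Iic t, ∫ x in (0 : ℝ)..(s : ℝ≥0), f x = 0 := fun s => by
    rw [← inner_indicatorIoc]
    exact hf _ (Submodule.subset_span ⟨s, rfl⟩)
  have hint : IntervalIntegrable f volume 0 (t : ℝ) := by
    rw [intervalIntegrable_iff_integrableOn_Ioc_of_le t.coe_nonneg]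
    exact (Lp.memLp f).integrable (by norm_num)
  rw [Submodule.mem_bot, Lp.eq_zero_iff_ae_eq_zero, Filter.EventuallyEq,
    ae_restrict_iff' measurableSet_Ioc]
  -- The primitive is known to vanish only on `[0, t]`, so the two-sided derivative is read off at
  -- interior points.
  have hne : ∀ᵐ x : ℝ, x ≠ t := by simp [ae_iff, measure_singleton]
  filter_upwards [hint.ae_hasDerivAt_integral, hne] with x hx hxt hmem
  rw [Set.uIcc_of_le t.coe_nonneg] at hx
  have hd := hx ⟨hmem.1.le, hmem.2⟩ 0 ⟨le_rfl, t.coe_nonneg⟩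
  refine hd.unique ((hasDerivAt_const x (0 : ℂ)).congr_of_eventuallyEq ?_)
  filter_upwards [Ioo_mem_nhds hmem.1 (lt_of_le_of_ne hmem.2 hxt)] with y hy
  have := h0 ⟨⟨y, hy.1.le⟩, by exact_mod_cast hy.2.le⟩
  exact this

end IntervalL2

/-! ### Stochastic integrals along an orthogonal cocycle -/

namespace IsOrthogonalCocycle

variable {K : Type*} [NormedAddCommGroup K] [InnerProductSpace ℂ K]
  {V : ℝ≥0 → K →L[ℂ] K} {b : ℝ≥0 → K}

theorem inner_le (hb : IsOrthogonalCocycle V b) {s t : ℝ≥0} (hst : s ≤ t) :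
    ⟪b s, b t⟫_ℂ = ((s : ℝ) : ℂ) := by
  obtain ⟨r, rfl⟩ := exists_add_of_le hst
  rw [hb.map_add, inner_add_right, hb.inner_map, add_zero, inner_self_eq_norm_sq_to_K,
    ← hb.norm_sq s]
  push_cast
  rfl

theorem inner_eq_min (hb : IsOrthogonalCocycle V b) (s t : ℝ≥0) :
    ⟪b s, b t⟫_ℂ = ((min s t : ℝ≥0) : ℝ) := by
  rcases le_total s t with h | h
  · rw [hb.inner_le h, min_eq_left h]
  · rw [← inner_conj_symm, hb.inner_le h, Complex.conj_ofReal, min_eq_right h]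

theorem inner_map_of_le (hb : IsOrthogonalCocycle V b) (hV : IsC0Semigroup V) {s t : ℝ≥0}
    (hst : s ≤ t) (y : K) : ⟪b s, V t y⟫_ℂ = 0 := by
  obtain ⟨r, rfl⟩ := exists_add_of_le hst
  rw [hV.map_add]
  exact hb.inner_map s _

/-- The closed span of an orthogonal cocycle. -/
def space (b : ℝ≥0 → K) : Submodule ℂ K := (Submodule.span ℂ (Set.range b)).topologicalClosure

theorem mem_space (s : ℝ≥0) : b s ∈ space b :=
  Submodule.le_topologicalClosure _ (Submodule.subset_span ⟨s, rfl⟩)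

theorem space_le {L : Submodule ℂ K} (hL : IsClosed (L : Set K)) (h : ∀ s, b s ∈ L) :
    space b ≤ L :=
  Submodule.topologicalClosure_minimal _
    (Submodule.span_le.2 (by rintro _ ⟨s, rfl⟩; exact h s)) hL

theorem isClosed_space : IsClosed (space b : Set K) := Submodule.isClosed_topologicalClosure _

theorem eq_of_inner_eq {z z' : K} (hz : z ∈ space b) (hz' : z' ∈ space b)
    (h : ∀ s, ⟪b s, z⟫_ℂ = ⟪b s, z'⟫_ℂ) : z = z' := by
  have hle : space b ≤ (ℂ ∙ (z - z'))ᗮ :=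
    space_le (Submodule.isClosed_orthogonal _) fun s => by
      rw [Submodule.mem_orthogonal_singleton_iff_inner_left, inner_sub_right, h, sub_self]
  have := hle (Submodule.sub_mem _ hz hz')
  rw [Submodule.mem_orthogonal_singleton_iff_inner_left, inner_self_eq_zero] at this
  exact sub_eq_zero.1 this

theorem map_mem_space (hb : IsOrthogonalCocycle V b) (t : ℝ≥0) {z : K} (hz : z ∈ space b) :
    V t z ∈ space b := by
  have hle : space b ≤ (space b).comap (V t).toLinearMap :=
    space_le (isClosed_space.preimage (V t).continuous) fun s => by
      have h := hb.map_add t s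
      change V t (b s) ∈ space b
      rw [← sub_eq_iff_eq_add'.2 h]
      exact Submodule.sub_mem _ (mem_space _) (mem_space _)
  exact hle hz

/-- The integral `z = ∫ φ db` over `(0, t]`. -/
structure IsIntegral (b : ℝ≥0 → K) (t : ℝ≥0) (φ : ℝ → ℂ) (z : K) : Prop where
  mem : z ∈ space b
  inner : ∀ s, ⟪b s, z⟫_ℂ = ∫ r in (0 : ℝ)..(min s t : ℝ≥0), φ r

theorem IsIntegral.unique {t : ℝ≥0} {φ : ℝ → ℂ} {z z' : K} (hz : IsIntegral b t φ z)
    (hz' : IsIntegral b t φ z') : z = z' :=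
  eq_of_inner_eq hz.mem hz'.mem fun s => by rw [hz.inner, hz'.inner]

/-- An element of the space of the cocycle which is orthogonal to the range of `V t` is an
integral over `(0, t]`. -/
theorem isIntegral_of_orthogonal (hb : IsOrthogonalCocycle V b) {t : ℝ≥0} {φ : ℝ → ℂ} {z : K}
    (hz : z ∈ space b) (h0 : ∀ y, ⟪V t y, z⟫_ℂ = 0)
    (h : ∀ s ≤ t, ⟪b s, z⟫_ℂ = ∫ r in (0 : ℝ)..s, φ r) : IsIntegral b t φ z := by
  refine ⟨hz, fun s => ?_⟩
  rcases le_total s t with hs | hs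
  · rw [min_eq_left hs, h s hs]
  · obtain ⟨r, rfl⟩ := exists_add_of_le hs
    rw [min_eq_right hs, hb.map_add, inner_add_left, h0, add_zero, h t le_rfl]

variable [CompleteSpace K]

theorem adjoint_map_self (hb : IsOrthogonalCocycle V b) (t : ℝ≥0) :
    ContinuousLinearMap.adjoint (V t) (b t) = 0 :=
  ext_inner_right ℂ fun y => by
    rw [ContinuousLinearMap.adjoint_inner_left, hb.inner_map, inner_zero_left]

theorem adjoint_map_add (hb : IsOrthogonalCocycle V b) (hV : IsC0Isometric V) (t s : ℝ≥0) :
    ContinuousLinearMap.adjoint (V t) (b (t + s)) = b s := by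
  rw [hb.map_add t s, _root_.map_add, hb.adjoint_map_self, zero_add,
    adjoint_apply_of_isometric (hV.norm_map t)]

/-- `(V t)*` sends `b s` to `b (s - t)` if `t ≤ s` and to `0` otherwise. With `map_mem_space`, the
span of the cocycle reduces `V`. -/
theorem adjoint_mem_space (hb : IsOrthogonalCocycle V b) (hV : IsC0Isometric V) (t : ℝ≥0)
    {z : K} (hz : z ∈ space b) : ContinuousLinearMap.adjoint (V t) z ∈ space b := by
  have hle : space b ≤ (space b).comap (ContinuousLinearMap.adjoint (V t)).toLinearMap :=
    space_le (isClosed_space.preimage (ContinuousLinearMap.adjoint (V t)).continuous) fun s => by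
      change ContinuousLinearMap.adjoint (V t) (b s) ∈ space b
      rcases le_total t s with h | h
      · obtain ⟨r, rfl⟩ := exists_add_of_le h
        rw [hb.adjoint_map_add hV]
        exact mem_space r
      · have : ContinuousLinearMap.adjoint (V t) (b s) = 0 := ext_inner_right ℂ fun y => by
          rw [ContinuousLinearMap.adjoint_inner_left, hb.inner_map_of_le hV.toIsC0Semigroup h,
            inner_zero_left]
        rw [this]
        exact Submodule.zero_mem _
  exact hle hz

-- The Wiener integral: `b s` and the indicators of `(0, s]` both have Gram matrix `min s r`, so
-- `L²((0, t])` embeds isometrically into the span of `b`.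
open MeasureTheory in
theorem exists_isIntegral (hb : IsOrthogonalCocycle V b) (hV : IsC0Isometric V) (t : ℝ≥0)
    {φ : ℝ → ℂ} (hφ : Continuous φ) :
    ∃ z, IsIntegral b t φ z ∧ ‖z‖ ^ 2 = ∫ r in (0 : ℝ)..t, ‖φ r‖ ^ 2 := by
  obtain ⟨I, hI⟩ := exists_linearIsometry_of_gram (w := fun s : Set.Iic t => b s)
    (span_indicatorIoc t) fun s r => by rw [inner_indicatorIoc_indicatorIoc, hb.inner_eq_min]
  have hrange : ∀ L : Submodule ℂ K, IsClosed (L : Set K) → (∀ s ≤ t, b s ∈ L) →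
      ∀ f, I f ∈ L := by
    intro L hL h f
    have hle : (Submodule.span ℂ (Set.range (indicatorIoc t))).topologicalClosure ≤
        L.comap I.toLinearMap := by
      refine Submodule.topologicalClosure_minimal _ (Submodule.span_le.2 ?_)
        (hL.preimage I.continuous)
      rintro _ ⟨s, rfl⟩
      change I _ ∈ L
      rw [hI]
      exact h s s.2
    rw [span_indicatorIoc] at hle
    exact hle (Submodule.mem_top (x := f))
  have hmem : MemLp φ 2 (volume.restrict (Set.Ioc 0 (t : ℝ))) := by
    obtain ⟨C, hC⟩ := isCompact_Icc.exists_bound_of_continuousOn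
      (s := Set.Icc 0 (t : ℝ)) hφ.continuousOn
    refine MemLp.of_bound hφ.aestronglyMeasurable C ?_
    rw [ae_restrict_iff' measurableSet_Ioc]
    exact Filter.Eventually.of_forall fun x hx => hC x ⟨hx.1.le, hx.2⟩
  have hae := hmem.coeFn_toLp
  refine ⟨I hmem.toLp, ⟨hrange _ isClosed_space (fun s _ => mem_space s) _, fun s => ?_⟩, ?_⟩
  · have hle : ∀ s : Set.Iic t, ⟪b s, I hmem.toLp⟫_ℂ = ∫ r in (0 : ℝ)..(s : ℝ≥0), φ r := by
      intro s
      rw [← hI, I.inner_map_map, inner_indicatorIoc]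
      refine intervalIntegral.integral_congr_ae_restrict ?_
      rw [Set.uIoc_of_le (NNReal.coe_nonneg _)]
      exact ae_restrict_of_ae_restrict_of_subset
        (Set.Ioc_subset_Ioc_right (by exact_mod_cast s.2)) hae
    rcases le_total s t with h | h
    · rw [min_eq_left h]
      exact hle ⟨s, h⟩
    · rw [min_eq_right h]
      obtain ⟨r, rfl⟩ := exists_add_of_le h
      -- Integrals over `(0, t]` are orthogonal to the increment `V t (b r)` of the cocycle after
      -- time `t`.
      have h0 := hrange (ℂ ∙ V t (b r))ᗮ (Submodule.isClosed_orthogonal _) (fun s hs => by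
        rw [Submodule.mem_orthogonal_singleton_iff_inner_left]
        exact hb.inner_map_of_le hV.toIsC0Semigroup hs _) hmem.toLp
      rw [Submodule.mem_orthogonal_singleton_iff_inner_right] at h0
      rw [hb.map_add, inner_add_left, h0, add_zero]
      exact hle ⟨t, Set.mem_Iic.2 le_rfl⟩
  · have h1 : ⟪hmem.toLp, hmem.toLp⟫_ℂ = ((∫ r in (0 : ℝ)..t, ‖φ r‖ ^ 2 : ℝ) : ℂ) := by
      rw [L2.inner_def, intervalIntegral.integral_of_le t.coe_nonneg, ← integral_complex_ofReal]
      refine integral_congr_ae ?_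
      filter_upwards [hae] with x hx
      rw [hx, inner_self_eq_norm_sq_to_K]
      push_cast
      rfl
    rw [I.norm_map]
    rw [inner_self_eq_norm_sq_to_K] at h1
    have h2 : ((‖hmem.toLp‖ ^ 2 : ℝ) : ℂ) = ((∫ r in (0 : ℝ)..t, ‖φ r‖ ^ 2 : ℝ) : ℂ) := by
      rw [← h1]; push_cast; rfl
    exact Complex.ofReal_injective h2

theorem IsIntegral.norm_sq (hb : IsOrthogonalCocycle V b) (hV : IsC0Isometric V) {t : ℝ≥0}
    {φ : ℝ → ℂ} {z : K} (hφ : Continuous φ) (hz : IsIntegral b t φ z) :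
    ‖z‖ ^ 2 = ∫ r in (0 : ℝ)..t, ‖φ r‖ ^ 2 := by
  obtain ⟨z', hz', h⟩ := hb.exists_isIntegral hV t hφ
  rw [hz.unique hz', h]

/-- The pairing of the integral with `b s` is constant for `s ≥ t`, so every increment of `b` after
time `t` is orthogonal to it; that is, `(V t)*` kills it. -/
theorem IsIntegral.inner_map (hb : IsOrthogonalCocycle V b) (hV : IsC0Isometric V) {t : ℝ≥0}
    {φ : ℝ → ℂ} {z : K} (hz : IsIntegral b t φ z) (y : K) : ⟪V t y, z⟫_ℂ = 0 := by
  rw [← ContinuousLinearMap.adjoint_inner_right]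
  have : ContinuousLinearMap.adjoint (V t) z = 0 := by
    refine eq_of_inner_eq (b := b) (hb.adjoint_mem_space hV t hz.mem) (Submodule.zero_mem _)
      fun s => ?_
    rw [ContinuousLinearMap.adjoint_inner_right, inner_zero_right,
      ← sub_eq_iff_eq_add'.2 (hb.map_add t s), inner_sub_left, hz.inner, hz.inner, min_self,
      min_eq_right le_self_add, sub_self]
  rw [this, inner_zero_right]

end IsOrthogonalCocycle

/-! ### Coupling of the unitary part with the shift -/

theorem norm_add_add_sq_of_orthogonal {K : Type*} [NormedAddCommGroup K] [InnerProductSpace ℂ K]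
    {x y z : K} (hxy : ⟪x, y⟫_ℂ = 0) (hxz : ⟪x, z⟫_ℂ = 0)
    (hyz : ⟪y, z⟫_ℂ = 0) : ‖x + y + z‖ ^ 2 = ‖x‖ ^ 2 + ‖y‖ ^ 2 + ‖z‖ ^ 2 := by
  have h1 := norm_add_sq_eq_norm_sq_add_norm_sq_of_inner_eq_zero (𝕜 := ℂ) x y hxy
  have h2 := norm_add_sq_eq_norm_sq_add_norm_sq_of_inner_eq_zero (𝕜 := ℂ) (x + y) z
    (by rw [inner_add_left, hxz, hyz, add_zero])
  nlinarith

theorem starProjection_eq_zero_iff {K : Type*} [NormedAddCommGroup K]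
    [InnerProductSpace ℂ K] {K₀ : Submodule ℂ K} [K₀.HasOrthogonalProjection] {x : K} :
    K₀.starProjection x = 0 ↔ x ∈ K₀ᗮ :=
  Submodule.starProjection_apply_eq_zero_iff K₀

section Coupling

variable {K : Type*} [NormedAddCommGroup K] [InnerProductSpace ℂ K] [CompleteSpace K]
  {V : ℝ≥0 → K →L[ℂ] K} {K₀ : Submodule ℂ K}

/-- A norm continuous stable contraction semigroup `E` on the range of the projection `P`, whose
energy dissipates through the single vector `g`. -/
structure IsDissipativeFlow (P : K →L[ℂ] K) (E : ℝ → K →L[ℂ] K) (g : K) : Prop where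
  zero : E 0 = P
  add : ∀ s t, 0 ≤ s → 0 ≤ t → E (s + t) = E s ∘L E t
  continuous : Continuous E
  map_g : P g = g
  energy : ∀ t, 0 ≤ t → ∀ x, ‖E t x‖ ^ 2 + ∫ s in (0 : ℝ)..t, ‖⟪g, E s x⟫_ℂ‖ ^ 2 = ‖P x‖ ^ 2
  stable : ∀ x, Filter.Tendsto (fun t => ContinuousLinearMap.adjoint (E t) x) Filter.atTop (𝓝 0)

namespace IsWoldDecomposition

variable (hW : IsWoldDecomposition V K₀)
include hW

theorem map_orthogonal (t : ℝ≥0) {y : K} (hy : y ∈ K₀ᗮ) : V t y ∈ K₀ᗮ := by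
  rw [Submodule.mem_orthogonal] at hy ⊢
  intro u hu
  rw [← ContinuousLinearMap.adjoint_inner_left]
  exact hy _ ((hW.unitary t).adjoint_mem u hu)

theorem adjoint_orthogonal (t : ℝ≥0) {y : K} (hy : y ∈ K₀ᗮ) :
    ContinuousLinearMap.adjoint (V t) y ∈ K₀ᗮ := by
  rw [Submodule.mem_orthogonal] at hy ⊢
  intro u hu
  rw [ContinuousLinearMap.adjoint_inner_right]
  exact hy _ ((hW.unitary t).map_mem u hu)

/-- `K₀` lies in the range of every `V s`, and `b s` is orthogonal to that range. -/
theorem space_le {b : ℝ≥0 → K} (hb : IsOrthogonalCocycle V b) :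
    IsOrthogonalCocycle.space b ≤ K₀ᗮ :=
  IsOrthogonalCocycle.space_le (Submodule.isClosed_orthogonal _) fun s => by
    rw [Submodule.mem_orthogonal']
    intro u hu
    obtain ⟨v, -, rfl⟩ := (hW.unitary s).surj u hu
    exact hb.inner_map s v

end IsWoldDecomposition

variable [K₀.HasOrthogonalProjection]

namespace IsDissipativeFlow

variable {E : ℝ → K →L[ℂ] K} {g : K} (hE : IsDissipativeFlow K₀.starProjection E g)
include hE

theorem apply_mem {t : ℝ} (ht : 0 ≤ t) (x : K) : E t x ∈ K₀ := by
  have h := hE.add 0 t le_rfl ht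
  rw [zero_add, hE.zero] at h
  rw [h]
  exact Submodule.starProjection_apply_mem _ _

theorem apply_starProjection {t : ℝ} (ht : 0 ≤ t) (x : K) : E t (K₀.starProjection x) = E t x := by
  have h := hE.add t 0 ht le_rfl
  rw [add_zero, hE.zero] at h
  exact (congrArg (fun A : K →L[ℂ] K => A x) h).symm

theorem apply_eq_zero {t : ℝ} (ht : 0 ≤ t) {x : K} (hx : x ∈ K₀ᗮ) : E t x = 0 := by
  rw [← hE.apply_starProjection ht, starProjection_eq_zero_iff.2 hx, map_zero]

theorem continuous_kernel (t : ℝ) (x : K) : Continuous fun r => ⟪g, E (t - r) x⟫_ℂ := by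
  have := hE.continuous
  fun_prop

theorem integral_norm_sq {t : ℝ} (ht : 0 ≤ t) (x : K) :
    ∫ r in (0 : ℝ)..t, ‖⟪g, E (t - r) x⟫_ℂ‖ ^ 2 = ‖K₀.starProjection x‖ ^ 2 - ‖E t x‖ ^ 2 := by
  rw [intervalIntegral.integral_comp_sub_left (fun r => ‖⟪g, E r x⟫_ℂ‖ ^ 2), sub_self, sub_zero,
    ← hE.energy t ht]
  ring

/-- The isometric semigroup in which the flow `E` emits into the shift generated by `b`. -/
theorem exists_coupling (hW : IsWoldDecomposition V K₀) (hV : IsC0Isometric V) {b : ℝ≥0 → K}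
    (hb : IsOrthogonalCocycle V b) :
    ∃ T : ℝ≥0 → K →L[ℂ] K, IsC0Isometric T ∧ (∀ t, ∀ y ∈ K₀ᗮ, T t y = V t y) ∧
      ∀ (t : ℝ≥0) x, ∃ z, IsOrthogonalCocycle.IsIntegral b t (fun r => ⟪g, E (t - r) x⟫_ℂ) z ∧
        T t (K₀.starProjection x) = E t x + z := by
  set P := K₀.starProjection with hP
  have hbK := hW.space_le hb
  choose J hJ hJn using fun (t : ℝ≥0) x => hb.exists_isIntegral hV t (hE.continuous_kernel t x)
  have hsub : ∀ x, x - P x ∈ K₀ᗮ := fun x => Submodule.sub_starProjection_mem_orthogonal x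
  have hPP : ∀ x, P (P x) = P x := fun x =>
    Submodule.starProjection_eq_self_iff.2 (Submodule.starProjection_apply_mem _ _)
  have hJadd : ∀ t x y, J t (x + y) = J t x + J t y := by
    intro t x y
    refine (hJ t (x + y)).unique ⟨Submodule.add_mem _ (hJ t x).mem (hJ t y).mem, fun s => ?_⟩
    rw [inner_add_right, (hJ t x).inner, (hJ t y).inner, ← intervalIntegral.integral_add
      ((hE.continuous_kernel t x).intervalIntegrable _ _)
      ((hE.continuous_kernel t y).intervalIntegrable _ _)]
    simp only [map_add, inner_add_right]
  have hJsmul : ∀ t (c : ℂ) x, J t (c • x) = c • J t x := by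
    intro t c x
    refine (hJ t (c • x)).unique ⟨Submodule.smul_mem _ _ (hJ t x).mem, fun s => ?_⟩
    rw [inner_smul_right, (hJ t x).inner, ← intervalIntegral.integral_const_mul]
    simp only [map_smul, inner_smul_right]
  have hJP : ∀ t x, J t (P x) = J t x := by
    intro t x
    refine (hJ t (P x)).unique ⟨(hJ t x).mem, fun s => ?_⟩
    rw [(hJ t x).inner]
    refine intervalIntegral.integral_congr fun r hr => ?_
    rw [Set.uIcc_of_le (NNReal.coe_nonneg _)] at hr
    have : (0 : ℝ) ≤ t - r := sub_nonneg.2 (hr.2.trans (by exact_mod_cast min_le_right _ _))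
    rw [hE.apply_starProjection this]
  have hEo : ∀ (t : ℝ≥0) x y, y ∈ K₀ᗮ → ⟪E t x, y⟫_ℂ = 0 := fun t x y hy =>
    Submodule.inner_right_of_mem_orthogonal (hE.apply_mem t.coe_nonneg x) hy
  -- The three terms lie in `K₀`, in the shift space orthogonally to the range of `V t`, and in `V t
  -- K₀ᗮ`. The energy identity of the flow is exactly what makes the sum isometric.
  let L : ℝ≥0 → K →ₗᵢ[ℂ] K := fun t =>
    { toFun := fun x => E t x + J t x + V t (x - P x)
      map_add' := fun x y => by simp only [map_add, map_sub, hJadd]; abel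
      map_smul' := fun c x => by simp only [map_smul, map_sub, hJsmul, smul_add, smul_sub,
        RingHom.id_apply]
      norm_map' := fun x => by
        refine (sq_eq_sq₀ (norm_nonneg _) (norm_nonneg _)).1 ?_
        change ‖E t x + J t x + V t (x - P x)‖ ^ 2 = _
        rw [norm_add_add_sq_of_orthogonal (hEo t x _ (hbK (hJ t x).mem))
          (hEo t x _ (hW.map_orthogonal t (hsub x)))
          (by rw [← inner_conj_symm, (hJ t x).inner_map hb hV, map_zero]), hJn,
          hE.integral_norm_sq t.coe_nonneg, hV.norm_map]
        have := norm_add_sq_eq_norm_sq_add_norm_sq_of_inner_eq_zero (𝕜 := ℂ) (P x) (x - P x)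
          (Submodule.inner_right_of_mem_orthogonal (Submodule.starProjection_apply_mem _ _) (hsub x))
        rw [add_sub_cancel] at this
        linarith }
  let T : ℝ≥0 → K →L[ℂ] K := fun t => (L t).toContinuousLinearMap
  have hT : ∀ t x, T t x = E t x + J t x + V t (x - P x) := fun t x => rfl
  have hTn : ∀ t x, ‖T t x‖ = ‖x‖ := fun t x => (L t).norm_map x
  have hT1 : ∀ t, ∀ y ∈ K₀ᗮ, T t y = V t y := by
    intro t y hy
    have h0 : P y = 0 := starProjection_eq_zero_iff.2 hy
    have h1 : J t y = 0 := by 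
      have := hJsmul t 0 0
      rw [zero_smul, zero_smul] at this
      rw [← hJP, h0, this]
    rw [hT, hE.apply_eq_zero t.coe_nonneg hy, h1, h0, sub_zero, zero_add, zero_add]
  have hT0 : ∀ t x, T t (P x) = E t x + J t x := by
    intro t x
    rw [hT, hPP, sub_self, map_zero, add_zero, hE.apply_starProjection t.coe_nonneg, hJP]
  have hTdec : ∀ t x, T t x = E t x + J t x + V t (x - P x) := hT
  -- The emission during the first `t` units of time is shifted by `V s` to `(s, s + t]`; the later
  -- emission, from the state `E t x`, fills `(0, s]`.
  have hJadd' : ∀ (s t : ℝ≥0) x, J (s + t) x = J s (E t x) + V s (J t x) := by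
    intro s t x
    refine (hJ (s + t) x).unique ⟨Submodule.add_mem _ (hJ _ _).mem
      (hb.map_mem_space s (hJ _ _).mem), fun r => ?_⟩
    rw [inner_add_right, (hJ _ _).inner]
    have hker : ∀ c : ℝ≥0, c ≤ s → ∫ u in (0 : ℝ)..c, ⟪g, E (s - u) (E t x)⟫_ℂ =
        ∫ u in (0 : ℝ)..c, ⟪g, E ((s + t : ℝ≥0) - u) x⟫_ℂ := by
      intro c hc
      refine intervalIntegral.integral_congr fun u hu => ?_
      rw [Set.uIcc_of_le c.coe_nonneg] at hu
      have h1 : (0 : ℝ) ≤ s - u := sub_nonneg.2 (hu.2.trans (by exact_mod_cast hc))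
      have h2 := hE.add _ t h1 t.coe_nonneg
      rw [NNReal.coe_add, add_sub_right_comm, h2]
      rfl
    rw [hker _ (min_le_right r s)]
    rcases le_total r s with h | h
    · rw [hb.inner_map_of_le hV.toIsC0Semigroup h, add_zero, min_eq_left h,
        min_eq_left (h.trans le_self_add)]
    · obtain ⟨r, rfl⟩ := exists_add_of_le h
      rw [min_eq_right h, hb.map_add, inner_add_left, hb.inner_map, zero_add,
        ← ContinuousLinearMap.adjoint_inner_left, adjoint_apply_of_isometric (hV.norm_map s),
        (hJ _ _).inner, min_add_add_left]
      have hshift : ∫ u in (0 : ℝ)..(min r t : ℝ≥0), ⟪g, E (t - u) x⟫_ℂ =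
          ∫ u in (s : ℝ)..(s + min r t : ℝ≥0), ⟪g, E ((s + t : ℝ≥0) - u) x⟫_ℂ := by
        have := intervalIntegral.integral_comp_add_right (a := 0) (b := ((min r t : ℝ≥0) : ℝ))
          (fun u => ⟪g, E ((s + t : ℝ≥0) - u) x⟫_ℂ) s
        rw [zero_add] at this
        rw [NNReal.coe_add s (min r t), add_comm (s : ℝ), ← this]
        refine intervalIntegral.integral_congr fun u _ => ?_
        rw [NNReal.coe_add]
        congr 3
        ring
      rw [hshift]
      have hi := fun a c => (hE.continuous_kernel (s + t : ℝ≥0) x).intervalIntegrable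
        (μ := MeasureTheory.volume) a c
      exact (intervalIntegral.integral_add_adjacent_intervals (hi _ _) (hi _ _))
  have hadd : ∀ s t, T (s + t) = T s ∘L T t := by
    intro s t
    ext x
    rw [ContinuousLinearMap.comp_apply, hT (s + t), hT t, map_add, map_add,
      hT1 s _ (hbK (hJ t x).mem), hT1 s _ (hW.map_orthogonal t (hsub x))]
    have hE1 : P (E t x) = E t x :=
      Submodule.starProjection_eq_self_iff.2 (hE.apply_mem t.coe_nonneg x)
    have h2 := hT0 s (E t x)
    rw [hE1] at h2
    rw [h2, hJadd', hV.map_add, NNReal.coe_add, hE.add _ _ s.coe_nonneg t.coe_nonneg]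
    simp only [ContinuousLinearMap.comp_apply]
    abel
  have hcont0 : ∀ x, Filter.Tendsto (fun t => T t x) (𝓝 0) (𝓝 x) := by
    intro x
    have hE0 : Filter.Tendsto (fun t : ℝ≥0 => E t x) (𝓝 0) (𝓝 (P x)) := by
      have : Continuous fun t : ℝ≥0 => E t x := by
        have := hE.continuous
        fun_prop
      have h := this.tendsto 0
      rwa [NNReal.coe_zero, hE.zero] at h
    -- The square norm of the emitted part is the energy lost, `‖P x‖² - ‖E t x‖²`.
    have hJ0 : Filter.Tendsto (fun t : ℝ≥0 => J t x) (𝓝 0) (𝓝 0) := by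
      rw [tendsto_zero_iff_norm_tendsto_zero]
      have h1 : Filter.Tendsto (fun t : ℝ≥0 => ‖J t x‖ ^ 2) (𝓝 0) (𝓝 0) := by
        simp_rw [hJn, fun t : ℝ≥0 => hE.integral_norm_sq t.coe_nonneg x]
        have := (tendsto_const_nhds (x := ‖P x‖ ^ 2)).sub (hE0.norm.pow 2)
        rwa [sub_self] at this
      have h2 := (Real.continuous_sqrt.tendsto _).comp h1
      rw [Real.sqrt_zero] at h2
      refine h2.congr fun t => ?_
      simp [Real.sqrt_sq]
    have hV0 : Filter.Tendsto (fun t : ℝ≥0 => V t (x - P x)) (𝓝 0) (𝓝 (x - P x)) := by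
      have := (hV.continuous (x - P x)).tendsto 0
      rwa [hV.map_zero] at this
    have := (hE0.add hJ0).add hV0
    rw [add_zero, add_sub_cancel] at this
    exact this
  refine ⟨T, ⟨⟨?_, hadd, fun x => continuous_of_tendsto_zero hadd hTn (hcont0 x)⟩, hTn⟩, hT1,
    fun t x => ⟨J t x, hJ t x, hT0 t x⟩⟩
  ext x
  have h0 : J 0 x = 0 := by
    have := hJn 0 x
    rw [NNReal.coe_zero, intervalIntegral.integral_same] at this
    simpa using this
  rw [hT, h0, NNReal.coe_zero, hE.zero, hV.map_zero]
  simp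

end IsDissipativeFlow

end Coupling

/-! ### The outgoing cocycle of the coupled semigroup. -/

section Intertwiner

variable {K : Type*} [NormedAddCommGroup K] [InnerProductSpace ℂ K] [CompleteSpace K]
  {V : ℝ≥0 → K →L[ℂ] K} {K₀ : Submodule ℂ K} [K₀.HasOrthogonalProjection]
  {E : ℝ → K →L[ℂ] K} {g : K} {b : ℝ≥0 → K} {T : ℝ≥0 → K →L[ℂ] K}

/-- Splitting `t` into `m` equal parts multiplies the deviation of the square roots at `t / m` by
`√m`, while the bound there is `c t / m`; the total `c t / √m` tends to `0`. -/
theorem eq_of_additive_of_sqrt_bound {n : ℝ≥0 → ℝ} {c : ℝ} (hn : ∀ t, 0 ≤ n t)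
    (hadd : ∀ s t, n (s + t) = n s + n t) (h : ∀ t : ℝ≥0, |√(n t) - √t| ≤ c * t) (t : ℝ≥0) :
    n t = t := by
  have hmul : ∀ (m : ℕ) s, n (m * s) = m * n s := by
    intro m s
    induction m with
    | zero =>
      have := hadd 0 0
      simp at this
      simp [this]
    | succ m ih =>
      push_cast
      rw [add_mul, one_mul, hadd, ih]
      ring
  have hbound : ∀ m : ℕ, 0 < m → |√(n t) - √t| ≤ c * t * (√m)⁻¹ := by
    intro m hm
    have hm0 : (0 : ℝ) < m := by exact_mod_cast hm
    have hm1 : (m : ℝ≥0) ≠ 0 := by exact_mod_cast hm.ne'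
    have h1 := h (t / m)
    have e1 : n t = m * n (t / m) := by rw [← hmul, mul_div_cancel₀ _ hm1]
    have e2 : (t : ℝ) = m * ((t / m : ℝ≥0) : ℝ) := by
      push_cast
      field_simp
    have hs : 0 < √(m : ℝ) := Real.sqrt_pos.2 hm0
    calc |√(n t) - √t| = √m * |√(n (t / m)) - √((t / m : ℝ≥0) : ℝ)| := by
          rw [← abs_of_pos hs]
          rw [← abs_mul, mul_sub, ← Real.sqrt_mul hm0.le,
            ← Real.sqrt_mul hm0.le, ← e1, ← e2]
      _ ≤ √m * (c * ((t / m : ℝ≥0) : ℝ)) := mul_le_mul_of_nonneg_left h1 hs.le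
      _ = c * t * (√m)⁻¹ := by
          push_cast
          have : (m : ℝ) = √m * √m := (Real.mul_self_sqrt hm0.le).symm
          rw [div_eq_mul_inv, this, mul_inv]
          rw [Real.sqrt_mul_self hs.le]
          field_simp
  have hlim : Filter.Tendsto (fun m : ℕ => c * t * (√(m : ℝ))⁻¹) Filter.atTop (𝓝 (c * t * 0)) :=
    (tendsto_inv_atTop_zero.comp (Real.tendsto_sqrt_atTop.comp tendsto_natCast_atTop_atTop)).const_mul _
  have h0 : |√(n t) - √t| ≤ 0 := by
    rw [mul_zero] at hlim
    refine ge_of_tendsto hlim ?_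
    filter_upwards [Filter.eventually_gt_atTop 0] with m hm using hbound m hm
  have h1 : √(n t) = √t := sub_eq_zero.1 (abs_nonpos_iff.1 h0)
  exact (Real.sqrt_inj (hn t) t.coe_nonneg).1 h1

/-- The isometric semigroup `T` couples the flow `E` on `K₀` to the shift generated by `b`. -/
structure IsCoupling (K₀ : Submodule ℂ K) [K₀.HasOrthogonalProjection] (V : ℝ≥0 → K →L[ℂ] K)
    (b : ℝ≥0 → K) (E : ℝ → K →L[ℂ] K) (g : K) (T : ℝ≥0 → K →L[ℂ] K) : Prop where
  wold : IsWoldDecomposition V K₀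
  isometric : IsC0Isometric V
  cocycle : IsOrthogonalCocycle V b
  flow : IsDissipativeFlow K₀.starProjection E g
  coupled : IsC0Isometric T
  apply_orthogonal : ∀ t, ∀ y ∈ K₀ᗮ, T t y = V t y
  exists_isIntegral : ∀ (t : ℝ≥0) x, ∃ z,
    IsOrthogonalCocycle.IsIntegral b t (fun r => ⟪g, E (t - r) x⟫_ℂ) z ∧
      T t (K₀.starProjection x) = E t x + z

/-- The image `b t - ∫ T r g dr` of the cocycle under the intertwiner of `V` and `T`. -/
noncomputable def coupledCocycle (T : ℝ≥0 → K →L[ℂ] K) (b : ℝ≥0 → K) (g : K) (t : ℝ≥0) : K :=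
  b t - ∫ r in (0 : ℝ)..t, T r.toNNReal g

namespace IsCoupling

variable (h : IsCoupling K₀ V b E g T)
include h

theorem space_le : IsOrthogonalCocycle.space b ≤ K₀ᗮ := h.wold.space_le h.cocycle

theorem cocycle_mem (t : ℝ≥0) : b t ∈ K₀ᗮ := h.space_le (IsOrthogonalCocycle.mem_space t)

theorem g_mem : g ∈ K₀ := Submodule.starProjection_eq_self_iff.1 h.flow.map_g

theorem decomp (t : ℝ≥0) (y : K) : ∃ z,
    IsOrthogonalCocycle.IsIntegral b t (fun r => ⟪g, E (t - r) y⟫_ℂ) z ∧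
      T t y = E t y + z + V t (y - K₀.starProjection y) := by
  obtain ⟨z, hz, hTz⟩ := h.exists_isIntegral t y
  refine ⟨z, hz, ?_⟩
  rw [← hTz, ← h.apply_orthogonal t _ (Submodule.sub_starProjection_mem_orthogonal y), ← map_add,
    add_sub_cancel]

/-- Emission goes into `K₀ᗮ`, which never feeds back into `K₀`: the compression of `T` to `K₀` is
the flow. -/
theorem inner_map_of_mem (t : ℝ≥0) {x : K} (hx : x ∈ K₀) (y : K) :
    ⟪x, T t y⟫_ℂ = ⟪x, E t y⟫_ℂ := by
  obtain ⟨z, hz, hT⟩ := h.decomp t y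
  rw [hT, inner_add_right, inner_add_right,
    Submodule.inner_right_of_mem_orthogonal hx (h.space_le hz.mem),
    Submodule.inner_right_of_mem_orthogonal hx
      (h.wold.map_orthogonal t (Submodule.sub_starProjection_mem_orthogonal y)), add_zero, add_zero]

theorem inner_coupled (t : ℝ≥0) (x y : K) : ⟪T t x, T t y⟫_ℂ = ⟪x, y⟫_ℂ := by
  rw [← ContinuousLinearMap.adjoint_inner_left, adjoint_apply_of_isometric (h.coupled.norm_map t)]

/-- Orthogonality holds because the pairing of `b t` with `T t y` is `∫ ⟪g, E (t - r) y⟫ dr`, which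
equals `∫ ⟪T r g, T t y⟫ dr`. It makes the square norm additive, and since the correction to `b t`
is `O(t)`, negligible against `‖b t‖ = √t`, the square norm must be `t`. -/
theorem coupledCocycle_isOrthogonalCocycle : IsOrthogonalCocycle T (coupledCocycle T b g) := by
  have hc := h.coupled.continuous_toNNReal g
  have hadd : ∀ s t, coupledCocycle T b g (s + t) =
      coupledCocycle T b g s + T s (coupledCocycle T b g t) := by
    intro s t
    simp only [coupledCocycle]
    rw [h.coupled.integral_add, h.cocycle.map_add, map_sub,
      h.apply_orthogonal s _ (h.cocycle_mem t)]
    abel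
  have horth : ∀ t y, ⟪coupledCocycle T b g t, T t y⟫_ℂ = 0 := by
    intro t y
    rw [coupledCocycle, inner_sub_left, inner_intervalIntegral_left hc, sub_eq_zero]
    obtain ⟨z, hz, hT⟩ := h.decomp t y
    rw [hT, inner_add_right, inner_add_right, Submodule.inner_left_of_mem_orthogonal
      (h.flow.apply_mem t.coe_nonneg y) (h.cocycle_mem t), h.cocycle.inner_map, zero_add, add_zero,
      hz.inner, min_self, ← hT]
    refine intervalIntegral.integral_congr fun r hr => ?_
    rw [Set.uIcc_of_le t.coe_nonneg] at hr
    have h1 : r.toNNReal ≤ t := Real.toNNReal_le_iff_le_coe.2 hr.2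
    have h2 : t = r.toNNReal + (t - r.toNNReal) := (add_tsub_cancel_of_le h1).symm
    have h3 : ((t - r.toNNReal : ℝ≥0) : ℝ) = t - r := by
      rw [NNReal.coe_sub h1, Real.coe_toNNReal _ hr.1]
    conv_rhs => rw [h2]
    rw [h.coupled.map_add, ContinuousLinearMap.comp_apply, h.inner_coupled,
      h.inner_map_of_mem _ h.g_mem, h3]
  refine ⟨hadd, horth, ?_⟩
  refine eq_of_additive_of_sqrt_bound (c := ‖g‖) (fun t => by positivity) (fun s t => ?_) fun t => ?_
  · have := norm_add_sq_eq_norm_sq_add_norm_sq_of_inner_eq_zero (𝕜 := ℂ) _ _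
      (horth s (coupledCocycle T b g t))
    rw [hadd, sq, sq, sq, this, h.coupled.norm_map]
  · have hbt : √(t : ℝ) = ‖b t‖ := by rw [← h.cocycle.norm_sq t, Real.sqrt_sq (norm_nonneg _)]
    rw [Real.sqrt_sq (norm_nonneg _), hbt]
    refine (abs_norm_sub_norm_le _ _).trans ?_
    rw [coupledCocycle, sub_sub_cancel_left, norm_neg]
    have := intervalIntegral.norm_integral_le_of_norm_le_const (a := 0) (b := (t : ℝ)) (C := ‖g‖)
      (f := fun r => T r.toNNReal g) fun r _ => (h.coupled.norm_map _ g).le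
    rwa [sub_zero, abs_of_nonneg t.coe_nonneg] at this

/-- The vectors orthogonal to `K₀` and to the shift space, on which the coupling is trivial. -/
theorem map_mem_sup (t : ℝ≥0) {k y : K} (hk₀ : k ∈ K₀ᗮ)
    (hk : k ∈ (IsOrthogonalCocycle.space b)ᗮ)
    (hy : ∀ k ∈ K₀ᗮ, k ∈ (IsOrthogonalCocycle.space b)ᗮ → ⟪k, y⟫_ℂ = 0) : ⟪k, T t y⟫_ℂ = 0 := by
  obtain ⟨z, hz, hT⟩ := h.decomp t y
  rw [hT, inner_add_right, inner_add_right,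
    Submodule.inner_left_of_mem_orthogonal (h.flow.apply_mem t.coe_nonneg y) hk₀,
    Submodule.inner_left_of_mem_orthogonal hz.mem hk, map_sub, inner_sub_right,
    ← ContinuousLinearMap.adjoint_inner_left, ← ContinuousLinearMap.adjoint_inner_left, hy,
    Submodule.inner_left_of_mem_orthogonal (Submodule.starProjection_apply_mem _ _)
    (h.wold.adjoint_orthogonal t hk₀)]
  · simp
  · exact h.wold.adjoint_orthogonal t hk₀
  · rw [Submodule.mem_orthogonal] at hk ⊢
    intro u hu
    rw [ContinuousLinearMap.adjoint_inner_right]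
    exact hk _ (h.cocycle.map_mem_space t hu)

/-- The left side is `‖E t x - x‖²` plus the lost energy `‖x‖² - ‖E t x‖²`; both are controlled by
`‖E t - P‖`. Norm continuity of the flow thus makes `T t` uniformly close to the identity on the
unit ball of `K₀`. -/
theorem norm_coupled_sub_sq_le (t : ℝ≥0) {x : K} (hx : x ∈ K₀) : ‖T t x - x‖ ^ 2 ≤
    (‖E t - K₀.starProjection‖ ^ 2 + 2 * ‖E t - K₀.starProjection‖) * ‖x‖ ^ 2 := by
  obtain ⟨z, hz, hT⟩ := h.exists_isIntegral t x
  rw [Submodule.starProjection_eq_self_iff.2 hx] at hT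
  have hz2 := hz.norm_sq h.cocycle h.isometric (h.flow.continuous_kernel t x)
  rw [h.flow.integral_norm_sq t.coe_nonneg, Submodule.starProjection_eq_self_iff.2 hx] at hz2
  have h1 : ‖E t x - x‖ ≤ ‖E t - K₀.starProjection‖ * ‖x‖ := by
    have := (E t - K₀.starProjection).le_opNorm x
    rwa [sub_apply, Submodule.starProjection_eq_self_iff.2 hx] at this
  have h2 := norm_add_sq_eq_norm_sq_add_norm_sq_of_inner_eq_zero (𝕜 := ℂ) (E t x - x) z
    (Submodule.inner_right_of_mem_orthogonal
      (Submodule.sub_mem _ (h.flow.apply_mem t.coe_nonneg x) hx) (h.space_le hz.mem))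
  have h3 : ‖x‖ - ‖E t x‖ ≤ ‖E t x - x‖ := by
    rw [norm_sub_rev]; exact norm_sub_norm_le _ _
  have h4 : ‖E t x‖ ≤ ‖x‖ := by
    refine (sq_le_sq₀ (norm_nonneg _) (norm_nonneg _)).1 ?_
    nlinarith [sq_nonneg ‖z‖]
  have e : T t x - x = (E t x - x) + z := by rw [hT]; abel
  rw [e, sq, h2, ← sq, ← sq, hz2]
  set c := ‖E t - K₀.starProjection‖
  have h5 : ‖E t x - x‖ ^ 2 ≤ c ^ 2 * ‖x‖ ^ 2 := by
    rw [← mul_pow]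
    gcongr
  have h6 : ‖x‖ ^ 2 - ‖E t x‖ ^ 2 ≤ 2 * c * ‖x‖ ^ 2 := by
    have : ‖x‖ - ‖E t x‖ ≤ c * ‖x‖ := h3.trans h1
    nlinarith [norm_nonneg x, norm_nonneg (E t x)]
  linarith

theorem eq_add_of_orthogonal {y : K}
    (hy : ∀ k ∈ K₀ᗮ, k ∈ (IsOrthogonalCocycle.space b)ᗮ → ⟪k, y⟫_ℂ = 0) :
    y - K₀.starProjection y ∈ IsOrthogonalCocycle.space b := by
  have : CompleteSpace (IsOrthogonalCocycle.space b) :=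
    IsOrthogonalCocycle.isClosed_space.completeSpace_coe
  rw [← Submodule.orthogonal_orthogonal (IsOrthogonalCocycle.space b), Submodule.mem_orthogonal]
  intro k hk
  have hk2 : k - K₀.starProjection k ∈ (IsOrthogonalCocycle.space b)ᗮ := by
    refine Submodule.sub_mem _ hk ?_
    rw [Submodule.mem_orthogonal']
    intro u hu
    exact Submodule.inner_right_of_mem_orthogonal (Submodule.starProjection_apply_mem _ _)
      (h.space_le hu)
  have h1 := hy _ (Submodule.sub_starProjection_mem_orthogonal k) hk2
  have h2 : ⟪K₀.starProjection k, y - K₀.starProjection y⟫_ℂ = 0 :=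
    Submodule.inner_right_of_mem_orthogonal (Submodule.starProjection_apply_mem _ _)
      (Submodule.sub_starProjection_mem_orthogonal y)
  have h3 : ⟪k - K₀.starProjection k, K₀.starProjection y⟫_ℂ = 0 :=
    Submodule.inner_left_of_mem_orthogonal (Submodule.starProjection_apply_mem _ _)
      (Submodule.sub_starProjection_mem_orthogonal k)
  rw [inner_sub_left] at h1 h3
  rw [inner_sub_right] at h2 ⊢
  linear_combination h1 + h2 - h3

/-- For small `t`, the range of `T t` together with the coupled cocycle up to time `t` spans. -/
theorem exists_pos_forall_eq_zero : ∃ t : ℝ≥0, 0 < t ∧ ∀ y : K,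
    (∀ k ∈ K₀ᗮ, k ∈ (IsOrthogonalCocycle.space b)ᗮ → ⟪k, y⟫_ℂ = 0) →
    (∀ w, ⟪T t w, y⟫_ℂ = 0) → (∀ s ≤ t, ⟪coupledCocycle T b g s, y⟫_ℂ = 0) → y = 0 := by
  set P := K₀.starProjection with hP
  have hEc := h.flow.continuous
  -- The time is chosen to make this quantity less than `1`. It bounds the ratio to `‖y‖²` of the
  -- sum of the square norms of the `K₀` and shift components of `y`, which forces `y = 0`.
  have hlim : Filter.Tendsto (fun t : ℝ => (‖E t - P‖ ^ 2 + 2 * ‖E t - P‖) + t * ‖g‖ ^ 2)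
      (𝓝[>] 0) (𝓝 0) := by
    have hcont : Continuous fun t : ℝ => (‖E t - P‖ ^ 2 + 2 * ‖E t - P‖) + t * ‖g‖ ^ 2 := by
      fun_prop
    have := hcont.tendsto 0
    rw [h.flow.zero, ← hP] at this
    simp only [sub_self, norm_zero] at this
    norm_num at this
    exact this.mono_left nhdsWithin_le_nhds
  obtain ⟨t, ht1, ht0⟩ := ((hlim.eventually (gt_mem_nhds one_pos)).and self_mem_nhdsWithin).exists
  lift t to ℝ≥0 using (le_of_lt ht0)
  refine ⟨t, by exact_mod_cast ht0, fun y hyk hyT hyb => ?_⟩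
  set c := ‖E t - P‖ ^ 2 + 2 * ‖E t - P‖ with hc
  have hPy : P y ∈ K₀ := Submodule.starProjection_apply_mem _ _
  have hzK : y - P y ∈ K₀ᗮ := Submodule.sub_starProjection_mem_orthogonal y
  have hz := h.eq_add_of_orthogonal hyk
  have hpy := norm_add_sq_eq_norm_sq_add_norm_sq_of_inner_eq_zero (𝕜 := ℂ) (P y) (y - P y)
    (Submodule.inner_right_of_mem_orthogonal hPy hzK)
  rw [add_sub_cancel] at hpy
  -- As `y` is orthogonal to the range of `T t`, `‖P y‖² = ⟪P y - T t (P y), y⟫`, which is small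
  -- compared with `‖P y‖ ‖y‖`.
  have hx : ‖P y‖ ^ 2 ≤ c * ‖y‖ ^ 2 := by
    have e1 : ⟪P y - T t (P y), y⟫_ℂ = ((‖P y‖ ^ 2 : ℝ) : ℂ) := by
      rw [inner_sub_left, hyT, sub_zero]
      have : ⟪P y, y⟫_ℂ = ⟪P y, P y⟫_ℂ := by
        rw [← sub_eq_zero, ← inner_sub_right, Submodule.inner_right_of_mem_orthogonal hPy hzK]
      rw [this, inner_self_eq_norm_sq_to_K]
      push_cast
      rfl
    have e2 : ‖P y‖ ^ 2 ≤ ‖T t (P y) - P y‖ * ‖y‖ := by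
      have := norm_inner_le_norm (𝕜 := ℂ) (P y - T t (P y)) y
      rw [e1, Complex.norm_real, Real.norm_of_nonneg (by positivity), norm_sub_rev] at this
      exact this
    have e3 := h.norm_coupled_sub_sq_le t hPy
    rw [← hP, ← hc] at e3
    have e4 : (‖P y‖ ^ 2) ^ 2 ≤ (c * ‖y‖ ^ 2) * ‖P y‖ ^ 2 := by
      calc (‖P y‖ ^ 2) ^ 2 ≤ (‖T t (P y) - P y‖ * ‖y‖) ^ 2 := by gcongr
        _ = ‖T t (P y) - P y‖ ^ 2 * ‖y‖ ^ 2 := by ring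
        _ ≤ (c * ‖P y‖ ^ 2) * ‖y‖ ^ 2 := by gcongr
        _ = _ := by ring
    rcases eq_or_lt_of_le (sq_nonneg ‖P y‖) with h0 | h0
    · rw [← h0]
      positivity
    · rw [sq (‖P y‖ ^ 2)] at e4
      exact le_of_mul_le_mul_right e4 h0
  have hTg := h.coupled.continuous_toNNReal g
  have hφ : Continuous fun r : ℝ => ⟪T r.toNNReal g, y⟫_ℂ := hTg.inner continuous_const
  -- Orthogonality to the coupled cocycle says that `⟪b s, y⟫ = ∫ ⟪T r g, y⟫ dr` for `s ≤ t`, which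
  -- identifies the shift component of `y`.
  have hint : IsOrthogonalCocycle.IsIntegral b t (fun r => ⟪T r.toNNReal g, y⟫_ℂ) (y - P y) := by
    refine IsOrthogonalCocycle.isIntegral_of_orthogonal h.cocycle hz (fun w => ?_) fun s hs => ?_
    · have e1 : ⟪V t (P w), y - P y⟫_ℂ = 0 := Submodule.inner_right_of_mem_orthogonal
        ((h.wold.unitary t).map_mem _ (Submodule.starProjection_apply_mem _ _)) hzK
      have hw : w - P w ∈ K₀ᗮ := Submodule.sub_starProjection_mem_orthogonal w
      have e2 : ⟪V t (w - P w), y - P y⟫_ℂ = 0 := by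
        rw [inner_sub_right, Submodule.inner_left_of_mem_orthogonal hPy
          (h.wold.map_orthogonal t hw), ← h.apply_orthogonal t _ hw, hyT, sub_zero]
      rw [← add_sub_cancel (P w) w, map_add, inner_add_left, e1, e2, add_zero]
    · have := hyb s hs
      rw [coupledCocycle, inner_sub_left, inner_intervalIntegral_left hTg, sub_eq_zero] at this
      rw [inner_sub_right, Submodule.inner_left_of_mem_orthogonal hPy (h.cocycle_mem s), sub_zero,
        this]
  have hzn : ‖y - P y‖ ^ 2 ≤ (t * ‖g‖ ^ 2) * ‖y‖ ^ 2 := by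
    rw [hint.norm_sq h.cocycle h.isometric hφ]
    have e1 : (t * ‖g‖ ^ 2) * ‖y‖ ^ 2 = ∫ _ in (0 : ℝ)..t, (‖g‖ * ‖y‖) ^ 2 := by
      rw [intervalIntegral.integral_const, smul_eq_mul]
      ring
    rw [e1]
    refine intervalIntegral.integral_mono_on t.coe_nonneg ((hφ.norm.pow 2).intervalIntegrable _ _)
      (by simp) fun r _ => ?_
    gcongr
    refine (norm_inner_le_norm _ _).trans ?_
    rw [h.coupled.norm_map]
  have hfin : ‖y‖ ^ 2 ≤ (c + t * ‖g‖ ^ 2) * ‖y‖ ^ 2 := by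
    nlinarith
  have : ‖y‖ ^ 2 ≤ 0 := by
    by_contra hcon
    push Not at hcon
    nlinarith
  simpa using le_antisymm this (sq_nonneg _)

end IsCoupling

end Intertwiner

/-! ### The coisometry intertwining `V` with the coupled semigroup. -/

section Intertwiner

variable {K : Type*} [NormedAddCommGroup K] [InnerProductSpace ℂ K] [CompleteSpace K]
  {V : ℝ≥0 → K →L[ℂ] K} {K₀ : Submodule ℂ K} [K₀.HasOrthogonalProjection]
  {E : ℝ → K →L[ℂ] K} {g : K} {b : ℝ≥0 → K} {T : ℝ≥0 → K →L[ℂ] K}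

/-- `Ω` is a coisometry with kernel `K₀` which intertwines `V` and `T`, carries the cocycle of `V`
to that of `T` and is the identity where the coupling is trivial. -/
structure IsIntertwiner (K₀ : Submodule ℂ K) [K₀.HasOrthogonalProjection] (V : ℝ≥0 → K →L[ℂ] K)
    (b : ℝ≥0 → K) (g : K) (T : ℝ≥0 → K →L[ℂ] K) (Ω : K →L[ℂ] K) : Prop where
  apply_adjoint : ∀ y, Ω (ContinuousLinearMap.adjoint Ω y) = y
  adjoint_apply : ∀ y, ContinuousLinearMap.adjoint Ω (Ω y) = y - K₀.starProjection y
  map_semigroup : ∀ t y, Ω (V t y) = T t (Ω y)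
  map_cocycle : ∀ t, Ω (b t) = coupledCocycle T b g t
  map_self : ∀ k ∈ K₀ᗮ, k ∈ (IsOrthogonalCocycle.space b)ᗮ → Ω k = k

namespace IsCoupling

variable (h : IsCoupling K₀ V b E g T)
include h

theorem sup_eq_top {L : Submodule ℂ K} (h0 : K₀ ≤ L) (h1 : IsOrthogonalCocycle.space b ≤ L)
    (h2 : ∀ k ∈ K₀ᗮ, k ∈ (IsOrthogonalCocycle.space b)ᗮ → k ∈ L) (y : K) : y ∈ L := by
  have : CompleteSpace (IsOrthogonalCocycle.space b) :=
    IsOrthogonalCocycle.isClosed_space.completeSpace_coe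
  set Q := (IsOrthogonalCocycle.space b).starProjection
  set P := K₀.starProjection
  have e : y = P y + Q y + (y - P y - Q y) := by abel
  rw [e]
  refine Submodule.add_mem _ (Submodule.add_mem _ (h0 (Submodule.starProjection_apply_mem _ _))
    (h1 (Submodule.starProjection_apply_mem _ _))) (h2 _ ?_ ?_)
  · exact Submodule.sub_mem _ (Submodule.sub_starProjection_mem_orthogonal y)
      (h.space_le (Submodule.starProjection_apply_mem _ _))
  · rw [sub_right_comm]
    refine Submodule.sub_mem _ (Submodule.sub_starProjection_mem_orthogonal y) ?_
    rw [Submodule.mem_orthogonal']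
    intro u hu
    exact Submodule.inner_right_of_mem_orthogonal (Submodule.starProjection_apply_mem _ _)
      (h.space_le hu)

/-- The vectors orthogonal to the coupled cocycle and to the trivial part vanish. -/
theorem eq_zero_of_orthogonal {y : K}
    (hyk : ∀ k ∈ K₀ᗮ, k ∈ (IsOrthogonalCocycle.space b)ᗮ → ⟪k, y⟫_ℂ = 0)
    (hyb : ∀ s, ⟪coupledCocycle T b g s, y⟫_ℂ = 0) : y = 0 := by
  have hβ := h.coupledCocycle_isOrthogonalCocycle
  set P := K₀.starProjection
  let Y : Submodule ℂ K :=
    { carrier := {y | (∀ k ∈ K₀ᗮ, k ∈ (IsOrthogonalCocycle.space b)ᗮ → ⟪k, y⟫_ℂ = 0) ∧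
        ∀ s, ⟪coupledCocycle T b g s, y⟫_ℂ = 0}
      zero_mem' := ⟨fun k _ _ => inner_zero_right _, fun s => inner_zero_right _⟩
      add_mem' := fun {x y} hx hy => ⟨fun k h1 h2 => by
        rw [inner_add_right, hx.1 k h1 h2, hy.1 k h1 h2, add_zero], fun s => by
        rw [inner_add_right, hx.2, hy.2, add_zero]⟩
      smul_mem' := fun c x hx => ⟨fun k h1 h2 => by
        rw [inner_smul_right, hx.1 k h1 h2, mul_zero], fun s => by
        rw [inner_smul_right, hx.2, mul_zero]⟩ }
  have hYclosed : IsClosed (Y : Set K) := by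
    have : (Y : Set K) = (⋂ k ∈ {k | k ∈ K₀ᗮ ∧ k ∈ (IsOrthogonalCocycle.space b)ᗮ},
        {y | ⟪k, y⟫_ℂ = 0}) ∩ ⋂ s, {y | ⟪coupledCocycle T b g s, y⟫_ℂ = 0} := by
      ext y
      simp [Y]
    rw [this]
    refine IsClosed.inter (isClosed_biInter fun k _ => ?_) (isClosed_iInter fun s => ?_) <;>
    exact isClosed_eq (continuous_const.inner continuous_id) continuous_const
  have hTY : ∀ t, ∀ w ∈ Y, T t w ∈ Y := by
    intro t w hw
    refine ⟨fun k h1 h2 => h.map_mem_sup t h1 h2 hw.1, fun s => ?_⟩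
    rcases le_total s t with hst | hst
    · exact hβ.inner_map_of_le h.coupled.toIsC0Semigroup hst w
    · obtain ⟨r, rfl⟩ := exists_add_of_le hst
      rw [hβ.map_add, inner_add_left, hβ.inner_map, zero_add, h.inner_coupled, hw.2]
  have hTk : ∀ t, ∀ k ∈ K₀ᗮ, k ∈ (IsOrthogonalCocycle.space b)ᗮ →
      V t k ∈ (IsOrthogonalCocycle.space b)ᗮ := by
    intro t k _ hk
    rw [Submodule.mem_orthogonal] at hk ⊢
    intro u hu
    rw [← ContinuousLinearMap.adjoint_inner_left]
    exact hk _ (h.cocycle.adjoint_mem_space h.isometric t hu)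
  have hTaY : ∀ t, ∀ w ∈ Y, ContinuousLinearMap.adjoint (T t) w ∈ Y := by
    intro t w hw
    refine ⟨fun k h1 h2 => ?_, fun s => ?_⟩
    · rw [ContinuousLinearMap.adjoint_inner_right, h.apply_orthogonal t k h1]
      exact hw.1 _ (h.wold.map_orthogonal t h1) (hTk t k h1 h2)
    · rw [ContinuousLinearMap.adjoint_inner_right, ← sub_eq_iff_eq_add'.2 (hβ.map_add t s),
        inner_sub_left, hw.2, hw.2, sub_zero]
  obtain ⟨t, ht0, ht⟩ := h.exists_pos_forall_eq_zero
  -- The defect `w - T t (T t)* w` stays in `Y` and is orthogonal to the range of `T t`, so it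
  -- vanishes for the small `t` just chosen.
  have hunit : ∀ w ∈ Y, T t (ContinuousLinearMap.adjoint (T t) w) = w := by
    intro w hw
    have hmem : w - T t (ContinuousLinearMap.adjoint (T t) w) ∈ Y :=
      Submodule.sub_mem _ hw (hTY t _ (hTaY t w hw))
    refine (sub_eq_zero.1 (ht _ hmem.1 (fun u => ?_) fun s _ => hmem.2 s)).symm
    rw [← ContinuousLinearMap.adjoint_inner_right, map_sub,
      adjoint_apply_of_isometric (h.coupled.norm_map t), sub_self, inner_zero_right]
  have hiter : ∀ (n : ℕ), ∀ w ∈ Y, ∃ v, T (n * t) v = w := by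
    intro n
    induction n with
    | zero => exact fun w _ => ⟨w, by simp [h.coupled.map_zero]⟩
    | succ n ih =>
      intro w hw
      obtain ⟨v, hv⟩ := ih _ (hTaY t w hw)
      refine ⟨v, ?_⟩
      push_cast
      rw [add_mul, one_mul, add_comm, h.coupled.map_add, ContinuousLinearMap.comp_apply, hv,
        hunit w hw]
  -- Write `w = T (n t) v` with `‖v‖ = ‖w‖`. Then `⟪x, w⟫ = ⟪(E (n t))* x, v⟫` tends to `0`; this is
  -- where stability of the adjoint flow enters.
  have hY0 : Y ≤ K₀ᗮ := by
    intro w hw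
    rw [Submodule.mem_orthogonal]
    intro x hx
    have hb : ∀ n : ℕ, ‖⟪x, w⟫_ℂ‖ ≤
        ‖ContinuousLinearMap.adjoint (E ((n * t : ℝ≥0) : ℝ)) x‖ * ‖w‖ := by
      intro n
      obtain ⟨v, rfl⟩ := hiter n w hw
      rw [h.inner_map_of_mem _ hx, h.coupled.norm_map, ← ContinuousLinearMap.adjoint_inner_left]
      exact norm_inner_le_norm _ _
    have hto : Filter.Tendsto (fun n : ℕ => ((n * t : ℝ≥0) : ℝ)) Filter.atTop Filter.atTop := by
      push_cast
      exact tendsto_natCast_atTop_atTop.atTop_mul_const (by exact_mod_cast ht0)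
    have hlim := (((h.flow.stable x).comp hto).norm).mul_const ‖w‖
    rw [norm_zero, zero_mul] at hlim
    exact norm_le_zero_iff.1 (ge_of_tendsto' hlim hb)
  have hTV : ∀ w ∈ Y, T t w = V t w := fun w hw => h.apply_orthogonal t w (hY0 hw)
  -- On `Y`, now inside `K₀ᗮ`, `T t` is `V t`. So `Y` reduces `V t` to a unitary, contrary to
  -- complete nonunitarity unless `Y = 0`.
  have hbot : Y = ⊥ := by
    refine h.wold.completelyNonunitary t ht0 Y hY0 ⟨hYclosed, fun w hw => ?_, fun w hw => ?_,
      fun w _ => h.isometric.norm_map t w, fun w hw => ?_⟩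
    · rw [← hTV w hw]
      exact hTY t w hw
    · have e : w = V t (ContinuousLinearMap.adjoint (T t) w) := by
        rw [← hTV _ (hTaY t w hw), hunit w hw]
      rw [e, adjoint_apply_of_isometric (h.isometric.norm_map t)]
      exact hTaY t w hw
    · exact ⟨_, hTaY t w hw, by rw [← hTV _ (hTaY t w hw), hunit w hw]⟩
  have : y ∈ Y := ⟨hyk, hyb⟩
  rw [hbot] at this
  exact this

/-- The cocycles of `V` and `T` have the same Gram matrix, which yields an isometry on the span of
`b`. Its range is orthogonal to the trivial part, and `eq_zero_of_orthogonal` says that the two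
together are dense, whence `Ω Ω* = 1`. -/
theorem exists_isIntertwiner : ∃ Ω : K →L[ℂ] K, IsIntertwiner K₀ V b g T Ω := by
  have hβ := h.coupledCocycle_isOrthogonalCocycle
  set Z := IsOrthogonalCocycle.space b with hZ
  have : CompleteSpace Z := IsOrthogonalCocycle.isClosed_space.completeSpace_coe
  set P := K₀.starProjection with hP
  set Q := Z.starProjection with hQ
  let v : ℝ≥0 → Z := fun t => ⟨b t, IsOrthogonalCocycle.mem_space t⟩
  have hv : (Submodule.span ℂ (Set.range v)).topologicalClosure = ⊤ := by
    rw [Submodule.topologicalClosure_eq_top_iff, eq_bot_iff]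
    intro z hz
    rw [Submodule.mem_orthogonal] at hz
    have : (z : K) = 0 := IsOrthogonalCocycle.eq_of_inner_eq z.2 (Submodule.zero_mem _) fun s => by
      rw [inner_zero_right]
      exact hz (v s) (Submodule.subset_span ⟨s, rfl⟩)
    exact Subtype.ext this
  obtain ⟨I, hI⟩ := exists_linearIsometry_of_gram (w := coupledCocycle T b g) hv fun s t => by
    rw [hβ.inner_eq_min, ← h.cocycle.inner_eq_min]
    rfl
  -- Along `K₀ ⊕ Z ⊕ (K₀ᗮ ∩ Zᗮ)` the operator is `0`, `I` and the identity.
  let Ω : K →L[ℂ] K := I.toContinuousLinearMap ∘L Z.orthogonalProjectionOnto + (1 - P - Q)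
  have hΩ : ∀ y, Ω y = I (Z.orthogonalProjectionOnto y) + (y - P y - Q y) := fun y => rfl
  have hPz : ∀ z ∈ Z, P z = 0 := fun z hz => starProjection_eq_zero_iff.2 (h.space_le hz)
  have hΩz : ∀ z : Z, Ω z = I z := by
    intro z
    rw [hΩ, hPz _ z.2, Submodule.orthogonalProjectionOnto_mem_subspace_eq_self,
      Submodule.starProjection_eq_self_iff.2 z.2]
    simp
  have hΩk : ∀ k ∈ K₀ᗮ, k ∈ Zᗮ → Ω k = k := by
    intro k h0 h1
    have h2 : Z.orthogonalProjectionOnto k = 0 := Subtype.ext (starProjection_eq_zero_iff.2 h1)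
    rw [hΩ, h2, hP, starProjection_eq_zero_iff.2 h0, hQ, starProjection_eq_zero_iff.2 h1]
    simp
  have hΩ0 : ∀ x ∈ K₀, Ω x = 0 := by
    intro x hx
    have h1 : x ∈ Zᗮ := by
      rw [Submodule.mem_orthogonal']
      intro u hu
      exact Submodule.inner_right_of_mem_orthogonal hx (h.space_le hu)
    have h2 : Z.orthogonalProjectionOnto x = 0 := Subtype.ext (starProjection_eq_zero_iff.2 h1)
    rw [hΩ, h2, hP, Submodule.starProjection_eq_self_iff.2 hx, hQ,
      starProjection_eq_zero_iff.2 h1]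
    simp
  have hΩb : ∀ t, Ω (b t) = coupledCocycle T b g t := fun t => by
    have := hΩz (v t)
    rw [hI] at this
    exact this
  -- the coupled cocycle is orthogonal to the trivial part
  have hβk : ∀ k ∈ K₀ᗮ, k ∈ Zᗮ → ∀ s, ⟪k, coupledCocycle T b g s⟫_ℂ = 0 := by
    intro k h0 h1 s
    have hg : ∀ r : ℝ, ⟪k, T r.toNNReal g⟫_ℂ = 0 := fun r =>
      h.map_mem_sup _ h0 h1 fun k hk _ => Submodule.inner_left_of_mem_orthogonal h.g_mem hk
    rw [coupledCocycle, inner_sub_right, inner_intervalIntegral_right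
      (h.coupled.continuous_toNNReal g), Submodule.inner_left_of_mem_orthogonal
      (IsOrthogonalCocycle.mem_space s) h1]
    simp [hg]
  have hIz : ∀ L : Submodule ℂ K, IsClosed (L : Set K) → (∀ s, coupledCocycle T b g s ∈ L) →
      ∀ z, I z ∈ L := by
    intro L hL hs z
    have hle : (Submodule.span ℂ (Set.range v)).topologicalClosure ≤ L.comap I.toLinearMap := by
      refine Submodule.topologicalClosure_minimal _ (Submodule.span_le.2 ?_)
        (hL.preimage I.continuous)
      rintro _ ⟨s, rfl⟩
      change I _ ∈ L
      rw [hI]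
      exact hs s
    rw [hv] at hle
    exact hle (Submodule.mem_top (x := z))
  have hrest0 : ∀ y, y - P y - Q y ∈ K₀ᗮ := fun y =>
    Submodule.sub_mem _ (Submodule.sub_starProjection_mem_orthogonal y)
      (h.space_le (Submodule.starProjection_apply_mem _ _))
  have hrest1 : ∀ y, y - P y - Q y ∈ Zᗮ := by
    intro y
    rw [sub_right_comm]
    refine Submodule.sub_mem _ (Submodule.sub_starProjection_mem_orthogonal y) ?_
    rw [Submodule.mem_orthogonal']
    intro u hu
    exact Submodule.inner_right_of_mem_orthogonal (Submodule.starProjection_apply_mem _ _)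
      (h.space_le hu)
  have hinner : ∀ x y, ⟪Ω x, Ω y⟫_ℂ = ⟪x - P x, y - P y⟫_ℂ := by
    intro x y
    have hcross : ∀ (z : Z) k, k ∈ K₀ᗮ → k ∈ Zᗮ → ⟪I z, k⟫_ℂ = 0 := by
      intro z k h0 h1
      have := hIz (ℂ ∙ k)ᗮ (Submodule.isClosed_orthogonal _) (fun s => by
        rw [Submodule.mem_orthogonal_singleton_iff_inner_right]
        exact hβk k h0 h1 s) z
      rwa [Submodule.mem_orthogonal_singleton_iff_inner_left] at this
    have hcross' : ∀ (z : Z) k, k ∈ K₀ᗮ → k ∈ Zᗮ → ⟪k, I z⟫_ℂ = 0 := fun z k h0 h1 => by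
      rw [← inner_conj_symm, hcross z k h0 h1, map_zero]
    have e : ∀ y, y - P y = Q y + (y - P y - Q y) := fun y => by abel
    rw [hΩ, hΩ, inner_add_left, inner_add_right, inner_add_right, I.inner_map_map,
      hcross _ _ (hrest0 y) (hrest1 y), hcross' _ _ (hrest0 x) (hrest1 x), e x, e y]
    rw [inner_add_left, inner_add_right, inner_add_right (x - P x - Q x),
      Submodule.inner_right_of_mem_orthogonal (Submodule.starProjection_apply_mem _ _) (hrest1 y),
      Submodule.inner_left_of_mem_orthogonal (Submodule.starProjection_apply_mem _ _) (hrest1 x),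
      add_sub_cancel_left, add_sub_cancel_left]
    rfl
  have hadj : ∀ y, ContinuousLinearMap.adjoint Ω (Ω y) = y - P y := by
    intro y
    refine ext_inner_left ℂ fun x => ?_
    rw [ContinuousLinearMap.adjoint_inner_right, hinner, inner_sub_left,
      Submodule.inner_right_of_mem_orthogonal (Submodule.starProjection_apply_mem _ _)
      (Submodule.sub_starProjection_mem_orthogonal y), sub_zero]
  have hker : ∀ y, ContinuousLinearMap.adjoint Ω y = 0 → y = 0 := by
    intro y hy
    refine h.eq_zero_of_orthogonal (fun k h0 h1 => ?_) fun s => ?_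
    · rw [← hΩk k h0 h1, ← ContinuousLinearMap.adjoint_inner_right, hy, inner_zero_right]
    · rw [← hΩb, ← ContinuousLinearMap.adjoint_inner_right, hy, inner_zero_right]
  refine ⟨Ω, fun y => ?_, hadj, fun t y => ?_, hΩb, hΩk⟩
  · refine sub_eq_zero.1 (hker _ ?_)
    rw [map_sub, hadj, sub_sub_cancel_left, neg_eq_zero, hP, starProjection_eq_zero_iff,
      Submodule.mem_orthogonal]
    intro x hx
    rw [ContinuousLinearMap.adjoint_inner_right, hΩ0 x hx, inner_zero_left]
  · have := h.sup_eq_top (L := LinearMap.eqLocus ((Ω ∘L V t) : K →ₗ[ℂ] K) ((T t ∘L Ω) : K →ₗ[ℂ] K))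
      (fun x hx => ?_) ?_ (fun k h0 h1 => ?_) y
    · exact this
    · change Ω (V t x) = T t (Ω x)
      rw [hΩ0 x hx, hΩ0 _ ((h.wold.unitary t).map_mem x hx), map_zero]
    · refine IsOrthogonalCocycle.space_le ?_ fun s => ?_
      · exact isClosed_eq (Ω ∘L V t).continuous (T t ∘L Ω).continuous
      · change Ω (V t (b s)) = T t (Ω (b s))
        rw [← sub_eq_iff_eq_add'.2 (h.cocycle.map_add t s), map_sub, hΩb, hΩb, hΩb, hβ.map_add,
          add_sub_cancel_left]
    · change Ω (V t k) = T t (Ω k)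
      rw [hΩk k h0 h1, h.apply_orthogonal t k h0]
      refine hΩk _ (h.wold.map_orthogonal t h0) ?_
      rw [Submodule.mem_orthogonal] at h1 ⊢
      intro u hu
      rw [← ContinuousLinearMap.adjoint_inner_left]
      exact h1 _ (h.cocycle.adjoint_mem_space h.isometric t hu)

/-- If the flow is a Hilbert–Schmidt perturbation of the unitary part of `V`, then the coupled
semigroup is a Hilbert–Schmidt perturbation of `V`. -/
theorem hasFiniteHSNorm_sub {t : ℝ≥0}
    (ht : HasFiniteHSNorm (E t - V t ∘L K₀.starProjection)) : HasFiniteHSNorm (T t - V t) := by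
  have hJ : HasFiniteHSNorm (T t ∘L K₀.starProjection - E t) := by
    have hc : Continuous fun r : ℝ => ContinuousLinearMap.adjoint (E (t - r)) g := by
      have := h.flow.continuous
      have h2 : Continuous fun r : ℝ => ContinuousLinearMap.adjoint (E (t - r)) := by
        exact ContinuousLinearMap.adjoint.continuous.comp (by fun_prop)
      fun_prop
    -- The square norm of the emitted part is `∫ |⟪g, E (t - r) x⟫|² dr`, so it has the Carleman
    -- kernel `r ↦ (E (t - r))* g`.
    refine hasFiniteHSNorm_of_le_integral t.coe_nonneg hc fun x => ?_
    obtain ⟨z, hz, hT⟩ := h.exists_isIntegral t x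
    rw [sub_apply, ContinuousLinearMap.comp_apply, hT, add_sub_cancel_left,
      hz.norm_sq h.cocycle h.isometric (h.flow.continuous_kernel t x)]
    refine le_of_eq (intervalIntegral.integral_congr fun r _ => ?_)
    rw [ContinuousLinearMap.adjoint_inner_right, ← inner_conj_symm, RCLike.norm_conj]
  have e : T t - V t = (T t ∘L K₀.starProjection - E t) + (E t - V t ∘L K₀.starProjection) := by
    ext x
    have := h.apply_orthogonal t _ (Submodule.sub_starProjection_mem_orthogonal (K := K₀) x)
    rw [map_sub, map_sub] at this
    simp only [sub_apply, add_apply, ContinuousLinearMap.comp_apply]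
    rw [sub_eq_sub_iff_add_eq_add] at this
    rw [sub_add_sub_cancel, sub_eq_sub_iff_add_eq_add, this, add_comm]
  rw [e]
  exact hJ.add ht

/-- Only the vectors of the shift space orthogonal to the range of `V t` matter. There `(Ω - 1) b s
= -∫ T r g dr`, so the adjoint sends `y` to the stochastic integral of `-⟪T r g, y⟫`, whose norm is
that of a Carleman operator. -/
theorem hasFiniteHSNorm_intertwiner {Ω : K →L[ℂ] K} (hΩ : IsIntertwiner K₀ V b g T Ω) (t : ℝ≥0) :
    HasFiniteHSNorm ((Ω - 1) ∘L (1 - V t ∘L ContinuousLinearMap.adjoint (V t))) := by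
  set R : K →L[ℂ] K := 1 - V t ∘L ContinuousLinearMap.adjoint (V t) with hR
  have hRa : ∀ y, R y = y - V t (ContinuousLinearMap.adjoint (V t) y) := fun y => rfl
  set A := (Ω - 1) ∘L R with hA
  have hAa : ∀ y, A y = Ω (R y) - R y := fun y => rfl
  have hc := h.coupled.continuous_toNNReal g
  have hRV : ∀ w, R (V t w) = 0 := fun w => by
    rw [hRa, adjoint_apply_of_isometric (h.isometric.norm_map t), sub_self]
  suffices HasFiniteHSNorm (ContinuousLinearMap.adjoint A) by
    simpa using this.adjoint
  refine hasFiniteHSNorm_of_le_integral t.coe_nonneg hc fun y => ?_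
  have hA0 : ∀ w ∈ (IsOrthogonalCocycle.space b)ᗮ, A w = 0 := by
    intro w hw
    set P := K₀.starProjection
    have hPw : A (P w) = 0 := by
      obtain ⟨u, -, hu⟩ := (h.wold.unitary t).surj (P w) (Submodule.starProjection_apply_mem _ _)
      rw [← hu, hAa, hRV, map_zero, sub_zero]
    have hPs : P w ∈ (IsOrthogonalCocycle.space b)ᗮ := by
      rw [Submodule.mem_orthogonal']
      intro u hu
      exact Submodule.inner_right_of_mem_orthogonal (Submodule.starProjection_apply_mem _ _)
        (h.space_le hu)
    have hk : A (w - P w) = 0 := by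
      have h0 : w - P w ∈ K₀ᗮ := Submodule.sub_starProjection_mem_orthogonal w
      have h1 : w - P w ∈ (IsOrthogonalCocycle.space b)ᗮ := Submodule.sub_mem _ hw hPs
      rw [hAa, hΩ.map_self, sub_self]
      · exact Submodule.sub_mem _ h0 (h.wold.map_orthogonal t (h.wold.adjoint_orthogonal t h0))
      · refine Submodule.sub_mem _ h1 ?_
        rw [Submodule.mem_orthogonal] at h1 ⊢
        intro u hu
        change ⟪u, V t (ContinuousLinearMap.adjoint (V t) _)⟫_ℂ = 0
        rw [← ContinuousLinearMap.adjoint_inner_left, ContinuousLinearMap.adjoint_inner_right]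
        exact h1 _ (h.cocycle.map_mem_space t (h.cocycle.adjoint_mem_space h.isometric t hu))
    rw [← add_sub_cancel (P w) w, map_add, hPw, hk, add_zero]
  have hmem : ContinuousLinearMap.adjoint A y ∈ IsOrthogonalCocycle.space b := by
    have : CompleteSpace (IsOrthogonalCocycle.space b) :=
      IsOrthogonalCocycle.isClosed_space.completeSpace_coe
    rw [← Submodule.orthogonal_orthogonal (IsOrthogonalCocycle.space b), Submodule.mem_orthogonal]
    intro w hw
    rw [ContinuousLinearMap.adjoint_inner_right, hA0 w hw, inner_zero_left]
  have hφ : Continuous fun r : ℝ => -⟪T r.toNNReal g, y⟫_ℂ := (hc.inner continuous_const).neg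
  have hint : IsOrthogonalCocycle.IsIntegral b t (fun r => -⟪T r.toNNReal g, y⟫_ℂ)
      (ContinuousLinearMap.adjoint A y) := by
    refine IsOrthogonalCocycle.isIntegral_of_orthogonal h.cocycle hmem (fun w => ?_) fun s hs => ?_
    · rw [ContinuousLinearMap.adjoint_inner_right, hAa, hRV, map_zero, sub_zero, inner_zero_left]
    · have hRb : R (b s) = b s := by
        have : ContinuousLinearMap.adjoint (V t) (b s) = 0 := ext_inner_right ℂ fun w => by
          rw [ContinuousLinearMap.adjoint_inner_left,
            h.cocycle.inner_map_of_le h.isometric.toIsC0Semigroup hs, inner_zero_left]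
        rw [hRa, this, map_zero, sub_zero]
      rw [ContinuousLinearMap.adjoint_inner_right, hAa, hRb, hΩ.map_cocycle, coupledCocycle,
        sub_sub_cancel_left, inner_neg_left, inner_intervalIntegral_left hc,
        intervalIntegral.integral_neg]
  rw [hint.norm_sq h.cocycle h.isometric hφ]
  refine le_of_eq (intervalIntegral.integral_congr fun r _ => ?_)
  rw [norm_neg, ← inner_conj_symm, RCLike.norm_conj]

end IsCoupling

/-- A dissipative flow which is a Hilbert–Schmidt perturbation of the unitary part of `V` gives rise
to a coisometry with kernel `K₀` which almost commutes with `V`. -/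
theorem exists_almost_commuting_coisometry (hW : IsWoldDecomposition V K₀) (hV : IsC0Isometric V)
    (hb : IsOrthogonalCocycle V b) (hE : IsDissipativeFlow K₀.starProjection E g)
    (hHS : ∀ t : ℝ≥0, HasFiniteHSNorm (E t - V t ∘L K₀.starProjection)) :
    ∃ Ω : K →L[ℂ] K, (∀ y, Ω (ContinuousLinearMap.adjoint Ω y) = y) ∧
      (∀ y, ContinuousLinearMap.adjoint Ω (Ω y) = y - K₀.starProjection y) ∧
      (∀ t, HasFiniteHSNorm (Ω ∘L V t - V t ∘L Ω)) ∧
      ∀ t, HasFiniteHSNorm ((Ω - 1) ∘L (1 - V t ∘L ContinuousLinearMap.adjoint (V t))) := by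
  obtain ⟨T, hT, hTo, hTi⟩ := hE.exists_coupling hW hV hb
  have h : IsCoupling K₀ V b E g T := ⟨hW, hV, hb, hE, hT, hTo, hTi⟩
  obtain ⟨Ω, hΩ⟩ := h.exists_isIntertwiner
  refine ⟨Ω, hΩ.apply_adjoint, hΩ.adjoint_apply, fun t => ?_,
    h.hasFiniteHSNorm_intertwiner hΩ⟩
  have : Ω ∘L V t - V t ∘L Ω = (T t - V t) ∘L Ω := by
    ext y
    simp [hΩ.map_semigroup]
  rw [this]
  exact (h.hasFiniteHSNorm_sub (hHS t)).comp_right Ω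

end Intertwiner

/-! ### Norm continuous semigroups -/

section NormContinuous

open NormedSpace

/-- A norm continuous semigroup in a Banach algebra is an exponential. -/
theorem exists_eq_exp_of_continuous {A : Type*} [NormedRing A] [NormedAlgebra ℝ A]
    [CompleteSpace A] {U : ℝ≥0 → A} (h0 : U 0 = 1) (hadd : ∀ s t, U (s + t) = U s * U t)
    (hc : Continuous U) : ∃ a : A, ∀ t : ℝ≥0, U t = exp ((t : ℝ) • a) := by
  set u : ℝ → A := fun r => U r.toNNReal with hu
  have huc : Continuous u := hc.comp continuous_real_toNNReal
  have hu0 : u 0 = 1 := by simp [hu, h0]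
  have huadd : ∀ s t, 0 ≤ s → 0 ≤ t → u (s + t) = u s * u t := fun s t hs ht => by
    simp only [hu]
    rw [Real.toNNReal_add hs ht, hadd]
  set F : ℝ → A := fun d => ∫ s in (0 : ℝ)..d, u s with hF
  have hFd : ∀ d, HasDerivAt F (u d) d := fun d =>
    intervalIntegral.integral_hasDerivAt_right (huc.intervalIntegrable _ _)
      (huc.stronglyMeasurableAtFilter _ _) huc.continuousAt
  -- `F δ / δ` tends to `1` and units form an open set. Then `u t = (F (t + δ) - F t) (F δ)⁻¹` shows
  -- that `u` is differentiable, which motivates `a` and `w`.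
  obtain ⟨δ, hδ, X, hX⟩ : ∃ δ : ℝ, 0 < δ ∧ ∃ X : Aˣ, F δ = X := by
    have h1 := (hasDerivAt_iff_tendsto_slope_zero.1 (hFd 0)).mono_left
      (nhdsWithin_mono (0 : ℝ) (fun x (hx : x ∈ Set.Ioi (0 : ℝ)) => ne_of_gt hx))
    rw [hu0] at h1
    have h2 := h1.eventually ((Units.isOpen (R := A)).mem_nhds (x := 1) isUnit_one)
    obtain ⟨δ, ⟨X, hX⟩, hδ⟩ := (h2.and self_mem_nhdsWithin).exists
    have hδ : (0 : ℝ) < δ := hδ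
    have hF0 : F 0 = 0 := by simp [hF]
    rw [zero_add, hF0, sub_zero] at hX
    refine ⟨δ, hδ, X * ⟨δ • 1, δ⁻¹ • 1, ?_, ?_⟩, ?_⟩
    · rw [Units.val_mul, hX]
      simp [smul_smul, hδ.ne']
    · simp [smul_smul, hδ.ne']
    · simp [smul_smul, hδ.ne']
  set a : A := (u δ - 1) * ↑X⁻¹ with ha
  set w : ℝ → A := fun t => (F (t + δ) - F t) * ↑X⁻¹ with hw
  have hwu : ∀ t, 0 ≤ t → w t = u t := by
    intro t ht
    have h1 : F (t + δ) - F t = u t * F δ := by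
      simp only [hF]
      rw [intervalIntegral.integral_interval_sub_left (huc.intervalIntegrable _ _)
        (huc.intervalIntegrable _ _)]
      have h2 : ∫ s in (0 : ℝ)..δ, u t * u s = u t * ∫ s in (0 : ℝ)..δ, u s :=
        (ContinuousLinearMap.mul ℝ A (u t)).intervalIntegral_comp_comm
          (huc.intervalIntegrable _ _)
      rw [← h2]
      have h3 : ∫ s in (0 : ℝ)..δ, u t * u s = ∫ s in (0 : ℝ)..δ, u (t + s) :=
        intervalIntegral.integral_congr fun s hs => by
          rw [Set.uIcc_of_le hδ.le] at hs
          exact (huadd t s ht hs.1).symm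
      rw [h3, intervalIntegral.integral_comp_add_left, add_zero]
    simp only [hw]
    rw [h1, hX, mul_assoc, Units.mul_inv, mul_one]
  have hwd : ∀ t, HasDerivAt w ((u (t + δ) - u t) * ↑X⁻¹) t := fun t =>
    (((hFd (t + δ)).comp_add_const t δ).sub (hFd t)).mul_const _
  have hwd' : ∀ t, 0 ≤ t → HasDerivAt w (w t * a) t := by
    intro t ht
    have h := hwd t
    rwa [huadd t δ ht hδ.le, ← mul_sub_one, mul_assoc, ← ha, ← hwu t ht] at h
  refine ⟨a, fun t => ?_⟩
  have hp : ∀ s ∈ Set.Icc (0 : ℝ) t, w s * exp (s • -a) = w 0 * exp ((0 : ℝ) • -a) := by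
    have hd : ∀ s, 0 ≤ s → HasDerivAt (fun s => w s * exp (s • -a)) 0 s := by
      intro s hs
      have := (hwd' s hs).mul (hasDerivAt_exp_smul_const' (𝕂 := ℝ) (-a) s)
      refine this.congr_deriv ?_
      rw [← mul_assoc (w s) (-a), mul_neg, neg_mul, add_neg_cancel]
    exact constant_of_has_deriv_right_zero
      (fun s hs => (hd s hs.1).continuousAt.continuousWithinAt)
      fun s hs => (hd s hs.1).hasDerivWithinAt
  have h1 := hp t ⟨t.coe_nonneg, le_rfl⟩
  rw [hwu t t.coe_nonneg, hwu 0 le_rfl, hu0, zero_smul, exp_zero, mul_one] at h1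
  have h2 : exp ((t : ℝ) • -a) * exp ((t : ℝ) • a) = 1 := by
    have : NormedAlgebra ℚ A := NormedAlgebra.restrictScalars ℚ ℝ A
    rw [← exp_add_of_commute ((Commute.refl a).neg_left.smul_left _ |>.smul_right _)]
    simp
  calc U t = u t := by simp [hu]
    _ = u t * (exp ((t : ℝ) • -a) * exp ((t : ℝ) • a)) := by rw [h2, mul_one]
    _ = _ := by rw [← mul_assoc, h1, one_mul]

variable {H : Type*} [NormedAddCommGroup H] [InnerProductSpace ℂ H] [CompleteSpace H]

theorem exp_add_smul (G : H →L[ℂ] H) (s t : ℝ) :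
    exp ((s + t) • G) = exp (s • G) ∘L exp (t • G) := by
  have : NormedAlgebra ℚ (H →L[ℂ] H) := NormedAlgebra.restrictScalars ℚ ℝ _
  rw [add_smul]
  exact exp_add_of_commute (((Commute.refl G).smul_left _).smul_right _)

theorem hasDerivAt_exp_smul_apply (G : H →L[ℂ] H) (x : H) (t : ℝ) :
    HasDerivAt (fun t : ℝ => exp (t • G) x) (G (exp (t • G) x)) t := by
  have h := hasDerivAt_exp_smul_const' (𝕂 := ℝ) G t
  exact ((ContinuousLinearMap.apply ℂ H x).restrictScalars ℝ).hasFDerivAt.comp_hasDerivAt t h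

theorem continuous_exp_smul (G : H →L[ℂ] H) : Continuous fun t : ℝ => exp (t • G) :=
  continuous_iff_continuousAt.2 fun t => (hasDerivAt_exp_smul_const' (𝕂 := ℝ) G t).continuousAt

/-- The energy identity of the semigroup `exp (t G)`, where `G + G* = -|g⟩⟨g|`. -/
theorem energy_exp_smul {G : H →L[ℂ] H} {g : H}
    (hG : ∀ x, 2 * RCLike.re ⟪x, G x⟫_ℂ = -‖⟪g, x⟫_ℂ‖ ^ 2) (t : ℝ) (x : H) :
    ‖exp (t • G) x‖ ^ 2 + ∫ s in (0 : ℝ)..t, ‖⟪g, exp (s • G) x⟫_ℂ‖ ^ 2 = ‖x‖ ^ 2 := by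
  have hc : Continuous fun s : ℝ => exp (s • G) x :=
    (continuous_exp_smul G).clm_apply continuous_const
  have hd : ∀ s : ℝ, HasDerivAt (fun s : ℝ => ‖exp (s • G) x‖ ^ 2)
      (-‖⟪g, exp (s • G) x⟫_ℂ‖ ^ 2) s := by
    intro s
    have h := hasDerivAt_exp_smul_apply G x s
    have h2 := (h.inner ℂ h)
    have h3 := RCLike.reCLM (K := ℂ) |>.hasFDerivAt.comp_hasDerivAt s h2
    refine (h3.congr_deriv ?_).congr_of_eventuallyEq (Filter.Eventually.of_forall fun r => ?_)
    · rw [← hG, map_add]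
      change RCLike.re ⟪_, _⟫_ℂ + RCLike.re ⟪_, _⟫_ℂ = _
      rw [inner_re_symm (𝕜 := ℂ) (G _)]
      ring
    · exact (inner_self_eq_norm_sq (𝕜 := ℂ) _).symm
  have h := intervalIntegral.integral_eq_sub_of_hasDerivAt (a := 0) (b := t) (fun s _ => hd s)
    (Continuous.intervalIntegrable (by fun_prop) _ _)
  rw [intervalIntegral.integral_neg] at h
  simp only [zero_smul, exp_zero] at h
  change _ = _ - ‖x‖ ^ 2 at h
  linarith

theorem norm_exp_smul_le {G : H →L[ℂ] H} {g : H}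
    (hG : ∀ x, 2 * RCLike.re ⟪x, G x⟫_ℂ = -‖⟪g, x⟫_ℂ‖ ^ 2) {t : ℝ} (ht : 0 ≤ t) (x : H) :
    ‖exp (t • G) x‖ ≤ ‖x‖ := by
  have h := energy_exp_smul hG t x
  have : 0 ≤ ∫ s in (0 : ℝ)..t, ‖⟪g, exp (s • G) x⟫_ℂ‖ ^ 2 :=
    intervalIntegral.integral_nonneg ht fun _ _ => by positivity
  exact le_of_sq_le_sq (by linarith) (norm_nonneg _)

theorem norm_exp_smul_of_skew {G : H →L[ℂ] H} (hG : ∀ x, RCLike.re ⟪x, G x⟫_ℂ = 0) (t : ℝ) (x : H) :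
    ‖exp (t • G) x‖ = ‖x‖ := by
  have h := energy_exp_smul (g := 0) (G := G) (fun x => by simp [hG]) t x
  simpa using h

/-- The generator of a norm continuous semigroup of isometries is skew-adjoint. -/
theorem re_inner_eq_zero_of_norm_exp {G : H →L[ℂ] H}
    (h : ∀ (t : ℝ≥0) x, ‖exp ((t : ℝ) • G) x‖ = ‖x‖)
    (x : H) : RCLike.re ⟪x, G x⟫_ℂ = 0 := by
  have h1 := hasDerivAt_exp_smul_apply G x 0
  have h3 := (RCLike.reCLM (K := ℂ) |>.hasFDerivAt.comp_hasDerivAt (0 : ℝ) (h1.inner ℂ h1)).hasDerivWithinAt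
    (s := Set.Ici 0)
  have h4 : HasDerivWithinAt (fun _ : ℝ => ‖x‖ ^ 2) 0 (Set.Ici 0) 0 := hasDerivWithinAt_const _ _ _
  have h5 := h4.congr (f₁ := ⇑(RCLike.reCLM (K := ℂ)) ∘ fun t : ℝ => ⟪exp (t • G) x, exp (t • G) x⟫_ℂ)
    (fun s hs => by
      have := h ⟨s, hs⟩ x
      rw [← this]
      exact inner_self_eq_norm_sq (𝕜 := ℂ) _) (by
      have := h 0 x
      rw [← this]
      exact inner_self_eq_norm_sq (𝕜 := ℂ) _)
  have h6 := (uniqueDiffOn_Ici (0 : ℝ)).uniqueDiffWithinAt (Set.self_mem_Ici) |>.eq_deriv _ h3 h5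
  simp only [zero_smul, exp_zero, map_add] at h6
  change RCLike.re ⟪x, G x⟫_ℂ + RCLike.re ⟪G x, x⟫_ℂ = _ at h6
  rw [inner_re_symm (𝕜 := ℂ) (G _)] at h6
  linarith

/-- Cauchy–Schwarz, from `∫ (t f - m)² ≥ 0`. -/
theorem sq_integral_le {f : ℝ → ℝ} (hf : Continuous f) {t : ℝ} (ht : 0 ≤ t) :
    (∫ s in (0 : ℝ)..t, f s) ^ 2 ≤ t * ∫ s in (0 : ℝ)..t, f s ^ 2 := by
  set m := ∫ s in (0 : ℝ)..t, f s with hm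
  have h : 0 ≤ ∫ s in (0 : ℝ)..t, (t * f s - m) ^ 2 :=
    intervalIntegral.integral_nonneg ht fun _ _ => by positivity
  have h2 : ∫ s in (0 : ℝ)..t, (t * f s - m) ^ 2 =
      ∫ s in (0 : ℝ)..t, (t ^ 2 * f s ^ 2 - 2 * t * m * f s + m ^ 2) := by
    congr 1; ext s; ring
  rw [h2, intervalIntegral.integral_add, intervalIntegral.integral_sub,
    intervalIntegral.integral_const_mul, intervalIntegral.integral_const_mul, ← hm,
    intervalIntegral.integral_const, sub_zero, smul_eq_mul] at h
  · rcases ht.eq_or_lt with rfl | ht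
    · simp [hm]
    · refine le_of_mul_le_mul_left ?_ ht
      nlinarith
  all_goals exact Continuous.intervalIntegrable (by fun_prop) _ _

/-- A Hilbert–Schmidt perturbation of the skew-adjoint generator of a group to the generator of a
contraction semigroup perturbs the semigroup by Hilbert–Schmidt operators. -/
theorem hasFiniteHSNorm_exp_sub_exp {A G : H →L[ℂ] H} (hA : ∀ x, RCLike.re ⟪x, A x⟫_ℂ = 0)
    (hG : ∀ t : ℝ, 0 ≤ t → ∀ x, ‖exp (t • G) x‖ ≤ ‖x‖) (hAG : HasFiniteHSNorm (G - A))
    {t : ℝ} (ht : 0 ≤ t) : HasFiniteHSNorm (exp (t • G) - exp (t • A)) := by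
  let U : ℝ → H →ₗᵢ[ℂ] H := fun s =>
    ⟨(exp (s • A) : H →L[ℂ] H).toLinearMap, norm_exp_smul_of_skew hA s⟩
  have hU : ∀ s x, U s x = exp (s • A) x := fun _ _ => rfl
  have hUc : ∀ x, Continuous fun s => U s x := fun x =>
    (continuous_exp_smul A).clm_apply continuous_const
  refine hasFiniteHSNorm_of_le_integral_comp (U := U) hAG ht ht hUc fun x => ?_
  refine le_trans ?_ (sq_integral_le (((G - A).continuous.comp (hUc x)).norm) ht)
  -- Duhamel's formula: integrating this derivative writes `exp (t G) - exp (t A)` as `∫ exp ((t -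
  -- s) G) (G - A) exp (s A) ds`. Contractivity removes the left factor, and the isometries on the
  -- right do not change Hilbert–Schmidt sums.
  have hd : ∀ s : ℝ, HasDerivAt (fun s : ℝ => exp ((t - s) • G) (U s x))
      (-(exp ((t - s) • G) ((G - A) (U s x)))) s := by
    intro s
    have h1 := (hasDerivAt_exp_smul_const (𝕂 := ℝ) G (t - s)).scomp s
      ((hasDerivAt_id s).const_sub t)
    have h2 := hasDerivAt_exp_smul_const' (𝕂 := ℝ) A s
    have h3 := h1.mul h2
    refine (((ContinuousLinearMap.apply ℂ H x).restrictScalars ℝ).hasFDerivAt.comp_hasDerivAt s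
      h3).congr_deriv ?_
    change ((-1 : ℝ) • (exp ((t - s) • G) * G)) (exp (s • A) x) +
      exp ((t - s) • G) (A (exp (s • A) x)) = _
    rw [hU, sub_apply, map_sub, neg_sub, neg_one_smul]
    change -(exp ((t - s) • G) (G (exp (s • A) x))) + _ = _
    abel
  have hcont : Continuous fun s => exp ((t - s) • G) ((G - A) (U s x)) :=
    ((continuous_exp_smul G).comp (continuous_const.sub continuous_id)).clm_apply
      ((G - A).continuous.comp (hUc x))
  have h := intervalIntegral.integral_eq_sub_of_hasDerivAt (a := 0) (b := t) (fun s _ => hd s)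
    (hcont.neg.intervalIntegrable _ _)
  rw [intervalIntegral.integral_neg] at h
  have h2 : (exp (t • G) - exp (t • A)) x =
      ∫ s in (0 : ℝ)..t, exp ((t - s) • G) ((G - A) (U s x)) := by
    rw [← neg_inj, h, hU, hU]
    simp
  rw [h2]
  gcongr
  refine (intervalIntegral.norm_integral_le_integral_norm ht).trans ?_
  refine intervalIntegral.integral_mono_on ht (hcont.norm.intervalIntegrable _ _)
    ((((G - A).continuous.comp (hUc x)).norm).intervalIntegrable _ _) fun s hs => ?_
  exact hG _ (sub_nonneg.2 hs.2) _

end NormContinuous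

/-! ### The theorem of Weyl and von Neumann -/

section OrthonormalFinset

variable {H : Type*} [NormedAddCommGroup H] [InnerProductSpace ℂ H]

/-- The functional `∑ (‖A e‖² - |⟨e, A e⟩|²) + ‖(1 - P) A P‖²`, where `P` is the projection onto the
span of the orthonormal set `s` and the last norm is the Hilbert–Schmidt norm. -/
noncomputable def offDiagonalEnergy (A : H →L[ℂ] H) (s : Finset H) : ℝ :=
  ∑ e ∈ s, (2 * ‖A e‖ ^ 2 - ‖⟪e, A e⟫_ℂ‖ ^ 2) - ∑ e ∈ s, ∑ e' ∈ s, ‖⟪e', A e⟫_ℂ‖ ^ 2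

theorem le_offDiagonalEnergy (A : H →L[ℂ] H) {s : Finset H}
    (hs : Orthonormal ℂ (fun e : s => (e : H))) :
    ∑ e ∈ s, (‖A e‖ ^ 2 - ‖⟪e, A e⟫_ℂ‖ ^ 2) ≤ offDiagonalEnergy A s := by
  rw [offDiagonalEnergy, ← Finset.sum_sub_distrib]
  refine Finset.sum_le_sum fun e _ => ?_
  linarith [sum_norm_inner_sq_le hs (A e)]

theorem norm_add_sq_of_inner_eq_zero {x y : H} (h : ⟪x, y⟫_ℂ = 0) :
    ‖x + y‖ ^ 2 = ‖x‖ ^ 2 + ‖y‖ ^ 2 := by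
  simpa only [sq] using norm_add_sq_eq_norm_sq_add_norm_sq_of_inner_eq_zero (𝕜 := ℂ) x y h

/-- The distance to the span of an orthonormal set. -/
theorem norm_sq_sub_sum_le {s : Finset H} (hs : Orthonormal ℂ (fun e : s => (e : H))) (y : H) {z : H}
    (hz : z ∈ Submodule.span ℂ (s : Set H)) :
    ‖y‖ ^ 2 - ∑ e ∈ s, ‖⟪e, y⟫_ℂ‖ ^ 2 ≤ ‖y - z‖ ^ 2 := by
  have hz' := Submodule.mem_span_finset.1 hz
  obtain ⟨c, -, rfl⟩ := hz'
  set p := ∑ e : s, ⟪(e : H), y⟫_ℂ • (e : H) with hp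
  have hpe : ∀ e : s, ⟪(e : H), y - p⟫_ℂ = 0 := fun e => by
    rw [inner_sub_right, hp, hs.inner_right_sum _ (Finset.mem_univ e), sub_self]
  have h0 : ∀ d : s → ℂ, ⟪∑ e : s, d e • (e : H), y - p⟫_ℂ = 0 := fun d => by
    rw [sum_inner]
    exact Finset.sum_eq_zero fun e _ => by rw [inner_smul_left, hpe, mul_zero]
  have h1 : ‖p‖ ^ 2 = ∑ e ∈ s, ‖⟪e, y⟫_ℂ‖ ^ 2 := by
    have h : ⟪p, p⟫_ℂ = ((∑ e : s, ‖⟪(e : H), y⟫_ℂ‖ ^ 2 : ℝ) : ℂ) := by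
      rw [hp, hs.inner_sum]
      push_cast
      exact Finset.sum_congr rfl fun e _ => Complex.conj_mul' _
    rw [← Finset.sum_coe_sort, ← inner_self_eq_norm_sq (𝕜 := ℂ), h]
    exact Complex.ofReal_re _
  have h2 : ‖y‖ ^ 2 = ‖p‖ ^ 2 + ‖y - p‖ ^ 2 := by
    rw [← norm_add_sq_of_inner_eq_zero (h0 _), ← hp,
      add_sub_cancel]
  have h3 : ‖y - ∑ e ∈ s, c e • e‖ ^ 2 = ‖p - ∑ e ∈ s, c e • e‖ ^ 2 + ‖y - p‖ ^ 2 := by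
    rw [← norm_add_sq_of_inner_eq_zero]
    · congr 2; abel
    · rw [← Finset.sum_coe_sort, hp, ← Finset.sum_sub_distrib]
      simp_rw [← sub_smul]
      exact h0 _
  nlinarith [sq_nonneg ‖p - ∑ e ∈ s, c e • e‖]

theorem orthonormal_insert [DecidableEq H] {s : Finset H}
    (hs : Orthonormal ℂ (fun e : s => (e : H))) {e : H} (he : ‖e‖ = 1)
    (h : ∀ e' ∈ s, ⟪e', e⟫_ℂ = 0) :
    Orthonormal ℂ (fun x : (insert e s : Finset H) => (x : H)) := by
  have hs' : ∀ x ∈ s, ‖x‖ = 1 := fun x hx => hs.1 ⟨x, hx⟩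
  refine ⟨?_, ?_⟩
  · rintro ⟨x, hx⟩
    rcases Finset.mem_insert.1 hx with rfl | hx
    exacts [he, hs' x hx]
  · rintro ⟨x, hx⟩ ⟨y, hy⟩ hxy
    have hxy' : x ≠ y := fun h => hxy (Subtype.ext h)
    change ⟪x, y⟫_ℂ = 0
    rcases Finset.mem_insert.1 hx with rfl | hx' <;> rcases Finset.mem_insert.1 hy with rfl | hy'
    · exact absurd rfl hxy'
    · rw [← inner_conj_symm, h y hy', map_zero]
    · exact h x hx'
    · exact hs.2 (i := ⟨x, hx'⟩) (j := ⟨y, hy'⟩) fun h => hxy' (congrArg Subtype.val h)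

end OrthonormalFinset

/-! ### Spectral subspaces and diagonalization up to Hilbert–Schmidt operators. -/

section WeylVonNeumann

variable {H : Type*} [NormedAddCommGroup H] [InnerProductSpace ℂ H] [CompleteSpace H]

/-- The spectral subspace of the selfadjoint operator `A` belonging to `(-∞, l]`. -/
noncomputable def spectralSubspace (A : H →L[ℂ] H) (l : ℝ) : Submodule ℂ H :=
  (cfc (fun x : ℝ => max (x - l) 0) A).ker

theorem mem_spectralSubspace {A : H →L[ℂ] H} {l : ℝ} {x : H} :
    x ∈ spectralSubspace A l ↔ cfc (fun x : ℝ => max (x - l) 0) A x = 0 := Iff.rfl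

theorem isClosed_spectralSubspace (A : H →L[ℂ] H) (l : ℝ) :
    IsClosed (spectralSubspace A l : Set H) :=
  (cfc (fun x : ℝ => max (x - l) 0) A).isClosed_ker

instance (A : H →L[ℂ] H) (l : ℝ) : CompleteSpace (spectralSubspace A l) :=
  (isClosed_spectralSubspace A l).completeSpace_coe

/-- For `l < l'` the function `(x - l')⁺` is a continuous multiple of `(x - l)⁺`. -/
theorem spectralSubspace_mono (A : H →L[ℂ] H) {l l' : ℝ} (h : l < l') :
    spectralSubspace A l ≤ spectralSubspace A l' := by
  intro x hx
  rw [mem_spectralSubspace] at hx ⊢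
  have hpos : ∀ x : ℝ, max (x - l) (l' - l) ≠ 0 := fun x =>
    ((sub_pos.2 h).trans_le (le_max_right _ _)).ne'
  have hcont : Continuous fun x : ℝ => max (x - l') 0 / max (x - l) (l' - l) := by
    refine Continuous.div (by fun_prop) (by fun_prop) hpos
  have heq : (fun x : ℝ => max (x - l') 0) =
      fun x : ℝ => (max (x - l') 0 / max (x - l) (l' - l)) * max (x - l) 0 := by
    ext x
    rcases le_total x l' with hx | hx
    · rw [max_eq_right (sub_nonpos.2 hx)]
      simp
    · rw [max_eq_left (sub_nonneg.2 hx), max_eq_left (by linarith : l' - l ≤ x - l),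
        max_eq_left (by linarith : (0 : ℝ) ≤ x - l), div_mul_cancel₀]
      linarith
  rw [heq, cfc_mul _ _ A hcont.continuousOn (by fun_prop)]
  change cfc _ A (cfc _ A x) = 0
  rw [hx, map_zero]

theorem abs_le_norm_of_mem_spectrum {A : H →L[ℂ] H} {x : ℝ} (hx : x ∈ spectrum ℝ A) :
    |x| ≤ ‖A‖ := by
  have h := spectrum.norm_le_norm_mul_of_mem hx
  have h1 : ‖(1 : H →L[ℂ] H)‖ ≤ 1 := ContinuousLinearMap.norm_id_le
  rw [Real.norm_eq_abs] at h
  nlinarith [norm_nonneg A]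

theorem spectralSubspace_eq_top {A : H →L[ℂ] H} {l : ℝ} (h : ‖A‖ ≤ l) :
    spectralSubspace A l = ⊤ := by
  refine Submodule.eq_top_iff'.2 fun x => ?_
  rw [mem_spectralSubspace, cfc_congr (g := fun _ => 0) fun y hy => ?_, cfc_const_zero]
  · rfl
  · exact max_eq_right (by linarith [le_abs_self y, abs_le_norm_of_mem_spectrum hy])

theorem spectralSubspace_eq_bot {A : H →L[ℂ] H} (hA : IsSelfAdjoint A) {l : ℝ} (h : ‖A‖ < -l) :
    spectralSubspace A l = ⊥ := by
  refine (Submodule.eq_bot_iff _).2 fun x hx => ?_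
  rw [mem_spectralSubspace, cfc_congr (g := fun y => y - l) fun y hy => ?_,
    cfc_sub (fun y => y) (fun _ => l) A, cfc_id' ℝ A, cfc_const l A] at hx
  · have h1 : A x = (l : ℂ) • x := sub_eq_zero.1 hx
    have h2 := A.le_opNorm x
    rw [h1, norm_smul, Complex.norm_real, Real.norm_eq_abs] at h2
    by_contra hne
    have := le_of_mul_le_mul_right h2 (norm_pos_iff.2 hne)
    linarith [neg_le_abs l]
  · exact max_eq_left (by linarith [neg_abs_le y, abs_le_norm_of_mem_spectrum hy])

/-- On such vectors `(A - l')⁺` and `(A - l)⁻` vanish, which leaves `A - l` equal to a function of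
`A` with values in `[0, l' - l]`. -/
theorem norm_apply_sub_le_of_mem_spectralSubspace {A : H →L[ℂ] H} (hA : IsSelfAdjoint A) {l l' : ℝ}
    (h : l ≤ l') {x : H} (hx : x ∈ spectralSubspace A l') (hx' : x ∈ (spectralSubspace A l)ᗮ) :
    ‖A x - (l : ℂ) • x‖ ≤ (l' - l) * ‖x‖ := by
  have h1 : cfc (fun y : ℝ => max (l - y) 0) A x = 0 := by
    -- The positive and negative parts of `A - l` have product zero, so the range of the latter lies
    -- in the kernel of the former.
    have hm : ∀ y, cfc (fun y : ℝ => max (l - y) 0) A y ∈ spectralSubspace A l := by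
      intro y
      rw [mem_spectralSubspace]
      change (cfc (fun y : ℝ => max (y - l) 0) A * cfc (fun y : ℝ => max (l - y) 0) A) y = 0
      rw [← cfc_mul (fun y : ℝ => max (y - l) 0) (fun y : ℝ => max (l - y) 0) A,
        cfc_congr (g := fun _ => 0) fun y _ => ?_, cfc_const_zero]
      · rfl
      · rcases le_total y l with hy | hy
        · simp [max_eq_right (sub_nonpos.2 hy)]
        · simp [max_eq_right (sub_nonpos.2 hy)]
    have hsa : IsSelfAdjoint (cfc (fun y : ℝ => max (l - y) 0) A) := cfc_predicate _ _
    refine ext_inner_left ℂ fun y => ?_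
    rw [← hsa.adjoint_eq, ContinuousLinearMap.adjoint_inner_right, inner_zero_right]
    exact Submodule.inner_right_of_mem_orthogonal (hm y) hx'
  have h2 : A - algebraMap ℝ (H →L[ℂ] H) l = cfc (fun y : ℝ => max (y - l) 0 - max (y - l') 0) A +
      cfc (fun y : ℝ => max (y - l') 0) A - cfc (fun y : ℝ => max (l - y) 0) A := by
    rw [← cfc_add .., ← cfc_sub ..]
    conv_lhs => rw [← cfc_id' ℝ A, ← cfc_const l A, ← cfc_sub ..]
    refine cfc_congr fun y _ => ?_
    rcases le_total y l with hy | hy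
    · rw [max_eq_right (sub_nonpos.2 hy), max_eq_left (sub_nonneg.2 hy)]
      ring
    · rw [max_eq_left (sub_nonneg.2 hy), max_eq_right (sub_nonpos.2 hy)]
      ring
  have h3 : A x - (l : ℂ) • x = cfc (fun y : ℝ => max (y - l) 0 - max (y - l') 0) A x := by
    have := congrArg (fun B : H →L[ℂ] H => B x) h2
    refine this.trans ?_
    rw [sub_apply, add_apply, h1, mem_spectralSubspace.1 hx, add_zero, sub_zero]
  rw [h3]
  refine ContinuousLinearMap.le_of_opNorm_le _ (norm_cfc_le (sub_nonneg.2 h) fun y _ => ?_) x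
  rw [Real.norm_eq_abs, abs_le]
  constructor
  · have := max_le_max_right (0 : ℝ) (sub_le_sub_left h y)
    linarith
  · rcases le_total y l' with hy | hy
    · rw [max_eq_right (sub_nonpos.2 hy), sub_zero]
      exact max_le (by linarith) (by linarith)
    · rw [max_eq_left (sub_nonneg.2 hy), max_eq_left (by linarith)]
      linarith

/-- Every vector is a sum of `m` orthogonal approximate eigenvectors of a selfadjoint operator, up to
errors of order `1 / m`. -/
theorem exists_orthogonal_approximate_eigenvectors {A : H →L[ℂ] H} (hA : IsSelfAdjoint A) (f : H)
    {ε : ℝ} (hε : 0 < ε) : ∃ (m : ℕ) (v : ℕ → H) (c : ℕ → ℝ) (Δ : ℝ), m * Δ ^ 2 ≤ ε ∧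
      ∑ j ∈ Finset.range m, v j = f ∧ (∀ i j, i < j → ⟪v i, v j⟫_ℂ = 0) ∧
      ∀ j, ‖A (v j) - (c j : ℂ) • v j‖ ≤ Δ * ‖v j‖ := by
  -- The added `1` gives the strict inequality which makes the lowest spectral subspace zero. The
  -- interval `[-R, R]` is cut into `m` pieces of length `Δ = 2 R / m`, so that `m Δ² = (2 R)² / m`.
  set R := ‖A‖ + 1 with hR
  have hR0 : 0 < R := by positivity
  obtain ⟨m, hm⟩ := exists_nat_gt ((2 * R) ^ 2 / ε)
  have hm0 : (0 : ℝ) < m := lt_trans (by positivity) hm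
  set Δ := 2 * R / m with hΔ
  have hΔ0 : 0 < Δ := by positivity
  set c : ℕ → ℝ := fun j => -R + Δ * j with hc
  have hcs : ∀ j, c (j + 1) = c j + Δ := fun j => by simp only [hc]; push_cast; ring
  have hmono : Monotone fun j => spectralSubspace A (c j) :=
    monotone_nat_of_le_succ fun j => spectralSubspace_mono A (by rw [hcs]; linarith)
  set p : ℕ → H := fun j => (spectralSubspace A (c j)).starProjection f with hp
  have hmem : ∀ j, p j ∈ spectralSubspace A (c j) := fun j => Submodule.starProjection_apply_mem _ _
  have hv : ∀ j, p (j + 1) - p j ∈ spectralSubspace A (c (j + 1)) := fun j =>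
    Submodule.sub_mem _ (hmem _) (hmono j.le_succ (hmem j))
  have hv' : ∀ j, p (j + 1) - p j ∈ (spectralSubspace A (c j))ᗮ := by
    intro j
    have h1 := Submodule.sub_starProjection_mem_orthogonal (K := spectralSubspace A (c j)) f
    have h2 := Submodule.orthogonal_le (hmono j.le_succ)
      (Submodule.sub_starProjection_mem_orthogonal (K := spectralSubspace A (c (j + 1))) f)
    have := Submodule.sub_mem _ h1 h2
    rwa [sub_sub_sub_cancel_left] at this
  refine ⟨m, fun j => p (j + 1) - p j, c, Δ, ?_, ?_, fun i j hij => ?_, fun j => ?_⟩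
  · rw [div_lt_iff₀ hε] at hm
    rw [hΔ, div_pow, mul_div_assoc', div_le_iff₀ (by positivity)]
    nlinarith
  · rw [Finset.sum_range_sub]
    have h0 : spectralSubspace A (c 0) = ⊥ := spectralSubspace_eq_bot hA (by simp [hc, hR])
    have h1 : spectralSubspace A (c m) = ⊤ := spectralSubspace_eq_top (by
      simp only [hc, hΔ]
      rw [div_mul_cancel₀ _ hm0.ne']
      linarith)
    have e0 : p 0 = 0 := by
      have := hmem 0
      rw [h0] at this
      exact (Submodule.mem_bot ℂ).1 this
    have e1 : p m = f := Submodule.starProjection_eq_self_iff.2 (h1 ▸ Submodule.mem_top)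
    rw [e0, e1, sub_zero]
  · exact Submodule.inner_right_of_mem_orthogonal (hmono (Nat.succ_le_of_lt hij) (hv i)) (hv' j)
  · have := norm_apply_sub_le_of_mem_spectralSubspace hA (l := c j) (l' := c (j + 1))
      (by rw [hcs]; linarith) (hv j) (hv' j)
    rwa [hcs, add_sub_cancel_left] at this

/-- The functional is arranged so that, for an orthonormal enlargement, the cost of a new vector `e`
is twice the squared distance of `A e` from the enlarged span. -/
theorem offDiagonalEnergy_insert [DecidableEq H] {A : H →L[ℂ] H} (hA : IsSelfAdjoint A)
    {s : Finset H} {e : H} (he : e ∉ s) : offDiagonalEnergy A (insert e s) =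
      offDiagonalEnergy A s +
        2 * (‖A e‖ ^ 2 - ∑ e' ∈ insert e s, ‖⟪e', A e⟫_ℂ‖ ^ 2) := by
  have hsymm : ∀ x, ‖⟪e, A x⟫_ℂ‖ = ‖⟪x, A e⟫_ℂ‖ := fun x => by
    rw [← ContinuousLinearMap.adjoint_inner_left, hA.adjoint_eq, norm_inner_symm]
  simp only [offDiagonalEnergy]
  rw [Finset.sum_insert he, Finset.sum_insert he, Finset.sum_insert he]
  have : ∑ x ∈ s, ∑ e' ∈ insert e s, ‖⟪e', A x⟫_ℂ‖ ^ 2 =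
      ∑ x ∈ s, ‖⟪x, A e⟫_ℂ‖ ^ 2 + ∑ x ∈ s, ∑ e' ∈ s, ‖⟪e', A x⟫_ℂ‖ ^ 2 := by
    rw [← Finset.sum_add_distrib]
    refine Finset.sum_congr rfl fun x _ => ?_
    rw [Finset.sum_insert he, hsymm]
  rw [this]
  ring

/-- Enlarging an orthonormal set by the directions of approximate eigenvectors of a compression of
`A`. -/
theorem exists_insert_approximate_eigenvectors {A : H →L[ℂ] H} (hA : IsSelfAdjoint A)
    {s : Finset H} (hs : Orthonormal ℂ (fun e : s => (e : H))) {v : ℕ → H} {c : ℕ → ℝ} {Δ : ℝ}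
    (hsv : ∀ j, ∀ e ∈ s, ⟪e, v j⟫_ℂ = 0) (hv : ∀ i j, i < j → ⟪v i, v j⟫_ℂ = 0)
    (hAv : ∀ j, ∃ z ∈ Submodule.span ℂ (s : Set H),
      ‖A (v j) - (c j : ℂ) • v j - z‖ ≤ Δ * ‖v j‖) (m : ℕ) :
    ∃ s' : Finset H, s ⊆ s' ∧ Orthonormal ℂ (fun e : s' => (e : H)) ∧
      (∀ j < m, v j ∈ Submodule.span ℂ (s' : Set H)) ∧ (∀ j, m ≤ j → ∀ e ∈ s', ⟪e, v j⟫_ℂ = 0) ∧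
      offDiagonalEnergy A s' ≤ offDiagonalEnergy A s + 2 * (m * Δ ^ 2) := by
  classical
  induction m with
  | zero => exact ⟨s, subset_rfl, hs, by simp, fun j _ => hsv j, by simp⟩
  | succ m ih =>
    obtain ⟨s', hss', hs', hspan, hperp, hen⟩ := ih
    by_cases h0 : v m = 0
    · refine ⟨s', hss', hs', fun j hj => ?_, fun j hj => hperp j (by omega), ?_⟩
      · rcases Nat.lt_succ_iff_lt_or_eq.1 hj with hj | rfl
        · exact hspan j hj
        · rw [h0]; exact Submodule.zero_mem _
      · push_cast
        nlinarith [sq_nonneg Δ]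
    have hn0 : (‖v m‖ : ℂ) ≠ 0 := by simpa using h0
    set e : H := (‖v m‖ : ℂ)⁻¹ • v m with he
    have hve : v m = (‖v m‖ : ℂ) • e := by rw [he, smul_smul, mul_inv_cancel₀ hn0, one_smul]
    have he1 : ‖e‖ = 1 := by
      rw [he, norm_smul, norm_inv, Complex.norm_real, norm_norm,
        inv_mul_cancel₀ (norm_ne_zero_iff.2 h0)]
    have hperp' : ∀ e' ∈ s', ⟪e', e⟫_ℂ = 0 := fun e' h' => by
      rw [he, inner_smul_right, hperp m le_rfl e' h', mul_zero]
    have hes : e ∉ s' := fun h => by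
      have := hperp' e h
      rw [inner_self_eq_norm_sq_to_K, he1] at this
      norm_num at this
    have hon := orthonormal_insert hs' he1 hperp'
    have hmem : e ∈ Submodule.span ℂ ((insert e s' : Finset H) : Set H) :=
      Submodule.subset_span (by simp)
    refine ⟨insert e s', hss'.trans (Finset.subset_insert _ _), hon, fun j hj => ?_,
      fun j hj e' h' => ?_, ?_⟩
    · rcases Nat.lt_succ_iff_lt_or_eq.1 hj with hj | rfl
      · exact Submodule.span_mono (by simp) (hspan j hj)
      · rw [hve]
        exact Submodule.smul_mem _ _ hmem
    · rcases Finset.mem_insert.1 h' with rfl | h'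
      · rw [he, inner_smul_left, hv m j hj, mul_zero]
      · exact hperp j (by omega) e' h'
    -- After normalization, `A e` is within `Δ` of the enlarged span: `c e` and `z` both lie in it.
    -- So the new vector costs at most `2 Δ²`.
    · obtain ⟨z, hz, hzn⟩ := hAv m
      have hz' : (c m : ℂ) • e + (‖v m‖ : ℂ)⁻¹ • z ∈
          Submodule.span ℂ ((insert e s' : Finset H) : Set H) := by
        refine Submodule.add_mem _ (Submodule.smul_mem _ _ hmem) (Submodule.smul_mem _ _ ?_)
        refine Submodule.span_mono ?_ hz
        exact_mod_cast hss'.trans (Finset.subset_insert e s')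
      have h1 := norm_sq_sub_sum_le hon (A e) hz'
      have h2 : A e - ((c m : ℂ) • e + (‖v m‖ : ℂ)⁻¹ • z) =
          (‖v m‖ : ℂ)⁻¹ • (A (v m) - (c m : ℂ) • v m - z) := by
        rw [smul_sub, smul_sub, smul_comm, ← map_smul, ← he, sub_sub]
      have h3 : ‖A e - ((c m : ℂ) • e + (‖v m‖ : ℂ)⁻¹ • z)‖ ≤ Δ := by
        rw [h2, norm_smul, norm_inv, Complex.norm_real, norm_norm,
          inv_mul_le_iff₀ (norm_pos_iff.2 h0), mul_comm]
        exact hzn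
      have h4 : ‖A e - ((c m : ℂ) • e + (‖v m‖ : ℂ)⁻¹ • z)‖ ^ 2 ≤ Δ ^ 2 := by gcongr
      rw [offDiagonalEnergy_insert hA hes]
      push_cast
      linarith

/-- Approximate eigenvectors are taken for the compression of `A` to the complement of the span of
`s`. The component of `A v` in that span is harmless, as the energy charges only for the distance to
the span. -/
theorem exists_orthonormal_superset_mem_span {A : H →L[ℂ] H} (hA : IsSelfAdjoint A) {s : Finset H}
    (hs : Orthonormal ℂ (fun e : s => (e : H))) (f : H) {ε : ℝ} (hε : 0 < ε) :
    ∃ s' : Finset H, s ⊆ s' ∧ Orthonormal ℂ (fun e : s' => (e : H)) ∧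
      f ∈ Submodule.span ℂ (s' : Set H) ∧ offDiagonalEnergy A s' ≤ offDiagonalEnergy A s + ε := by
  set F := Submodule.span ℂ (s : Set H) with hF
  have : FiniteDimensional ℂ F := FiniteDimensional.span_finset ℂ s
  set B : Fᗮ →L[ℂ] Fᗮ := Fᗮ.orthogonalProjectionOnto ∘L A ∘L Fᗮ.subtypeL with hB
  have hBA : ∀ x : Fᗮ, (B x : H) = A x - F.starProjection (A x) := fun x => by
    change Fᗮ.starProjection (A x) = _
    rw [Submodule.starProjection_orthogonal]
    rfl
  have hBs : IsSelfAdjoint B := by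
    rw [ContinuousLinearMap.isSelfAdjoint_iff_isSymmetric] at hA ⊢
    intro x y
    change ⟪(B x : H), (y : H)⟫_ℂ = ⟪(x : H), (B y : H)⟫_ℂ
    rw [hBA, hBA, inner_sub_left, inner_sub_right,
      Submodule.inner_right_of_mem_orthogonal (Submodule.starProjection_apply_mem _ _) y.2,
      Submodule.inner_left_of_mem_orthogonal (Submodule.starProjection_apply_mem _ _) x.2,
      sub_zero, sub_zero]
    exact hA x y
  obtain ⟨m, v, c, Δ, hΔ, hsum, hv, hBv⟩ := exists_orthogonal_approximate_eigenvectors hBs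
    (Fᗮ.orthogonalProjectionOnto f) (half_pos hε)
  obtain ⟨s', hss', hs', hspan, -, hen⟩ := exists_insert_approximate_eigenvectors hA hs
    (v := fun j => (v j : H)) (c := c) (Δ := Δ)
    (fun j e he => Submodule.inner_right_of_mem_orthogonal (Submodule.subset_span he) (v j).2)
    (fun i j hij => hv i j hij) (fun j => ⟨F.starProjection (A (v j)),
      Submodule.starProjection_apply_mem _ _, by
        rw [sub_right_comm, ← hBA]
        exact hBv j⟩) m
  refine ⟨s', hss', hs', ?_, by linarith⟩
  have h1 : f = F.starProjection f + ∑ j ∈ Finset.range m, (v j : H) := by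
    have : ∑ j ∈ Finset.range m, (v j : H) = Fᗮ.starProjection f := by
      rw [← Submodule.coe_sum, hsum]
      rfl
    rw [this, Submodule.starProjection_orthogonal]
    simp
  rw [h1]
  refine Submodule.add_mem _ (Submodule.span_mono (by exact_mod_cast hss')
    (Submodule.starProjection_apply_mem F f)) (Submodule.sum_mem _ fun j hj => ?_)
  exact hspan j (Finset.mem_range.1 hj)

/-- The theorem of Weyl and von Neumann: a bounded selfadjoint operator on a separable space is
diagonal up to a Hilbert–Schmidt operator. -/
theorem exists_hilbertBasis_summable_off_diagonal [TopologicalSpace.SeparableSpace H]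
    {A : H →L[ℂ] H} (hA : IsSelfAdjoint A) : ∃ (w : Set H) (b : HilbertBasis w ℂ H), w.Countable ∧
      Summable fun e => ‖A (b e) - ⟪b e, A (b e)⟫_ℂ • b e‖ ^ 2 := by
  classical
  let S := {s : Finset H // Orthonormal ℂ (fun e : s => (e : H))}
  set f := TopologicalSpace.denseSeq H with hf
  -- One vector of a dense sequence is absorbed at each step, at a cost of `2^{-n}`, so the total
  -- energy stays below `2`.
  have hstep : ∀ (n : ℕ) (s : S), ∃ s' : S, s.1 ⊆ s'.1 ∧
      f n ∈ Submodule.span ℂ (s'.1 : Set H) ∧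
      offDiagonalEnergy A s'.1 ≤ offDiagonalEnergy A s.1 + (1 / 2) ^ n := fun n s => by
    obtain ⟨s', h1, h2, h3, h4⟩ := exists_orthonormal_superset_mem_span hA s.2 (f n)
      (ε := (1 / 2) ^ n) (by positivity)
    exact ⟨⟨s', h2⟩, h1, h3, h4⟩
  choose next hsub hmem hen using hstep
  let s₀ : S := ⟨∅, ⟨fun e => absurd e.2 (Finset.notMem_empty _),
    fun e => absurd e.2 (Finset.notMem_empty _)⟩⟩
  let s : ℕ → S := fun n => Nat.rec s₀ next n
  have hs : ∀ n, s (n + 1) = next n (s n) := fun n => rfl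
  have hmono : Monotone fun n => ((s n).1 : Set H) := monotone_nat_of_le_succ fun n => by
    rw [hs]
    exact_mod_cast hsub n (s n)
  have hbound : ∀ n, offDiagonalEnergy A (s n).1 ≤ 2 := by
    have h : ∀ n, offDiagonalEnergy A (s n).1 ≤ ∑ k ∈ Finset.range n, (1 / 2 : ℝ) ^ k := by
      intro n
      induction n with
      | zero =>
        change offDiagonalEnergy A ∅ ≤ _
        simp [offDiagonalEnergy]
      | succ n ih =>
        rw [hs, Finset.sum_range_succ]
        exact (hen n (s n)).trans (by linarith)
    refine fun n => (h n).trans ?_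
    exact (summable_geometric_two.sum_le_tsum _ fun _ _ => by positivity).trans_eq
      tsum_geometric_two
  set w : Set H := ⋃ n, ((s n).1 : Set H) with hw
  have hfin : ∀ u : Finset w, ∃ n, ∀ e ∈ u, (e : H) ∈ (s n).1 := by
    intro u
    induction u using Finset.induction_on with
    | empty => exact ⟨0, by simp⟩
    | insert a u _ ih =>
      obtain ⟨n, hn⟩ := ih
      obtain ⟨m, hm⟩ := Set.mem_iUnion.1 a.2
      refine ⟨max n m, fun e he => ?_⟩
      rcases Finset.mem_insert.1 he with rfl | he
      · exact hmono (le_max_right n m) hm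
      · exact hmono (le_max_left n m) (hn e he)
  have hon : Orthonormal ℂ (fun e : w => (e : H)) := by
    refine ⟨fun e => ?_, fun e e' hne => ?_⟩
    · obtain ⟨n, hn⟩ := hfin {e}
      exact (s n).2.1 ⟨e, hn e (by simp)⟩
    · obtain ⟨n, hn⟩ := hfin {e, e'}
      exact (s n).2.2 (i := ⟨e, hn e (by simp)⟩) (j := ⟨e', hn e' (by simp)⟩)
        fun h => hne (Subtype.ext (Subtype.mk.inj h))
  have hspan : ⊤ ≤ (Submodule.span ℂ (Set.range fun e : w => (e : H))).topologicalClosure := by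
    rw [Subtype.range_coe]
    intro x _
    have : Set.range f ⊆ Submodule.span ℂ w := by
      rintro _ ⟨n, rfl⟩
      refine Submodule.span_mono (Set.subset_iUnion _ (n + 1)) ?_
      rw [hs]
      exact hmem n (s n)
    exact closure_mono this (TopologicalSpace.denseRange_denseSeq H x)
  refine ⟨w, HilbertBasis.mk hon hspan,
    Set.countable_iUnion fun n => (s n).1.countable_toSet, summable_of_sum_le (c := 2) (fun _ => by positivity)
    fun u => ?_⟩
  rw [HilbertBasis.coe_mk]
  obtain ⟨n, hn⟩ := hfin u
  have hoff : ∀ e : w, ‖A e - ⟪(e : H), A e⟫_ℂ • (e : H)‖ ^ 2 =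
      ‖A e‖ ^ 2 - ‖⟪(e : H), A e⟫_ℂ‖ ^ 2 := by
    intro e
    have h0 : ⟪⟪(e : H), A e⟫_ℂ • (e : H), A e - ⟪(e : H), A e⟫_ℂ • (e : H)⟫_ℂ = 0 := by
      rw [inner_smul_left, inner_sub_right, inner_smul_right, inner_self_eq_norm_sq_to_K, hon.1 e]
      simp
    have := norm_add_sq_of_inner_eq_zero h0
    rw [add_sub_cancel, norm_smul, hon.1 e, mul_one] at this
    linarith
  calc ∑ e ∈ u, ‖A e - ⟪(e : H), A e⟫_ℂ • (e : H)‖ ^ 2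
      = ∑ e ∈ u.image Subtype.val, (‖A e‖ ^ 2 - ‖⟪e, A e⟫_ℂ‖ ^ 2) := by
        rw [Finset.sum_image fun _ _ _ _ h => Subtype.ext h]
        exact Finset.sum_congr rfl fun e _ => hoff e
    _ ≤ ∑ e ∈ (s n).1, (‖A e‖ ^ 2 - ‖⟪e, A e⟫_ℂ‖ ^ 2) := by
        refine Finset.sum_le_sum_of_subset_of_nonneg ?_ fun e he _ => ?_
        · intro e he
          obtain ⟨e', he', rfl⟩ := Finset.mem_image.1 he
          exact hn e' he'
        · have := hoff ⟨e, Set.mem_iUnion.2 ⟨n, he⟩⟩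
          rw [← this]
          positivity
    _ ≤ 2 := (le_offDiagonalEnergy A (s n).2).trans (hbound n)

end WeylVonNeumann

/-! ### Stable dissipative perturbations -/

section Perturbation

variable {H : Type*} [NormedAddCommGroup H] [InnerProductSpace ℂ H]

/-- Operators with prescribed square summable columns. -/
theorem exists_apply_hilbertBasis_eq {F : Type*} [NormedAddCommGroup F] [InnerProductSpace ℂ F]
    [CompleteSpace F] {ι : Type*} (b : HilbertBasis ι ℂ H) {c : ι → F}
    (hc : Summable fun i => ‖c i‖ ^ 2) : ∃ N : H →L[ℂ] F, ∀ i, N (b i) = c i := by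
  classical
  have hle : ∀ x i, ‖⟪b i, x⟫_ℂ • c i‖ ≤ (‖⟪b i, x⟫_ℂ‖ ^ 2 + ‖c i‖ ^ 2) / 2 := fun x i => by
    rw [norm_smul]
    nlinarith [sq_nonneg (‖⟪b i, x⟫_ℂ‖ - ‖c i‖)]
  have hsum' : ∀ x, Summable fun i => (‖⟪b i, x⟫_ℂ‖ ^ 2 + ‖c i‖ ^ 2) / 2 := fun x =>
    ((hasSum_norm_inner_sq b x).summable.add hc).div_const 2
  have hnorm : ∀ x, Summable fun i => ‖⟪b i, x⟫_ℂ • c i‖ := fun x =>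
    Summable.of_nonneg_of_le (fun _ => norm_nonneg _) (hle x) (hsum' x)
  let N₀ : H →ₗ[ℂ] F :=
    { toFun := fun x => ∑' i, ⟪b i, x⟫_ℂ • c i
      map_add' := fun x y => by
        rw [← (hnorm x).of_norm.tsum_add (hnorm y).of_norm]
        simp only [inner_add_right, add_smul]
      map_smul' := fun a x => by
        rw [RingHom.id_apply, ← tsum_const_smul'']
        simp only [inner_smul_right, mul_smul] }
  set C := ∑' i, ‖c i‖ ^ 2 with hC
  have hball : ∀ x, ‖N₀ x‖ ≤ (‖x‖ ^ 2 + C) / 2 := by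
    intro x
    refine (norm_tsum_le_tsum_norm (hnorm x)).trans ?_
    refine ((hnorm x).tsum_le_tsum (hle x) (hsum' x)).trans_eq ?_
    rw [tsum_div_const, (hasSum_norm_inner_sq b x).summable.tsum_add hc,
      (hasSum_norm_inner_sq b x).tsum_eq]
  -- The inhomogeneous bound becomes homogeneous on rescaling to unit vectors.
  have hbound : ∀ x, ‖N₀ x‖ ≤ ((1 + C) / 2) * ‖x‖ := by
    intro x
    by_cases hx : x = 0
    · simp [hx]
    have hx0 : (‖x‖ : ℂ) ≠ 0 := by simpa using hx
    have h := hball ((‖x‖ : ℂ)⁻¹ • x)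
    rw [map_smul, norm_smul, norm_smul, norm_inv, Complex.norm_real, norm_norm,
      inv_mul_cancel₀ (norm_ne_zero_iff.2 hx), one_pow,
      inv_mul_le_iff₀ (norm_pos_iff.2 hx), mul_comm] at h
    exact h
  refine ⟨N₀.mkContinuous _ hbound, fun i => ?_⟩
  change ∑' j, ⟪b j, b i⟫_ℂ • c j = c i
  rw [tsum_eq_single i fun j hj => by rw [b.orthonormal.2 hj, zero_smul],
    inner_self_eq_norm_sq_to_K, b.orthonormal.1 i]
  simp

theorem hilbertBasis_ext_inner {ι : Type*} (b : HilbertBasis ι ℂ H) {x y : H}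
    (h : ∀ i, ⟪b i, x⟫_ℂ = ⟪b i, y⟫_ℂ) : x = y := by
  refine b.repr.injective (lp.ext (funext fun i => ?_))
  rw [b.repr_apply_apply, b.repr_apply_apply, h]

variable [CompleteSpace H]

open NormedSpace

theorem exp_smul_adjoint (G : H →L[ℂ] H) (t : ℝ) :
    ContinuousLinearMap.adjoint (exp (t • G)) = exp (t • ContinuousLinearMap.adjoint G) := by
  rw [← ContinuousLinearMap.star_eq_adjoint, star_exp, star_smul, star_trivial,
    ContinuousLinearMap.star_eq_adjoint]

/-- A vector `v` is stable under a contraction semigroup with generator `B` if `B v - l v` is, for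
some `l` in the left half plane. -/
theorem tendsto_exp_smul_apply_zero {B : H →L[ℂ] H}
    (hB : ∀ t : ℝ, 0 ≤ t → ∀ x, ‖exp (t • B) x‖ ≤ ‖x‖)
    {l : ℂ} (hl : l.re < 0) {v : H}
    (h : Filter.Tendsto (fun t : ℝ => exp (t • B) (B v - l • v)) Filter.atTop (𝓝 0)) :
    Filter.Tendsto (fun t : ℝ => exp (t • B) v) Filter.atTop (𝓝 0) := by
  set r := B v - l • v with hr
  set q := Real.exp (-l.re) with hq
  have hq1 : 1 < q := Real.one_lt_exp_iff.2 (by linarith)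
  have hcomm : ∀ (t : ℝ) x, B (exp (t • B) x) = exp (t • B) (B x) := fun t x => by
    have : Commute B (exp (t • B)) := ((Commute.refl B).smul_right t).exp_right
    exact congrArg (fun A : H →L[ℂ] H => A x) this.eq
  -- Over a unit of time, `e^{-l s} exp (s B) y` changes only through the residual `r`. As `q > 1`,
  -- the limit `L` of the decreasing norms will satisfy `q L ≤ L`, hence vanish.
  have hstep : ∀ t : ℝ, 0 ≤ t → q * ‖exp ((t + 1) • B) v‖ ≤ ‖exp (t • B) v‖ + q * ‖exp (t • B) r‖ := by
    intro t ht
    set y := exp (t • B) v with hy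
    have hyr : B y - l • y = exp (t • B) r := by
      rw [hy, hcomm, hr, map_sub, map_smul]
    set ψ : ℝ → H := fun s => Complex.exp (-l * s) • exp (s • B) y with hψ
    have hd : ∀ s : ℝ, HasDerivAt ψ (Complex.exp (-l * s) • exp (s • B) (exp (t • B) r)) s := by
      intro s
      have h1 : HasDerivAt (fun s : ℝ => Complex.exp (-l * s)) (Complex.exp (-l * s) * -l) s := by
        have : HasDerivAt (fun s : ℝ => -l * (s : ℂ)) (-l * 1) s :=
          (Complex.ofRealCLM.hasDerivAt (x := s)).const_mul (-l)
        simpa using this.cexp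
      refine (h1.smul (hasDerivAt_exp_smul_apply B y s)).congr_deriv ?_
      rw [← hyr, map_sub, map_smul, hcomm, smul_sub, mul_smul, neg_smul, smul_neg, sub_eq_add_neg]
    have h2 : ‖ψ 1 - ψ 0‖ ≤ q * ‖exp (t • B) r‖ * (1 - 0) := by
      refine norm_image_sub_le_of_norm_deriv_le_segment' (fun s _ => (hd s).hasDerivWithinAt)
        (fun s hs => ?_) 1 ⟨zero_le_one, le_rfl⟩
      rw [norm_smul, Complex.norm_exp]
      refine mul_le_mul ?_ (hB s hs.1 _) (norm_nonneg _) (Real.exp_pos _).le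
      refine Real.exp_le_exp.2 ?_
      simp only [Complex.mul_re, Complex.neg_re, Complex.ofReal_re, Complex.ofReal_im, mul_zero,
        sub_zero]
      nlinarith [hs.2]
    have e0 : ψ 0 = y := by
      simp only [hψ]
      simp
    have e1 : ‖ψ 1‖ = q * ‖exp ((t + 1) • B) v‖ := by
      simp only [hψ]
      rw [norm_smul, Complex.norm_exp, add_comm t 1, exp_add_smul]
      simp [hq, hy]
    rw [e0, sub_zero, mul_one] at h2
    have h3 := norm_sub_norm_le (ψ 1) y
    linarith
  have hanti : ∀ s t : ℝ, 0 ≤ s → s ≤ t → ‖exp (t • B) v‖ ≤ ‖exp (s • B) v‖ := by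
    intro s t hs hst
    have := exp_add_smul B (t - s) s
    rw [sub_add_cancel] at this
    rw [this]
    exact hB _ (sub_nonneg.2 hst) _
  set a : ℝ → ℝ := fun t => ‖exp (max t 0 • B) v‖ with ha
  have haa : Antitone a := fun s t hst => hanti _ _ (le_max_right _ _) (max_le_max_right 0 hst)
  have hab : BddBelow (Set.range a) := ⟨0, by rintro _ ⟨t, rfl⟩; exact norm_nonneg _⟩
  have hlim := tendsto_atTop_ciInf haa hab
  set L := ⨅ t, a t with hL
  have hev : ∀ᶠ t in Filter.atTop, a t = ‖exp (t • B) v‖ :=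
    (Filter.eventually_ge_atTop 0).mono fun t ht => by simp only [ha]; rw [max_eq_left ht]
  have hlim' : Filter.Tendsto (fun t : ℝ => ‖exp (t • B) v‖) Filter.atTop (𝓝 L) :=
    hlim.congr' hev
  have hL0 : 0 ≤ L := ge_of_tendsto' hlim' fun t => norm_nonneg _
  have h4 : q * L ≤ L + q * ‖(0 : H)‖ := by
    refine le_of_tendsto_of_tendsto
      ((hlim'.comp (Filter.tendsto_atTop_add_const_right _ 1 Filter.tendsto_id)).const_mul q)
      (hlim'.add (h.norm.const_mul q)) ?_
    exact (Filter.eventually_ge_atTop 0).mono fun t ht => hstep t ht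
  have hL' : L = 0 := by
    rw [norm_zero, mul_zero, add_zero] at h4
    nlinarith
  rw [hL'] at hlim'
  exact tendsto_zero_iff_norm_tendsto_zero.2 hlim'

/-- A contraction semigroup which is stable on an orthonormal basis is stable. -/
theorem tendsto_exp_smul_of_hilbertBasis {B : H →L[ℂ] H} {ι : Type*} (b : HilbertBasis ι ℂ H)
    (hB : ∀ t : ℝ, 0 ≤ t → ∀ x, ‖exp (t • B) x‖ ≤ ‖x‖)
    (h : ∀ i, Filter.Tendsto (fun t : ℝ => exp (t • B) (b i)) Filter.atTop (𝓝 0)) (x : H) :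
    Filter.Tendsto (fun t : ℝ => exp (t • B) x) Filter.atTop (𝓝 0) := by
  let M : Submodule ℂ H :=
    { carrier := {x | Filter.Tendsto (fun t : ℝ => exp (t • B) x) Filter.atTop (𝓝 0)}
      zero_mem' := by simp
      add_mem' := fun {x y} hx hy => by
        have := Filter.Tendsto.add hx hy
        simpa using this
      smul_mem' := fun c x hx => by
        have := Filter.Tendsto.const_smul hx c
        simpa using this }
  have hM : IsClosed (M : Set H) := by
    refine isClosed_of_closure_subset fun x hx => ?_
    change Filter.Tendsto _ _ _
    rw [Metric.tendsto_nhds]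
    intro ε hε
    obtain ⟨y, hy, hxy⟩ := Metric.mem_closure_iff.1 hx (ε / 2) (half_pos hε)
    have hy : Filter.Tendsto (fun t : ℝ => exp (t • B) y) Filter.atTop (𝓝 0) := hy
    filter_upwards [Metric.tendsto_nhds.1 hy (ε / 2) (half_pos hε), Filter.eventually_ge_atTop 0]
      with t h1 ht
    rw [dist_zero_right] at h1 ⊢
    have h2 := hB t ht (x - y)
    rw [map_sub] at h2
    rw [dist_eq_norm] at hxy
    have h3 := norm_sub_norm_le (exp (t • B) x) (exp (t • B) y)
    linarith
  have hle : (Submodule.span ℂ (Set.range b)).topologicalClosure ≤ M := by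
    refine Submodule.topologicalClosure_minimal _ (Submodule.span_le.2 ?_) hM
    rintro _ ⟨i, rfl⟩
    exact h i
  rw [b.dense_span] at hle
  exact hle (Submodule.mem_top (x := x))

/-- A bounded selfadjoint operator `A` on a separable space has a Hilbert–Schmidt perturbation `G` of
`i A` with `G + G* = -|g⟩⟨g|`, such that the adjoint of the contraction semigroup generated by `G`
is stable: `G` is triangular in an orthonormal basis which almost diagonalizes `A`. -/
theorem exists_stable_perturbation [TopologicalSpace.SeparableSpace H] {A : H →L[ℂ] H}
    (hA : IsSelfAdjoint A) : ∃ (G : H →L[ℂ] H) (g : H),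
      (∀ x, 2 * RCLike.re ⟪x, G x⟫_ℂ = -‖⟪g, x⟫_ℂ‖ ^ 2) ∧
      HasFiniteHSNorm (G - Complex.I • A) ∧
      ∀ x, Filter.Tendsto (fun t : ℝ => ContinuousLinearMap.adjoint (exp (t • G)) x)
        Filter.atTop (𝓝 0) := by
  classical
  obtain ⟨w, b, hcount, hw⟩ := exists_hilbertBasis_summable_off_diagonal hA
  have : Countable w := hcount.to_subtype
  obtain ⟨enc, henc⟩ := exists_injective_nat w
  -- Any positive weights with finite sum would do: positivity gives every basis vector some
  -- damping, summability keeps the perturbation Hilbert–Schmidt.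
  set γ : w → ℝ := fun i => (1 / 2) ^ enc i with hγ
  have hγ0 : ∀ i, 0 < γ i := fun i => by positivity
  have hγ1 : ∀ i, γ i ≤ 1 := fun i => pow_le_one₀ (by norm_num) (by norm_num)
  have hγs : Summable γ := summable_geometric_two.comp_injective henc
  have hγs2 : Summable fun i => γ i ^ 2 :=
    Summable.of_nonneg_of_le (fun _ => by positivity)
      (fun i => by nlinarith [hγ0 i, hγ1 i]) hγs
  have hb : ∀ i j, ⟪b i, b j⟫_ℂ = if i = j then 1 else 0 := orthonormal_iff_ite.1 b.orthonormal
  have hbn : ∀ i, ‖b i‖ = 1 := b.orthonormal.1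
  -- partial sums of the vector `∑ γ k • b k`
  have hpart : ∀ p : w → Prop, Summable fun k => if p k then (γ k : ℂ) • b k else 0 := fun p => by
    refine Summable.of_norm_bounded hγs fun k => ?_
    split_ifs
    · rw [norm_smul, hbn, mul_one, Complex.norm_real, Real.norm_of_nonneg (hγ0 k).le]
    · rw [norm_zero]; exact (hγ0 k).le
  set τ : (w → Prop) → H := fun p => ∑' k, if p k then (γ k : ℂ) • b k else 0 with hτ
  have hτi : ∀ p i, ⟪b i, τ p⟫_ℂ = if p i then (γ i : ℂ) else 0 := by
    intro p i
    have h1 := (hpart p).hasSum.mapL (innerSL ℂ (b i))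
    have h2 : HasSum (fun k => ⟪b i, if p k then (γ k : ℂ) • b k else 0⟫_ℂ)
      (if p i then (γ i : ℂ) else 0) := by
      convert hasSum_ite_eq i (if p i then (γ i : ℂ) else 0) using 2 with k
      by_cases hk : k = i
      · subst hk
        rw [if_pos rfl]
        split_ifs
        · rw [inner_smul_right, hb, if_pos rfl, mul_one]
        · rw [inner_zero_right]
      · rw [if_neg hk]
        split_ifs
        · rw [inner_smul_right, hb, if_neg (Ne.symm hk), mul_zero]
        · rw [inner_zero_right]
    exact h1.unique h2
  have hτn : ∀ p, ‖τ p‖ ≤ ∑' i, γ i := fun p => by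
    refine tsum_of_norm_bounded hγs.hasSum fun k => ?_
    split_ifs
    · rw [norm_smul, hbn, mul_one, Complex.norm_real, Real.norm_of_nonneg (hγ0 k).le]
    · rw [norm_zero]; exact (hγ0 k).le
  set g := τ fun _ => True with hg
  have hgi : ∀ i, ⟪b i, g⟫_ℂ = γ i := fun i => by rw [hg, hτi]; simp
  have hgi' : ∀ i, ⟪g, b i⟫_ℂ = γ i := fun i => by rw [← inner_conj_symm, hgi, Complex.conj_ofReal]
  -- Half of the diagonal and the strictly lower triangle of `|g⟩⟨g|`, column by column up to the
  -- factor `γ j`. Subtracting it from a skew-adjoint diagonal operator yields `G + G* = -|g⟩⟨g|`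
  -- and keeps `G` triangular.
  set u : w → H := fun j => (γ j / 2 : ℂ) • b j + τ fun k => enc j < enc k with hu
  have hun : ∀ j, ‖u j‖ ≤ 1 + ∑' i, γ i := fun j => by
    refine (norm_add_le _ _).trans (add_le_add ?_ (hτn _))
    rw [norm_smul, hbn, mul_one, norm_div, Complex.norm_real, Real.norm_of_nonneg (hγ0 j).le]
    norm_num
    linarith [hγ1 j]
  -- The columns of the perturbation: removal of the off-diagonal part of `i A`, then the triangular
  -- damping.
  set c : w → H := fun j => -(Complex.I • (A (b j) - ⟪b j, A (b j)⟫_ℂ • b j)) - (γ j : ℂ) • u j with hc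
  have hcs : Summable fun j => ‖c j‖ ^ 2 := by
    refine Summable.of_nonneg_of_le (fun _ => by positivity) (fun j => ?_)
      ((hw.mul_left 2).add (hγs2.mul_left (2 * (1 + ∑' i, γ i) ^ 2)))
    have h1 : ‖c j‖ ≤ ‖A (b j) - ⟪b j, A (b j)⟫_ℂ • b j‖ + γ j * (1 + ∑' i, γ i) := by
      refine (norm_sub_le _ _).trans (add_le_add ?_ ?_)
      · rw [norm_neg, norm_smul, Complex.norm_I, one_mul]
      · rw [norm_smul, Complex.norm_real, Real.norm_of_nonneg (hγ0 j).le]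
        exact mul_le_mul_of_nonneg_left (hun j) (hγ0 j).le
    have h2 := pow_le_pow_left₀ (norm_nonneg _) h1 2
    nlinarith [sq_nonneg (‖A (b j) - ⟪b j, A (b j)⟫_ℂ • b j‖ - γ j * (1 + ∑' i, γ i))]
  obtain ⟨N, hN⟩ := exists_apply_hilbertBasis_eq b hcs
  set G := Complex.I • A + N with hG
  set d : w → ℝ := fun j => RCLike.re ⟪b j, A (b j)⟫_ℂ with hd
  have hdA : ∀ j, ⟪b j, A (b j)⟫_ℂ = d j := fun j => by
    have h1 := (ContinuousLinearMap.isSelfAdjoint_iff_isSymmetric.1 hA) (b j) (b j)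
    have h2 : (starRingEnd ℂ) ⟪b j, A (b j)⟫_ℂ = ⟪b j, A (b j)⟫_ℂ := by
      rw [inner_conj_symm]
      exact h1
    exact (Complex.conj_eq_iff_re.1 h2).symm
  have hGb : ∀ j, G (b j) = (Complex.I * d j) • b j - (γ j : ℂ) • u j := by
    intro j
    change Complex.I • A (b j) + N (b j) = _
    rw [hN, ← hdA, mul_smul]
    simp only [hc, smul_sub]
    abel
  have hGi : ∀ i j, ⟪b i, G (b j)⟫_ℂ = (if i = j then Complex.I * d j - γ j ^ 2 / 2 else 0) -
      if enc j < enc i then (γ j * γ i : ℂ) else 0 := by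
    intro i j
    rw [hGb, inner_sub_right, inner_smul_right, inner_smul_right, hu, inner_add_right,
      inner_smul_right, hτi, hb]
    split_ifs <;> ring
  have hGadj : ∀ i j, ⟪b i, ContinuousLinearMap.adjoint G (b j)⟫_ℂ =
      (if i = j then -Complex.I * d j - γ j ^ 2 / 2 else 0) -
      if enc i < enc j then (γ j * γ i : ℂ) else 0 := by
    intro i j
    rw [ContinuousLinearMap.adjoint_inner_right, ← inner_conj_symm, hGi]
    by_cases hij : i = j
    · subst hij
      simp [Complex.conj_ofNat]
    · rw [if_neg hij, if_neg (Ne.symm hij)]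
      split_ifs <;> simp [mul_comm]
  have hsumG : ∀ x, G x + ContinuousLinearMap.adjoint G x = -(⟪g, x⟫_ℂ • g) := by
    have h1 : G + ContinuousLinearMap.adjoint G = -((innerSL ℂ g).smulRight g) := by
      refine ContinuousLinearMap.ext_on (s := Set.range b) ?_ ?_
      · exact Submodule.dense_iff_topologicalClosure_eq_top.2 b.dense_span
      rintro _ ⟨j, rfl⟩
      refine hilbertBasis_ext_inner b fun i => ?_
      change ⟪b i, G (b j) + ContinuousLinearMap.adjoint G (b j)⟫_ℂ = ⟪b i, -(⟪g, b j⟫_ℂ • g)⟫_ℂ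
      rw [inner_add_right, hGi, hGadj, inner_neg_right, inner_smul_right, hgi, hgi']
      by_cases hij : i = j
      · subst hij
        simp
        ring
      · rcases lt_or_gt_of_ne (fun h => hij (henc h)) with h | h
        · simp [hij, h, h.not_gt]
        · simp [hij, h, h.not_gt]
    exact fun x => congrArg (fun B : H →L[ℂ] H => B x) h1
  have hre : ∀ x, 2 * RCLike.re ⟪x, G x⟫_ℂ = -‖⟪g, x⟫_ℂ‖ ^ 2 := by
    intro x
    have h1 := congrArg (fun y => RCLike.re ⟪x, y⟫_ℂ) (hsumG x)
    simp only [inner_add_right, map_add, inner_neg_right, inner_smul_right, map_neg] at h1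
    rw [ContinuousLinearMap.adjoint_inner_right, inner_re_symm (𝕜 := ℂ) (G x), ← inner_conj_symm x g,
      RCLike.mul_conj] at h1
    rw [two_mul, h1]
    norm_cast
  refine ⟨G, g, hre, ?_, ?_⟩
  · rw [hG, add_sub_cancel_left]
    exact hasFiniteHSNorm_of_basis b N (by simpa only [hN] using hcs)
  · have hB : ∀ t : ℝ, 0 ≤ t → ∀ x, ‖exp (t • ContinuousLinearMap.adjoint G) x‖ ≤ ‖x‖ := by
      intro t ht
      have h1 : ∀ x, 2 * RCLike.re ⟪x, ContinuousLinearMap.adjoint G x⟫_ℂ = -‖⟪g, x⟫_ℂ‖ ^ 2 := fun x => by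
        rw [ContinuousLinearMap.adjoint_inner_right, inner_re_symm (𝕜 := ℂ)]
        exact hre x
      exact norm_exp_smul_le h1 ht
    simp only [exp_smul_adjoint]
    refine tendsto_exp_smul_of_hilbertBasis b hB fun j => ?_
    -- `G* b j` is `l (b j)` plus a combination of earlier basis vectors, where `l` has real part
    -- `-γ j² / 2 < 0`. So stability propagates along the enumeration.
    induction hn : enc j using Nat.strong_induction_on generalizing j with
    | _ n ih =>
      refine tendsto_exp_smul_apply_zero hB (l := -Complex.I * d j - γ j ^ 2 / 2) ?_ ?_
      · have : 0 < γ j ^ 2 := by have := hγ0 j; positivity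
        simp [← Complex.ofReal_pow]
        exact this
      · have hfin : {i | enc i < enc j}.Finite := (Set.finite_lt_nat (enc j)).preimage henc.injOn
        have hr : ContinuousLinearMap.adjoint G (b j) - (-Complex.I * d j - γ j ^ 2 / 2 : ℂ) • b j =
            ∑ i ∈ hfin.toFinset, -(γ j * γ i : ℂ) • b i := by
          refine hilbertBasis_ext_inner b fun i => ?_
          rw [inner_sub_right, hGadj, inner_smul_right, hb, inner_sum]
          simp only [inner_smul_right, hb]
          simp
          split_ifs <;> simp
        rw [hr]
        simp only [map_sum, map_smul]
        rw [← Finset.sum_const_zero (s := hfin.toFinset) (ι := w)]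
        refine tendsto_finsetSum _ fun i hi => ?_
        rw [← smul_zero (-(γ j * γ i : ℂ))]
        have hi : enc i < enc j := by simpa using hi
        exact (ih (enc i) (hn ▸ hi) i rfl).const_smul _

end Perturbation

/-! ### The unitary part -/

section UnitaryPart

/-- The semigroup generated by a bounded operator `G`. -/
noncomputable def expSemigroup {H : Type*} [NormedAddCommGroup H] [InnerProductSpace ℂ H]
    [CompleteSpace H] (G : H →L[ℂ] H) (t : ℝ) : H →L[ℂ] H := NormedSpace.exp (t • G)

variable {K : Type*} [NormedAddCommGroup K] [InnerProductSpace ℂ K] [CompleteSpace K]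
  {V : ℝ≥0 → K →L[ℂ] K} {K₀ : Submodule ℂ K}

theorem isSelfAdjoint_of_re_inner_eq_zero {H : Type*} [NormedAddCommGroup H]
    [InnerProductSpace ℂ H] [CompleteSpace H] {B : H →L[ℂ] H}
    (hB : ∀ x, RCLike.re ⟪x, B x⟫_ℂ = 0) : IsSelfAdjoint (-Complex.I • B) := by
  rw [ContinuousLinearMap.isSelfAdjoint_iff_isSymmetric,
    LinearMap.isSymmetric_iff_inner_map_self_real]
  intro v
  change (starRingEnd ℂ) ⟪-Complex.I • B v, v⟫_ℂ = ⟪-Complex.I • B v, v⟫_ℂ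
  rw [inner_conj_symm, inner_smul_right, inner_smul_left, ← inner_conj_symm (B v)]
  have h1 : (starRingEnd ℂ) ⟪v, B v⟫_ℂ = -⟪v, B v⟫_ℂ := by
    have := RCLike.add_conj ⟪v, B v⟫_ℂ
    rw [hB] at this
    rw [eq_neg_iff_add_eq_zero, add_comm, this]
    simp
  rw [h1]
  simp

/-- The generator of a norm continuous unitary part. -/
theorem exists_unitary_part_eq_exp [CompleteSpace K₀] (hV : IsC0Isometric V)
    (hW : IsWoldDecomposition V K₀) (hN : Continuous fun t => V t ∘L K₀.subtypeL) :
    ∃ B : K₀ →L[ℂ] K₀, (∀ x, RCLike.re ⟪x, B x⟫_ℂ = 0) ∧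
      ∀ (t : ℝ≥0) (x : K₀), ((expSemigroup B t x : K₀) : K) = V t x := by
  let U : ℝ≥0 → K₀ →L[ℂ] K₀ := fun t => K₀.orthogonalProjectionOnto ∘L V t ∘L K₀.subtypeL
  have hU : ∀ t (x : K₀), (U t x : K) = V t x := fun t x =>
    Submodule.starProjection_eq_self_iff.2 ((hW.unitary t).map_mem x x.2)
  obtain ⟨B, hB⟩ := exists_eq_exp_of_continuous (U := U)
    (by
      ext x
      rw [hU, hV.map_zero]
      rfl)
    (fun s t => by
      ext x
      change _ = (U s (U t x) : K)
      rw [hU, hU, hU, hV.map_add]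
      rfl)
    (continuous_const.clm_comp hN)
  refine ⟨B, re_inner_eq_zero_of_norm_exp fun t x => ?_, fun t x => by
    rw [← hU, hB]
    rfl⟩
  rw [← hB]
  change ‖(U t x : K)‖ = _
  rw [hU, hV.norm_map]
  rfl

/-- A norm continuous unitary part is the Hilbert–Schmidt perturbation of a stable dissipative
flow. -/
theorem exists_isDissipativeFlow [TopologicalSpace.SeparableSpace K] [CompleteSpace K₀]
    (hV : IsC0Isometric V) (hW : IsWoldDecomposition V K₀)
    (hN : Continuous fun t => V t ∘L K₀.subtypeL) :
    ∃ (E : ℝ → K →L[ℂ] K) (g : K), IsDissipativeFlow K₀.starProjection E g ∧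
      ∀ t : ℝ≥0, HasFiniteHSNorm (E t - V t ∘L K₀.starProjection) := by
  have : SecondCountableTopology K := UniformSpace.secondCountable_of_separable K
  obtain ⟨B, hB, hVB⟩ := exists_unitary_part_eq_exp hV hW hN
  obtain ⟨G, g, hG, hHS, hst⟩ :=
    exists_stable_perturbation (isSelfAdjoint_of_re_inner_eq_zero hB)
  -- The selfadjoint operator is `-i B`, so `i A` is `B` again.
  rw [smul_smul, mul_neg, Complex.I_mul_I, neg_neg, one_smul] at hHS
  have hcontr : ∀ t : ℝ, 0 ≤ t → ∀ x, ‖expSemigroup G t x‖ ≤ ‖x‖ := fun t ht => norm_exp_smul_le hG ht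
  let E : ℝ → K →L[ℂ] K := fun t => K₀.subtypeL ∘L expSemigroup G t ∘L K₀.orthogonalProjectionOnto
  have hE : ∀ t x, E t x = (expSemigroup G t (K₀.orthogonalProjectionOnto x) : K₀) := fun _ _ => rfl
  refine ⟨E, g, ⟨?_, fun s t _ _ => ?_, ?_, ?_, fun t _ x => ?_, fun x => ?_⟩, fun t => ?_⟩
  · ext x
    rw [hE, expSemigroup, zero_smul, NormedSpace.exp_zero]
    rfl
  · ext x
    change E (s + t) x = E s (E t x)
    rw [hE, hE, hE, Submodule.orthogonalProjectionOnto_mem_subspace_eq_self, expSemigroup,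
      exp_add_smul]
    rfl
  · exact continuous_const.clm_comp ((continuous_exp_smul G).clm_comp continuous_const)
  · exact Submodule.starProjection_eq_self_iff.2 g.2
  · exact energy_exp_smul hG t (K₀.orthogonalProjectionOnto x)
  · have h1 : ∀ t, ContinuousLinearMap.adjoint (E t) x =
        (ContinuousLinearMap.adjoint (expSemigroup G t) (K₀.orthogonalProjectionOnto x) : K₀) := by
      intro t
      refine ext_inner_right ℂ fun y => ?_
      rw [ContinuousLinearMap.adjoint_inner_left, hE,
        ← Submodule.inner_orthogonalProjectionOnto_eq_of_mem_right,
        ← Submodule.inner_orthogonalProjectionOnto_eq_of_mem_left]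
      exact (ContinuousLinearMap.adjoint_inner_left _ _ _).symm
    simp only [h1]
    have := (continuous_subtype_val.tendsto (0 : K₀)).comp (hst (K₀.orthogonalProjectionOnto x))
    exact this
  · have h1 : E t - V t ∘L K₀.starProjection =
        K₀.subtypeL ∘L (expSemigroup G t - expSemigroup B t) ∘L
          K₀.orthogonalProjectionOnto := by
      ext x
      change E t x - V t (K₀.orthogonalProjectionOnto x : K) = _
      rw [← hVB, hE]
      rfl
    rw [h1]
    exact ((hasFiniteHSNorm_exp_sub_exp hB hcontr hHS t.coe_nonneg).comp_right _).comp_left _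

end UnitaryPart

/-! ### Compressions by coisometries -/

section Conjugation

variable {K : Type*} [NormedAddCommGroup K] [InnerProductSpace ℂ K] [CompleteSpace K]
  {V : ℝ≥0 → K →L[ℂ] K} {K₀ : Submodule ℂ K} [K₀.HasOrthogonalProjection] {Ω : K →L[ℂ] K}

/-- The compression `Ω V Ω*` of a semigroup by a coisometry. -/
noncomputable def conjugate {K' : Type*} [NormedAddCommGroup K'] [InnerProductSpace ℂ K']
    [CompleteSpace K'] (Ω : K' →L[ℂ] K') (V : ℝ≥0 → K' →L[ℂ] K') (t : ℝ≥0) : K' →L[ℂ] K' :=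
  Ω ∘L V t ∘L ContinuousLinearMap.adjoint Ω

theorem conjugate_apply (Ω : K →L[ℂ] K) (V : ℝ≥0 → K →L[ℂ] K) (t : ℝ≥0) (x : K) :
    conjugate Ω V t x = Ω (V t (ContinuousLinearMap.adjoint Ω x)) := rfl

theorem adjoint_conjugate (Ω : K →L[ℂ] K) (V : ℝ≥0 → K →L[ℂ] K) (t : ℝ≥0) (x : K) :
    ContinuousLinearMap.adjoint (conjugate Ω V t) x =
      Ω (ContinuousLinearMap.adjoint (V t) (ContinuousLinearMap.adjoint Ω x)) := by
  refine ext_inner_left ℂ fun y => ?_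
  rw [ContinuousLinearMap.adjoint_inner_right, conjugate_apply,
    ← ContinuousLinearMap.adjoint_inner_right, ← ContinuousLinearMap.adjoint_inner_right,
    ← ContinuousLinearMap.adjoint_inner_left Ω]

/-- `Ω` is a coisometry with kernel `K₀`. -/
structure IsCoisometryWithKernel (K₀ : Submodule ℂ K) [K₀.HasOrthogonalProjection]
    (Ω : K →L[ℂ] K) : Prop where
  apply_adjoint : ∀ y, Ω (ContinuousLinearMap.adjoint Ω y) = y
  adjoint_apply : ∀ y, ContinuousLinearMap.adjoint Ω (Ω y) = y - K₀.starProjection y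

namespace IsCoisometryWithKernel

variable (hΩ : IsCoisometryWithKernel K₀ Ω)
include hΩ

theorem norm_adjoint (y : K) : ‖ContinuousLinearMap.adjoint Ω y‖ = ‖y‖ := by
  rw [← sq_eq_sq₀ (norm_nonneg _) (norm_nonneg _), ← inner_self_eq_norm_sq (𝕜 := ℂ),
    ContinuousLinearMap.adjoint_inner_left, hΩ.apply_adjoint, inner_self_eq_norm_sq (𝕜 := ℂ)]

theorem adjoint_mem (y : K) : ContinuousLinearMap.adjoint Ω y ∈ K₀ᗮ := by
  have h := hΩ.adjoint_apply (ContinuousLinearMap.adjoint Ω y)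
  rw [hΩ.apply_adjoint, eq_comm, sub_eq_self] at h
  exact starProjection_eq_zero_iff.1 h

theorem adjoint_apply_of_mem {y : K} (hy : y ∈ K₀ᗮ) : ContinuousLinearMap.adjoint Ω (Ω y) = y := by
  rw [hΩ.adjoint_apply, starProjection_eq_zero_iff.2 hy, sub_zero]

theorem apply_eq_zero {y : K} (hy : y ∈ K₀) : Ω y = 0 := by
  rw [← hΩ.apply_adjoint (Ω y), hΩ.adjoint_apply, Submodule.starProjection_eq_self_iff.2 hy,
    sub_self, map_zero]

section Conjugate

variable (hV : IsC0Isometric V) (hW : IsWoldDecomposition V K₀)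

-- `Ω*` is an isometry onto `K₀ᗮ`, and it identifies the compression with the restriction of `V` to
-- `K₀ᗮ`.
include hW in
theorem adjoint_conjugate_apply (t : ℝ≥0) (y : K) :
    ContinuousLinearMap.adjoint Ω (conjugate Ω V t y) = V t (ContinuousLinearMap.adjoint Ω y) :=
  hΩ.adjoint_apply_of_mem (hW.map_orthogonal t (hΩ.adjoint_mem y))

include hV hW

/-- A subspace reducing the compression to a unitary is carried by `Ω*` to one in `K₀ᗮ` reducing `V
t` to a unitary, which is zero. -/
theorem isC0CompletelyNonunitary_conjugate : IsC0CompletelyNonunitary (conjugate Ω V) := by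
  have hnorm : ∀ t x, ‖conjugate Ω V t x‖ = ‖x‖ := fun t x => by
    rw [← hΩ.norm_adjoint, hΩ.adjoint_conjugate_apply hW, hV.norm_map, hΩ.norm_adjoint]
  refine ⟨⟨⟨?_, fun s t => ?_, fun x => ?_⟩, hnorm⟩, fun t ht => ⟨hnorm t, fun L hL => ?_⟩⟩
  · ext x
    rw [conjugate_apply, hV.map_zero]
    exact hΩ.apply_adjoint x
  · ext x
    rw [ContinuousLinearMap.comp_apply, conjugate_apply, conjugate_apply Ω V s,
      hΩ.adjoint_conjugate_apply hW, hV.map_add]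
    rfl
  · exact Ω.continuous.comp (hV.continuous _)
  · set J := ContinuousLinearMap.adjoint Ω with hJ
    have hJi : Isometry J := AddMonoidHomClass.isometry_of_norm _ hΩ.norm_adjoint
    have hmap : L.map (J : K →ₗ[ℂ] K) = ⊥ := by
      refine hW.completelyNonunitary t ht _ ?_ ⟨?_, ?_, ?_, fun x _ => hV.norm_map t x, ?_⟩
      · rintro _ ⟨x, -, rfl⟩
        exact hΩ.adjoint_mem x
      · rw [Submodule.map_coe]
        exact hJi.isClosedEmbedding.isClosedMap _ hL.isClosed
      · rintro _ ⟨x, hx, rfl⟩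
        exact ⟨_, hL.map_mem x hx, hΩ.adjoint_conjugate_apply hW t x⟩
      · rintro _ ⟨x, hx, rfl⟩
        refine ⟨_, hL.adjoint_mem x hx, ?_⟩
        change J (ContinuousLinearMap.adjoint (conjugate Ω V t) x) = _
        rw [adjoint_conjugate]
        exact hΩ.adjoint_apply_of_mem (hW.adjoint_orthogonal t (hΩ.adjoint_mem x))
      · rintro _ ⟨y, hy, rfl⟩
        obtain ⟨x, hx, rfl⟩ := hL.surj y hy
        exact ⟨J x, ⟨x, hx, rfl⟩, (hΩ.adjoint_conjugate_apply hW t x).symm⟩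
    refine (Submodule.eq_bot_iff L).2 fun x hx => hJi.injective ?_
    rw [map_zero]
    exact (Submodule.mem_bot ℂ).1 (hmap ▸ Submodule.mem_map_of_mem hx)

/-- Deficiency vectors of `V` are orthogonal to `K₀`, so `Ω*` maps the deficiency subspace of the
compression onto that of `V`. -/
theorem deficiencyIndex_conjugate : deficiencyIndex (conjugate Ω V) = deficiencyIndex V := by
  set J := ContinuousLinearMap.adjoint Ω with hJ
  have hS := hΩ.isC0CompletelyNonunitary_conjugate hV hW
  have hJinj : Function.Injective (J : K →ₗ[ℂ] K) :=
    (AddMonoidHomClass.isometry_of_norm J hΩ.norm_adjoint).injective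
  have horth : ∀ x ∈ deficiencySubspace V, x ∈ K₀ᗮ := by
    intro x hx
    rw [mem_deficiencySubspace_iff hV.toIsC0Semigroup] at hx
    rw [Submodule.mem_orthogonal']
    intro z hz
    -- Each `z` in `K₀` is `V t y` with `‖y‖ = ‖z‖`, for every `t`.
    have hle : ∀ t : ℝ≥0, ‖⟪x, z⟫_ℂ‖ ≤ Real.exp (-t) * (‖x‖ * ‖z‖) := by
      intro t
      obtain ⟨y, -, rfl⟩ := (hW.unitary t).surj z hz
      rw [hx, norm_mul, Complex.norm_real, Real.norm_of_nonneg (Real.exp_pos _).le, hV.norm_map]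
      exact mul_le_mul_of_nonneg_left (norm_inner_le_norm _ _) (Real.exp_pos _).le
    have hlim : Filter.Tendsto (fun t : ℝ≥0 => Real.exp (-t) * (‖x‖ * ‖z‖)) Filter.atTop (𝓝 0) := by
      have h1 := (Real.tendsto_exp_neg_atTop_nhds_zero.comp
        (NNReal.tendsto_coe_atTop.2 Filter.tendsto_id)).mul_const (‖x‖ * ‖z‖)
      simpa using h1
    have := ge_of_tendsto' hlim hle
    simpa using this
  have hmap : deficiencySubspace V = (deficiencySubspace (conjugate Ω V)).map (J : K →ₗ[ℂ] K) := by
    have hJJ : ∀ x y, ⟪J x, J y⟫_ℂ = ⟪x, y⟫_ℂ := fun x y => by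
      rw [hJ, ContinuousLinearMap.adjoint_inner_left, hΩ.apply_adjoint]
    have hVJ : ∀ t x y, ⟪J x, V t y⟫_ℂ = ⟪x, conjugate Ω V t (Ω y)⟫_ℂ := fun t x y => by
      rw [← hJJ x, hΩ.adjoint_conjugate_apply hW, hΩ.adjoint_apply, map_sub, inner_sub_right,
        Submodule.inner_left_of_mem_orthogonal ((hW.unitary t).map_mem _
          (Submodule.starProjection_apply_mem _ _)) (hΩ.adjoint_mem x), sub_zero]
    have hJS : ∀ x, J x ∈ deficiencySubspace V ↔ x ∈ deficiencySubspace (conjugate Ω V) := by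
      intro x
      rw [mem_deficiencySubspace_iff hS.toIsC0Semigroup,
        mem_deficiencySubspace_iff hV.toIsC0Semigroup]
      constructor
      · intro h t y
        have := h t (J y)
        rwa [hVJ, hΩ.apply_adjoint, hJJ] at this
      · intro h t y
        rw [hVJ, h, hJ, ContinuousLinearMap.adjoint_inner_left]
    ext x
    constructor
    · intro hx
      have hxJ : J (Ω x) = x := hΩ.adjoint_apply_of_mem (horth x hx)
      exact ⟨Ω x, (hJS _).1 (hxJ.symm ▸ hx), hxJ⟩
    · rintro ⟨x, hx, rfl⟩
      exact (hJS x).2 hx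
  rw [deficiencyIndex, deficiencyIndex, hmap]
  exact congrArg _ (LinearEquiv.rank_eq (Submodule.equivMapOfInjective _ hJinj _))

end Conjugate

end IsCoisometryWithKernel

end Conjugation

/-! ### Compressions of unitary dilations -/

section Dilation

universe u

variable {K : Type u} [NormedAddCommGroup K] [InnerProductSpace ℂ K] [CompleteSpace K]
  {K' : Type u} [NormedAddCommGroup K'] [InnerProductSpace ℂ K'] [CompleteSpace K']

/-- The adjoint of an isometric embedding. -/
noncomputable def embeddingAdjoint (ι : K →ₗᵢ[ℂ] K') : K' →L[ℂ] K :=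
  ContinuousLinearMap.adjoint ι.toContinuousLinearMap

theorem inner_embeddingAdjoint (ι : K →ₗᵢ[ℂ] K') (x : K) (z : K') :
    ⟪x, embeddingAdjoint ι z⟫_ℂ = ⟪ι x, z⟫_ℂ :=
  ContinuousLinearMap.adjoint_inner_right _ _ _

theorem embeddingAdjoint_apply (ι : K →ₗᵢ[ℂ] K') (x : K) : embeddingAdjoint ι (ι x) = x :=
  ext_inner_left ℂ fun y => by rw [inner_embeddingAdjoint, ι.inner_map_map]

theorem embeddingAdjoint_eq_zero_iff (ι : K →ₗᵢ[ℂ] K') {z : K'} :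
    embeddingAdjoint ι z = 0 ↔ z ∈ (LinearMap.range ι.toLinearMap)ᗮ := by
  rw [Submodule.mem_orthogonal]
  constructor
  · rintro h _ ⟨x, rfl⟩
    change ⟪ι x, z⟫_ℂ = 0
    rw [← inner_embeddingAdjoint, h, inner_zero_right]
  · intro h
    refine ext_inner_left ℂ fun x => ?_
    rw [inner_embeddingAdjoint, inner_zero_right]
    exact h _ ⟨x, rfl⟩

/-- The extension of an operator on `K` to `K' ⊇ K` by the identity on `K' ⊖ K`. -/
noncomputable def extendByOne (ι : K →ₗᵢ[ℂ] K') (Ω : K →L[ℂ] K) : K' →L[ℂ] K' :=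
  1 + ι.toContinuousLinearMap ∘L (Ω - 1) ∘L embeddingAdjoint ι

theorem extendByOne_apply (ι : K →ₗᵢ[ℂ] K') (Ω : K →L[ℂ] K) (z : K') : extendByOne ι Ω z =
    z + ι (Ω (embeddingAdjoint ι z) - embeddingAdjoint ι z) := rfl

theorem extendByOne_embedding (ι : K →ₗᵢ[ℂ] K') (Ω : K →L[ℂ] K) (x : K) :
    extendByOne ι Ω (ι x) = ι (Ω x) := by
  rw [extendByOne_apply, embeddingAdjoint_apply, map_sub, add_sub_cancel]

theorem extendByOne_of_eq_zero (ι : K →ₗᵢ[ℂ] K') (Ω : K →L[ℂ] K) {z : K'}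
    (hz : embeddingAdjoint ι z = 0) : extendByOne ι Ω z = z := by
  rw [extendByOne_apply, hz]
  simp

theorem embeddingAdjoint_extendByOne (ι : K →ₗᵢ[ℂ] K') (Ω : K →L[ℂ] K) (z : K') :
    embeddingAdjoint ι (extendByOne ι Ω z) = Ω (embeddingAdjoint ι z) := by
  rw [extendByOne_apply, map_add, embeddingAdjoint_apply, add_sub_cancel]

theorem adjoint_extendByOne (ι : K →ₗᵢ[ℂ] K') (Ω : K →L[ℂ] K) :
    ContinuousLinearMap.adjoint (extendByOne ι Ω) =
      extendByOne ι (ContinuousLinearMap.adjoint Ω) := by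
  symm
  refine (ContinuousLinearMap.eq_adjoint_iff _ _).2 fun x y => ?_
  rw [extendByOne_apply, extendByOne_apply, inner_add_left, inner_add_right,
    ← inner_embeddingAdjoint, ← inner_conj_symm x (ι _), ← inner_embeddingAdjoint, inner_conj_symm,
    inner_sub_left, inner_sub_right, ContinuousLinearMap.adjoint_inner_left]

variable {V : ℝ≥0 → K →L[ℂ] K} {K₀ : Submodule ℂ K} {Ω : K →L[ℂ] K}
  {ι : K →ₗᵢ[ℂ] K'} {V' : ℝ≥0 → K' →L[ℂ] K'}

theorem IsWoldDecomposition.adjoint_embedding (hW : IsWoldDecomposition V K₀)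
    (hV' : IsC0Unitary V') (hι : ∀ t x, V' t (ι x) = ι (V t x)) (t : ℝ≥0) {x : K} (hx : x ∈ K₀) :
    ∃ y ∈ K₀, ContinuousLinearMap.adjoint (V' t) (ι x) = ι y := by
  obtain ⟨y, hy, rfl⟩ := (hW.unitary t).surj x hx
  refine ⟨y, hy, ?_⟩
  rw [← hι]
  exact congrArg (fun A : K' →L[ℂ] K' => A (ι y)) (hV'.unitary t).1

/-- `V'` leaves `K` invariant, so `(V' t)*` leaves `K' ⊖ K` invariant, and there the extension and
its adjoint are the identity. -/
theorem conjugate_extendByOne_adjoint_apply (hV' : IsC0Unitary V')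
    (hι : ∀ t x, V' t (ι x) = ι (V t x)) (t : ℝ≥0) {z : K'}
    (hz : z ∈ (LinearMap.range ι.toLinearMap)ᗮ) :
    conjugate (extendByOne ι Ω) V' t (ContinuousLinearMap.adjoint (V' t) z) = z := by
  have hz' := (embeddingAdjoint_eq_zero_iff ι).2 hz
  have h1 : embeddingAdjoint ι (ContinuousLinearMap.adjoint (V' t) z) = 0 := by
    refine ext_inner_left ℂ fun x => ?_
    rw [inner_embeddingAdjoint, ContinuousLinearMap.adjoint_inner_right, hι,
      ← inner_embeddingAdjoint, hz', inner_zero_right, inner_zero_right]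
  have h2 : V' t (ContinuousLinearMap.adjoint (V' t) z) = z :=
    congrArg (fun A : K' →L[ℂ] K' => A z) (hV'.unitary t).2
  rw [conjugate_apply, adjoint_extendByOne, extendByOne_of_eq_zero ι _ h1, h2,
    extendByOne_of_eq_zero ι _ hz']

variable [K₀.HasOrthogonalProjection]

namespace IsCoisometryWithKernel

variable (hΩ : IsCoisometryWithKernel K₀ Ω)
include hΩ

theorem extendByOne_adjoint_apply (z : K') : extendByOne ι Ω
    (ContinuousLinearMap.adjoint (extendByOne ι Ω) z) = z := by
  rw [adjoint_extendByOne, extendByOne_apply, embeddingAdjoint_extendByOne, hΩ.apply_adjoint,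
    extendByOne_apply, add_assoc, ← map_add]
  simp

theorem adjoint_extendByOne_apply (z : K') : ContinuousLinearMap.adjoint (extendByOne ι Ω)
    (extendByOne ι Ω z) = z - ι (K₀.starProjection (embeddingAdjoint ι z)) := by
  rw [adjoint_extendByOne, extendByOne_apply, embeddingAdjoint_extendByOne, hΩ.adjoint_apply,
    extendByOne_apply, add_assoc, ← map_add, sub_add_sub_cancel', sub_sub_cancel_left, map_neg,
    sub_eq_add_neg]

theorem extendByOne_eq_zero {x : K} (hx : x ∈ K₀) : extendByOne ι Ω (ι x) = 0 := by
  rw [extendByOne_embedding, hΩ.apply_eq_zero hx, map_zero]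

/-- The minimal unitary dilation of the compression `Ω V Ω*`. -/
theorem isMinimalUnitaryDilation_conjugate (hW : IsWoldDecomposition V K₀)
    (hV' : IsMinimalUnitaryDilation ι V V') (hι : ∀ t x, V' t (ι x) = ι (V t x)) :
    IsMinimalUnitaryDilation ι (conjugate Ω V) (conjugate (extendByOne ι Ω) V') := by
  set X := extendByOne ι Ω with hX
  have hXX : ∀ z, X (ContinuousLinearMap.adjoint X z) = z := hΩ.extendByOne_adjoint_apply
  have hXX' : ∀ z, ContinuousLinearMap.adjoint X (X z) =
      z - ι (K₀.starProjection (embeddingAdjoint ι z)) := hΩ.adjoint_extendByOne_apply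
  have hU : ∀ t z, ContinuousLinearMap.adjoint (V' t) (V' t z) = z := fun t z =>
    congrArg (fun A : K' →L[ℂ] K' => A z) (hV'.isC0Unitary.unitary t).1
  have hU' : ∀ t z, V' t (ContinuousLinearMap.adjoint (V' t) z) = z := fun t z =>
    congrArg (fun A : K' →L[ℂ] K' => A z) (hV'.isC0Unitary.unitary t).2
  have hXadj : ∀ x, ContinuousLinearMap.adjoint X (ι x) = ι (ContinuousLinearMap.adjoint Ω x) :=
    fun x => by rw [hX, adjoint_extendByOne, extendByOne_embedding]
  -- the kernel of `X` reduces `V'`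
  have hXV : ∀ t z, X (V' t (ContinuousLinearMap.adjoint X (X z))) = X (V' t z) := by
    intro t z
    rw [hXX', map_sub, map_sub, hι, hΩ.extendByOne_eq_zero ((hW.unitary t).map_mem _
      (Submodule.starProjection_apply_mem _ _)), sub_zero]
  have hXV' : ∀ t z, X (ContinuousLinearMap.adjoint (V' t) (ContinuousLinearMap.adjoint X (X z))) =
      X (ContinuousLinearMap.adjoint (V' t) z) := by
    intro t z
    obtain ⟨y, hy, hyz⟩ := hW.adjoint_embedding hV'.isC0Unitary hι t
      (Submodule.starProjection_apply_mem K₀ (embeddingAdjoint ι z))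
    rw [hXX', map_sub, map_sub, hyz, hΩ.extendByOne_eq_zero hy, sub_zero]
  refine ⟨⟨⟨?_, fun s t => ?_, fun x => X.continuous.comp (hV'.isC0Unitary.continuous _)⟩,
    fun t => ?_⟩, fun t x y => ?_, ?_⟩
  · ext z
    rw [conjugate_apply, hV'.isC0Unitary.map_zero]
    exact hXX z
  · ext z
    rw [ContinuousLinearMap.comp_apply, conjugate_apply, conjugate_apply X V' s,
      conjugate_apply, hXV, hV'.isC0Unitary.map_add]
    rfl
  · constructor
    · ext z
      change ContinuousLinearMap.adjoint (conjugate X V' t) (conjugate X V' t z) = z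
      rw [adjoint_conjugate, conjugate_apply, hXV', hU, hXX]
    · ext z
      change conjugate X V' t (ContinuousLinearMap.adjoint (conjugate X V' t) z) = z
      rw [adjoint_conjugate, conjugate_apply, hXV, hU', hXX]
  · rw [conjugate_apply, ← ContinuousLinearMap.adjoint_inner_left, hXadj, hXadj, hι,
      ι.inner_map_map, ContinuousLinearMap.adjoint_inner_left, conjugate_apply]
  -- The coisometry maps the generating vectors of the dilation of `V` to generating vectors of the
  -- new one, and it is onto; so minimality is inherited.
  · rw [eq_top_iff]
    set M := (Submodule.span ℂ {z | ∃ t x, z = conjugate X V' t (ι x) ∨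
      z = ContinuousLinearMap.adjoint (conjugate X V' t) (ι x)}).topologicalClosure with hM
    have hle : (Submodule.span ℂ {z | ∃ t x, z = V' t (ι x) ∨
        z = ContinuousLinearMap.adjoint (V' t) (ι x)}).topologicalClosure ≤
          M.comap (X : K' →ₗ[ℂ] K') := by
      refine Submodule.topologicalClosure_minimal _ (Submodule.span_le.2 ?_)
        ((Submodule.isClosed_topologicalClosure _).preimage X.continuous)
      rintro _ ⟨t, x, rfl | rfl⟩
      · refine Submodule.le_topologicalClosure _ (Submodule.subset_span ⟨t, Ω x, Or.inl ?_⟩)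
        rw [conjugate_apply, ← extendByOne_embedding, hXV]
        rfl
      · refine Submodule.le_topologicalClosure _ (Submodule.subset_span ⟨t, Ω x, Or.inr ?_⟩)
        rw [adjoint_conjugate, ← extendByOne_embedding, hXV']
        rfl
    rw [hV'.minimal] at hle
    intro z _
    have := hle (Submodule.mem_top (x := ContinuousLinearMap.adjoint X z))
    change X _ ∈ M at this
    rwa [hXX] at this

/-- The difference is `(X V' - V' X) X*`. The commutator acts on `K` as `Ω V - V Ω`; for `z` in `K'
⊖ K` it is `(Ω - 1)` applied to the `K` component of `V' t z`. -/
theorem hasFiniteHSNorm_conjugate_sub (hV' : IsC0Unitary V')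
    (hι : ∀ t x, V' t (ι x) = ι (V t x)) (t : ℝ≥0) (h1 : HasFiniteHSNorm (Ω ∘L V t - V t ∘L Ω))
    (h2 : HasFiniteHSNorm ((Ω - 1) ∘L (1 - V t ∘L ContinuousLinearMap.adjoint (V t)))) :
    HasFiniteHSNorm (conjugate (extendByOne ι Ω) V' t - V' t) := by
  set X := extendByOne ι Ω with hX
  set R := embeddingAdjoint ι with hR
  have h3 : conjugate X V' t - V' t =
      (ι.toContinuousLinearMap ∘L (Ω ∘L V t - V t ∘L Ω) ∘L R +
        ι.toContinuousLinearMap ∘L ((Ω - 1) ∘L (1 - V t ∘L ContinuousLinearMap.adjoint (V t))) ∘L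
          R ∘L V' t ∘L (1 - ι.toContinuousLinearMap ∘L R)) ∘L ContinuousLinearMap.adjoint X := by
    ext z
    set y := ContinuousLinearMap.adjoint X z with hy
    have hz : z = X y := (hΩ.extendByOne_adjoint_apply z).symm
    -- `V' t` keeps `K' ⊖ K` orthogonal to `V' t K = V t K`, so the `K` component lies in the kernel
    -- of `(V t)*`. This allows the insertion of `1 - V V*`.
    have h4 : ContinuousLinearMap.adjoint (V t) (R (V' t (y - ι (R y)))) = 0 := by
      refine ext_inner_left ℂ fun x => ?_
      rw [ContinuousLinearMap.adjoint_inner_right, inner_embeddingAdjoint, ← hι,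
        ← ContinuousLinearMap.adjoint_inner_left,
        show ContinuousLinearMap.adjoint (V' t) (V' t (ι x)) = ι x from
          congrArg (fun A : K' →L[ℂ] K' => A (ι x)) (hV'.unitary t).1,
        ← inner_embeddingAdjoint, map_sub, hR, embeddingAdjoint_apply, sub_self, inner_zero_right]
    have h5 : R (V' t (y - ι (R y))) = R (V' t y) - V t (R y) := by
      rw [map_sub, map_sub, hι, hR, embeddingAdjoint_apply]
    change X (V' t y) - V' t z = ι (Ω (V t (R y)) - V t (Ω (R y))) +
      ι (Ω (R (V' t (y - ι (R y))) - V t (ContinuousLinearMap.adjoint (V t) (R (V' t (y - ι (R y)))))) -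
        (R (V' t (y - ι (R y))) - V t (ContinuousLinearMap.adjoint (V t) (R (V' t (y - ι (R y)))))))
    rw [h4, map_zero, sub_zero, h5, hz, hX, extendByOne_apply, extendByOne_apply, map_add, hι]
    simp only [map_sub, ← hR]
    abel
  rw [h3]
  exact (((h1.comp_right R).comp_left _).add ((h2.comp_right _).comp_left _)).comp_right _

end IsCoisometryWithKernel

end Dilation

/-! ### Assembly under condition N. -/

section ConditionN

variable {K : Type*} [NormedAddCommGroup K] [InnerProductSpace ℂ K] {V : ℝ≥0 → K →L[ℂ] K}

theorem exists_norm_one_mem_deficiencySubspace (h : 0 < deficiencyIndex V) :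
    ∃ x ∈ deficiencySubspace V, ‖x‖ = 1 := by
  have hne : deficiencySubspace V ≠ ⊥ := by
    intro h0
    rw [deficiencyIndex, h0] at h
    simp at h
  obtain ⟨x, hx, hx0⟩ := Submodule.exists_mem_ne_zero_of_ne_bot hne
  exact ⟨(‖x‖ : ℂ)⁻¹ • x, Submodule.smul_mem _ _ hx, norm_smul_inv_norm hx0⟩

/-- A semigroup with nonzero deficiency index and norm continuous unitary part is carried by a
coisometry to a completely nonunitary one, up to Hilbert–Schmidt operators. -/
theorem exists_isCoisometryWithKernel [CompleteSpace K] [TopologicalSpace.SeparableSpace K]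
    (hV : IsC0Isometric V) (hd : 0 < deficiencyIndex V) {K₀ : Submodule ℂ K} [CompleteSpace K₀]
    (hW : IsWoldDecomposition V K₀) (hN : Continuous fun t => V t ∘L K₀.subtypeL) :
    ∃ Ω : K →L[ℂ] K, IsCoisometryWithKernel K₀ Ω ∧
      ∀ t, HasFiniteHSNorm (Ω ∘L V t - V t ∘L Ω) ∧
        HasFiniteHSNorm ((Ω - 1) ∘L (1 - V t ∘L ContinuousLinearMap.adjoint (V t))) := by
  obtain ⟨h, hh, hn⟩ := exists_norm_one_mem_deficiencySubspace hd
  obtain ⟨b, hb⟩ := exists_isOrthogonalCocycle hV hn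
    ((mem_deficiencySubspace_iff hV.toIsC0Semigroup h).1 hh)
  obtain ⟨E, g, hE, hEV⟩ := exists_isDissipativeFlow hV hW hN
  obtain ⟨Ω, h1, h2, h3, h4⟩ := exists_almost_commuting_coisometry hW hV hb hE hEV
  exact ⟨Ω, ⟨h1, h2⟩, fun t => ⟨h3 t, h4 t⟩⟩

end ConditionN

end IsometricSemigroup

theorem theorem5 {K : Type*} [NormedAddCommGroup K] [InnerProductSpace ℂ K] [CompleteSpace K]
    [TopologicalSpace.SeparableSpace K] (n : ℕ∞) (hn : 0 < n) (V : ℝ≥0 → K →L[ℂ] K)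
    (hV : IsometricSemigroup.IsC0Isometric V)
    (hVn : IsometricSemigroup.deficiencyIndex V = n)
    (hN : IsometricSemigroup.ConditionN V) :
    ∃ S : ℝ≥0 → K →L[ℂ] K,
      IsometricSemigroup.IsC0CompletelyNonunitary S ∧
      IsometricSemigroup.deficiencyIndex S = n ∧
      IsometricSemigroup.Approximates S V := by
  obtain ⟨K₀, hW, hN⟩ := hN
  have : CompleteSpace K₀ := (hW.unitary 0).isClosed.completeSpace_coe
  obtain ⟨Ω, hΩ, hHS⟩ :=
    IsometricSemigroup.exists_isCoisometryWithKernel hV (hVn ▸ hn) hW hN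
  have hV' := IsometricSemigroup.isMinimalUnitaryDilation_dilation hV
  have hι := IsometricSemigroup.TrajectorySpace.dilation_embed hV
  refine ⟨IsometricSemigroup.conjugate Ω V, hΩ.isC0CompletelyNonunitary_conjugate hV hW,
    (hΩ.deficiencyIndex_conjugate hV hW).trans hVn, _, inferInstance, inferInstance, inferInstance,
    _, _, _, hΩ.isMinimalUnitaryDilation_conjugate hW hV' hι, hV', fun t => ⟨?_, fun z hz => ?_⟩⟩
  · exact (hΩ.hasFiniteHSNorm_conjugate_sub hV'.isC0Unitary hι t (hHS t).1
      (hHS t).2).isHilbertSchmidt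
  · exact IsometricSemigroup.conjugate_extendByOne_adjoint_apply hV'.isC0Unitary hι t hz
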